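/- Let $d\in\{2,3\}$, let $k\ge 1$ be an integer, and let $\rho_v,\rho_e,\theta,\sigma,\delta>0$. Then there are constants $C_1,C_2>0$, depending only on these data, such that the following holds. Let $\Omega\subset\mathbb R^d$ be a bounded domain and $\mathcal T_h$ a finite partition of $\overline\Omega$ into closed, possibly non-convex, polytopal elements $T$ with flat $(d-1)$-dimensional edges/faces $e$; write $h_T,h_e$ for the diameters of $T,e$ and $|T|,|e|$ for their $d$- and $(d-1)$-dimensional measures. Assume that $\mathcal T_h$ is shape regular: for every $T\in\mathcal T_h$ and every edge/face $e$ of $T$, (i) $\rho_v h_T^d\le |T|$ and $\rho_e h_e^{d-1}\le |e|$; (ii) $\theta h_T\le h_e$; (iii) $T$ contains a pyramid with base $e$, apex in $T$ and height at least $\sigma h_T$; (iv) for every other edge/face $e'\neq e$ of $T$, some point of $e$ has distance at least $\delta h_T$ from the hyperplane containing $e'$. Let $V_h$ be the space of pairs $v=\{v_0,v_b\}$ with $v_0|_T\in[P_k(T)]^d$ for each element $T$ and $v_b|_e\in[P_k(e)]^d$ for each edge/face $e$ of the partition ($v_b$ single-valued on each $e$). For an element $T$ with $N$ edges/faces let $r=2N+k-1$,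 or, if $T$ is convex, alternatively $r=N+k-1$, and let the discrete weak gradient $\nabla_w v|_T\in[P_r(T)]^{d\times d}$ be the unique polynomial with $$(\nabla_w v,\varphi)_T=-(v_0,\nabla\cdot\varphi)_T+\langle v_b,\varphi\, n\rangle_{\partial T}\qquad\text{for all }\varphi\in[P_r(T)]^{d\times d},$$ where $n$ is the outward unit normal. Let $\kappa$ be a constant symmetric positive definite $d\times d$ matrix, and put $$|||v|||=\Big(\sum_{T\in\mathcal T_h}\|\nabla_w v\|_T^2+(\kappa^{-1}v_0,v_0)_T\Big)^{1/2},$$ $$\|v\|_{1,h}=\Big(\sum_{T\in\mathcal T_h}\|\nabla v_0\|_T^2+(\kappa^{-1}v_0,v_0)_T+h_T^{-1}\|v_0-v_b\|_{\partial T}^2\Big)^{1/2}.$$ Then, for all $v\in V_h$, $$C_1\|v\|_{1,h}\le |||v|||\le C_2\|v\|_{1,h}.$$ In particular $C_1,C_2$ do not depend on the mesh size $h$, on $\Omega$ or on $\kappa$. -/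

import Mathlib

open MeasureTheory Module

noncomputable section

namespace WG

/-- Points of `ℝ^d`, with the Euclidean metric. -/
abbrev Pt (d : ℕ) := EuclideanSpace ℝ (Fin d)

/-- Real polynomials in `d` variables. -/
abbrev Poly (d : ℕ) := MvPolynomial (Fin d) ℝ

/-- The value of a polynomial at a point. -/
def pval {d : ℕ} (p : Poly d) (x : Pt d) : ℝ := MvPolynomial.eval (fun i => x i) p

/-! ### Polytopal geometry -/

/-- A (not necessarily convex) polytopal set: a finite union of convex hulls of finite sets. -/
def IsPolytopal {d : ℕ} (P : Set (Pt d)) : Prop :=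
  ∃ S : Finset (Finset (Pt d)), P = ⋃ s ∈ S, convexHull ℝ (s : Set (Pt d))

/-- A polytopal element: a polytopal set that is the closure of its connected, nonempty
interior.  No convexity is asked for. -/
structure IsElement {d : ℕ} (T : Set (Pt d)) : Prop where
  polytopal : IsPolytopal T
  connected : IsConnected (interior T)
  regular : closure (interior T) = T

/-- A flat `(d-1)`-dimensional polytopal set (an edge if `d = 2`, a flat face if `d = 3`):
it spans a hyperplane and is the closure of its connected, nonempty relative interior. -/
structure IsFlatFace {d : ℕ} (e : Set (Pt d)) : Prop where
  polytopal : IsPolytopal e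
  hyperplane : finrank ℝ (vectorSpan ℝ e) + 1 = d
  connected : IsConnected (intrinsicInterior ℝ e)
  regular : closure (intrinsicInterior ℝ e) = e

/-- `ν` is the outward unit normal of `T` along the flat face `e`: a unit vector orthogonal to
`e` such that, from each relative interior point of `e`, one leaves `T` along `ν` and enters `T`
along `-ν`. -/
structure IsOutwardNormal {d : ℕ} (T e : Set (Pt d)) (ν : Pt d) : Prop where
  unit : ‖ν‖ = 1
  orthogonal : ∀ w ∈ vectorSpan ℝ e, inner ℝ ν w = 0
  outside : ∀ x ∈ intrinsicInterior ℝ e, ∃ ε > 0, ∀ t : ℝ, 0 < t → t < ε → x + t • ν ∉ T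
  inside : ∀ x ∈ intrinsicInterior ℝ e, ∃ ε > 0, ∀ t : ℝ, 0 < t → t < ε → x - t • ν ∈ T

/-- The outward unit normal of `T` along `e` (unique when it exists, and part of the definition
of a mesh is that it exists). -/
def outwardNormal {d : ℕ} (T e : Set (Pt d)) : Pt d := Classical.epsilon (IsOutwardNormal T e)

open Classical in
/-- The members of a collection `F` of flat faces that lie on the boundary of `T`. -/
def facesOn {d : ℕ} (F : Finset (Set (Pt d))) (T : Set (Pt d)) : Finset (Set (Pt d)) :=
  F.filter fun e => e ⊆ frontier T

/-- A finite partition of the domain `Ω` into polytopal elements, with its set of edges/faces. -/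
structure Mesh (d : ℕ) (Ω : Set (Pt d)) where
  /-- the elements -/
  cells : Finset (Set (Pt d))
  /-- the edges or flat faces -/
  faces : Finset (Set (Pt d))
  isElement : ∀ T ∈ cells, IsElement T
  cover : ⋃ T ∈ cells, T = closure Ω
  cells_disjoint : ∀ T ∈ cells, ∀ T' ∈ cells, T ≠ T' → Disjoint (interior T) (interior T')
  isFlatFace : ∀ e ∈ faces, IsFlatFace e
  faces_disjoint : ∀ e ∈ faces, ∀ e' ∈ faces, e ≠ e' →
    Disjoint (intrinsicInterior ℝ e) (intrinsicInterior ℝ e')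
  face_of_cell : ∀ e ∈ faces, ∃ T ∈ cells, e ∈ facesOn faces T
  boundary : ∀ T ∈ cells, frontier T = ⋃ e ∈ facesOn faces T, e
  normal : ∀ T ∈ cells, ∀ e ∈ facesOn faces T, ∃ ν, IsOutwardNormal T e ν

namespace Mesh

variable {d : ℕ} {Ω : Set (Pt d)}

/-- The edges/faces of the element `T`. -/
def facesOf (M : Mesh d Ω) (T : Set (Pt d)) : Finset (Set (Pt d)) := facesOn M.faces T

/-- The number `N` of edges/faces of the element `T`. -/
def numFaces (M : Mesh d Ω) (T : Set (Pt d)) : ℕ := (M.facesOf T).card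

/-- Shape regularity of a polytopal mesh; `h_T` is the diameter of `T` and `h_e` that of `e`.
The height of a pyramid is the distance of its apex to the hyperplane of its base.  Since
`|x - A| ≤ h_T` on `T`, the height bound already forces the angle between `x - A`, `x ∈ e`, and
the outward normal to be at most `arccos σ < π / 2`. -/
structure ShapeRegular (M : Mesh d Ω) (ρv ρe θ σ : ℝ) : Prop where
  /-- `ρv h_T^d ≤ |T|` -/
  volume_ge : ∀ T ∈ M.cells, ρv * Metric.diam T ^ d ≤ volume.real T
  /-- `ρe h_e^(d-1) ≤ |e|` -/
  area_ge : ∀ T ∈ M.cells, ∀ e ∈ M.facesOf T,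
    ρe * Metric.diam e ^ (d - 1) ≤ (μHE[d - 1] : Measure (Pt d)).real e
  /-- `θ h_T ≤ h_e` -/
  diam_ge : ∀ T ∈ M.cells, ∀ e ∈ M.facesOf T, θ * Metric.diam T ≤ Metric.diam e
  /-- a pyramid with base `e`, apex `A ∈ T` and height at least `σ h_T` is contained in `T` -/
  pyramid : ∀ T ∈ M.cells, ∀ e ∈ M.facesOf T, ∃ A ∈ T,
    convexJoin ℝ {A} e ⊆ T ∧
      σ * Metric.diam T ≤ Metric.infDist A (affineSpan ℝ e : Set (Pt d))

/-- Two distinct edges/faces of an element do not (nearly) lie in a common hyperplane: for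
`e ≠ e'`, some point of `e` has distance at least `δ h_T` from the hyperplane of `e'`.
If `l'` is the linear function vanishing on `e'`, scaled by `h_T`, this says
`|l'| ≥ δ` somewhere on `e`; without it the face bubble function of `e`, the product of the `l'^2`,
vanishes on `e` or has no uniform positive lower bound on a part of `e`. -/
def NoncoplanarFaces (M : Mesh d Ω) (δ : ℝ) : Prop :=
  ∀ T ∈ M.cells, ∀ e ∈ M.facesOf T, ∀ e' ∈ M.facesOf T, e ≠ e' →
    ∃ x ∈ e, δ * Metric.diam T ≤ Metric.infDist x (affineSpan ℝ e' : Set (Pt d))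

/-- Admissible degrees `r_T` of the discrete weak gradient: `2N + k - 1` on any element, where on
convex elements `N + k - 1` may be taken instead (`N` is the number of edges/faces of `T`). -/
def AdmissibleDegree (M : Mesh d Ω) (k : ℕ) (r : Set (Pt d) → ℕ) : Prop :=
  ∀ T ∈ M.cells, r T = 2 * M.numFaces T + k - 1 ∨ (Convex ℝ T ∧ r T = M.numFaces T + k - 1)

end Mesh

/-! ### Weak functions and the discrete weak gradient -/

/-- A pair `{v₀, v_b}`: `v₀` is given on each element and `v_b` on each edge/face (hence is
single-valued across interior faces).  Both are piecewise polynomial vector fields; the values on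
an element, resp. face, are those of the polynomial there, and only these values are used. -/
structure WeakFunction (d : ℕ) where
  /-- the interior part `v₀` on an element -/
  inner : Set (Pt d) → Fin d → Poly d
  /-- the boundary part `v_b` on an edge/face -/
  bdry : Set (Pt d) → Fin d → Poly d

/-- The weak finite element space `V_h`: `v₀ ∈ [P_k(T)]^d` for each element `T` and
`v_b ∈ [P_k(e)]^d` for each edge/face `e`, where `P_k(e)` is the space of restrictions to `e` of
polynomials of total degree at most `k`. -/
structure MemVh {d : ℕ} {Ω : Set (Pt d)} (M : Mesh d Ω) (k : ℕ) (v : WeakFunction d) : Prop where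
  inner_deg : ∀ T ∈ M.cells, ∀ i, (v.inner T i).totalDegree ≤ k
  bdry_deg : ∀ e ∈ M.faces, ∀ i, (v.bdry e i).totalDegree ≤ k

/-- `G ∈ [P_r(T)]^{d×d}` is a discrete weak gradient of `v` on `T`:
`(G, φ)_T = -(v₀, ∇·φ)_T + ⟨v_b, φ n⟩_{∂T}` for all `φ ∈ [P_r(T)]^{d×d}`. -/
structure IsWeakGradient {d : ℕ} {Ω : Set (Pt d)} (M : Mesh d Ω) (r : ℕ) (T : Set (Pt d))
    (v : WeakFunction d) (G : Fin d → Fin d → Poly d) : Prop where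
  deg : ∀ i j, (G i j).totalDegree ≤ r
  eq : ∀ φ : Fin d → Fin d → Poly d, (∀ i j, (φ i j).totalDegree ≤ r) →
    ∫ x in T, ∑ i, ∑ j, pval (G i j) x * pval (φ i j) x =
      -(∫ x in T, ∑ i, pval (v.inner T i) x * ∑ j, pval (MvPolynomial.pderiv j (φ i j)) x)
      + ∑ e ∈ M.facesOf T, ∫ x in e,
          ∑ i, pval (v.bdry e i) x * (∑ j, pval (φ i j) x * outwardNormal T e j) ∂μHE[d - 1]

/-- The discrete weak gradient `∇_{w,r,T} v`, the unique polynomial matrix above. -/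
def weakGradient {d : ℕ} {Ω : Set (Pt d)} (M : Mesh d Ω) (r : ℕ) (T : Set (Pt d))
    (v : WeakFunction d) : Fin d → Fin d → Poly d :=
  Classical.epsilon (IsWeakGradient M r T v)

/-! ### The two norms -/

/-- `(κ⁻¹ v₀, v₀)_T` -/
def reaction {d : ℕ} (κ : Matrix (Fin d) (Fin d) ℝ) (T : Set (Pt d)) (v : WeakFunction d) : ℝ :=
  ∫ x in T, κ⁻¹.mulVec (fun i => pval (v.inner T i) x) ⬝ᵥ (fun i => pval (v.inner T i) x)

/-- The energy norm `|||v|||`. -/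
def energyNorm {d : ℕ} {Ω : Set (Pt d)} (M : Mesh d Ω) (κ : Matrix (Fin d) (Fin d) ℝ)
    (r : Set (Pt d) → ℕ) (v : WeakFunction d) : ℝ :=
  √(∑ T ∈ M.cells,
    ((∫ x in T, ∑ i, ∑ j, pval (weakGradient M (r T) T v i j) x ^ 2) + reaction κ T v))

/-- The discrete `H¹` norm `‖v‖_{1,h}`. -/
def discreteH1Norm {d : ℕ} {Ω : Set (Pt d)} (M : Mesh d Ω) (κ : Matrix (Fin d) (Fin d) ℝ)
    (v : WeakFunction d) : ℝ :=
  √(∑ T ∈ M.cells,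
    ((∫ x in T, ∑ i, ∑ j, pval (MvPolynomial.pderiv j (v.inner T i)) x ^ 2)
      + reaction κ T v
      + (Metric.diam T)⁻¹ * ∑ e ∈ M.facesOf T,
          ∫ x in e, ∑ i, (pval (v.inner T i) x - pval (v.bdry e i) x) ^ 2 ∂μHE[d - 1]))

end WG

end

noncomputable section

namespace WG

/-! ### Polynomials as functions -/

section Poly

variable {d m : ℕ}

/-! Everything happens on one element and for one component of `v` at a time. Integrating by parts
in the definition of the weak gradient gives (∇_w v, φ)_T = (∇v₀, φ)_T + ⟨v_b - v₀, φ n⟩_∂T, which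
is `WeakRelation`. The reaction term is the same in both norms, so κ never enters the constants.

Testing with φ = ∇_w v and using the trace inequality `exists_trace_le` bounds the weak gradient
(`exists_weakGradient_le`). Conversely, let Φ be the product over all faces of the functions cutting
out their hyperplanes, squared so as to be nonnegative on T, or unsquared when T is convex. The test
function Φ∇v₀ removes the boundary term and bounds ∇v₀ in a weighted norm (`exists_gradient_le`).
Leaving the factor of one face e out of Φ, and extending the jump on e constantly along the normal,
isolates the jump on e (`exists_jump_le`). With exponent s = 2 or 1 and N faces these tests have
degree at most sN + k - 1, which is where the admissible degrees come from.

The constants must not depend on the shape of T, and there is no reference element to map to.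
Uniformity comes from a Remez-type inequality: a polynomial of bounded degree on a ball is
controlled by its L² norm on any measurable subset of proportional measure. Applied to the affine
factors of a bubble, it shows that the bubble is small only on a small part of T or e, so the weight
can be dropped (`exists_le_integral_weight`). The number of factors is bounded because the face
hyperplanes form a separated family in a compact parameter set (`exists_card_faces_le`).

The integration by parts needs the divergence theorem on a non-convex polytope. For a direction w,
almost every point lies on a line that crosses the faces one at a time and transversally, and there
the indicator of T is a signed count of the faces lying behind the point. Thus T is, up to a null
set, a signed sum of half-cylinders over its faces, and on each of them the claim is Fubini together
with the fundamental theorem of calculus (`IsFacetedBody.integral_fderiv`). -/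

@[simp] lemma pval_add (p q : Poly d) (x : Pt d) : pval (p + q) x = pval p x + pval q x := by
  simp [pval]

@[simp] lemma pval_sub (p q : Poly d) (x : Pt d) : pval (p - q) x = pval p x - pval q x := by
  simp [pval]

@[simp] lemma pval_mul (p q : Poly d) (x : Pt d) : pval (p * q) x = pval p x * pval q x := by
  simp [pval]

@[simp] lemma pval_pow (p : Poly d) (n : ℕ) (x : Pt d) : pval (p ^ n) x = pval p x ^ n := by
  simp [pval]

@[simp] lemma pval_C (c : ℝ) (x : Pt d) : pval (MvPolynomial.C c : Poly d) x = c := by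
  simp [pval]

@[simp] lemma pval_zero (x : Pt d) : pval (0 : Poly d) x = 0 := by
  simp [pval]

@[simp] lemma pval_smul (c : ℝ) (p : Poly d) (x : Pt d) : pval (c • p) x = c * pval p x := by
  simp [pval, MvPolynomial.smul_eval]

lemma pval_sum {ι : Type*} (s : Finset ι) (f : ι → Poly d) (x : Pt d) :
    pval (∑ i ∈ s, f i) x = ∑ i ∈ s, pval (f i) x := by
  simp [pval, map_sum]

lemma pval_prod {ι : Type*} (s : Finset ι) (f : ι → Poly d) (x : Pt d) :
    pval (∏ i ∈ s, f i) x = ∏ i ∈ s, pval (f i) x := by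
  simp [pval, map_prod]

@[fun_prop]
lemma contDiff_pval (p : Poly d) {n : WithTop ℕ∞} : ContDiff ℝ n (pval p) := by
  induction p using MvPolynomial.induction_on with
  | C a => simpa [funext fun x => pval_C a x] using contDiff_const
  | add p q hp hq =>
    rw [show pval (p + q) = fun x => pval p x + pval q x from funext (pval_add p q)]
    exact hp.add hq
  | mul_X p i hp =>
    rw [show pval (p * MvPolynomial.X i) = fun x => pval p x * x i from
      funext fun x => by simp [pval]]
    exact hp.mul (by fun_prop)

@[fun_prop]
lemma continuous_pval (p : Poly d) : Continuous (pval p) := (contDiff_pval p (n := 0)).continuous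

/-- The partial derivative of a polynomial is its directional derivative along a coordinate. -/
lemma fderiv_pval_single (p : Poly d) (x : Pt d) (j : Fin d) :
    fderiv ℝ (pval p) x (EuclideanSpace.single j 1) = pval (MvPolynomial.pderiv j p) x := by
  have hdiff : ∀ q : Poly d, DifferentiableAt ℝ (pval q) x := fun q =>
    (contDiff_pval q (n := 1)).differentiable one_ne_zero x
  induction p using MvPolynomial.induction_on with
  | C a =>
    rw [show pval (MvPolynomial.C a : Poly d) = fun _ => a from funext (pval_C a)]
    simp
  | add p q hp hq =>
    rw [show pval (p + q) = fun x => pval p x + pval q x from funext (pval_add p q)]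
    rw [fderiv_fun_add (hdiff p) (hdiff q)]
    simp [hp, hq]
  | mul_X p i hp =>
    rw [show pval (p * MvPolynomial.X i) = fun x => pval p x * x i from
      funext fun x => by simp [pval]]
    have hx : HasFDerivAt (fun y : Pt d => y i) (EuclideanSpace.proj i : Pt d →L[ℝ] ℝ) x :=
      (EuclideanSpace.proj i : Pt d →L[ℝ] ℝ).hasFDerivAt
    rw [((hdiff p).hasFDerivAt.fun_mul hx).fderiv]
    by_cases hij : i = j
    · subst hij
      simp [hp, pval]
    · simp [hp, pval, MvPolynomial.pderiv_X_of_ne hij, hij]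

/-- A monomial `s` of the derivative comes from the monomial `s + single j 1` of `p`. The gain of
one degree makes room for the full bubble in `exists_gradient_le`; truncated subtraction is correct
for constants. -/
lemma totalDegree_pderiv_le (p : Poly d) (j : Fin d) :
    (MvPolynomial.pderiv j p).totalDegree ≤ p.totalDegree - 1 := by
  rw [MvPolynomial.totalDegree, Finset.sup_le_iff]
  intro s hs
  have h : MvPolynomial.coeff (s + Finsupp.single j 1) p ≠ 0 := by
    rw [MvPolynomial.mem_support_iff, MvPolynomial.coeff_pderiv] at hs
    exact left_ne_zero_of_mul hs
  have := MvPolynomial.le_totalDegree (MvPolynomial.mem_support_iff.2 h)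
  rw [Finsupp.sum_add_index' (by simp) (by simp)] at this
  simp at this
  omega

/-- The zero set of a nonzero polynomial is a Lebesgue null set. -/
lemma volume_eval_eq_zero {n : ℕ} {p : MvPolynomial (Fin n) ℝ} (hp : p ≠ 0) :
    volume {x : Fin n → ℝ | MvPolynomial.eval x p = 0} = 0 := by
  induction n with
  | zero =>
    obtain ⟨c, rfl⟩ := MvPolynomial.C_surjective (Fin 0) p
    have : c ≠ 0 := by rintro rfl; simp at hp
    simp [this]
  | succ n ih =>
    let e := MeasurableEquiv.piFinSuccAbove (fun _ : Fin (n + 1) => ℝ) 0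
    have he := (volume_preserving_piFinSuccAbove (fun _ : Fin (n + 1) => ℝ) 0).symm
    have hm : MeasurableSet {x : Fin (n + 1) → ℝ | MvPolynomial.eval x p = 0} :=
      (isClosed_eq (MvPolynomial.continuous_eval p) continuous_const).measurableSet
    rw [← he.measure_preimage_equiv, Measure.volume_eq_prod,
      Measure.measure_prod_null (he.measurable hm)]
    -- View `p` as a one-variable polynomial over the domain of polynomials in the other variables.
    -- It has finitely many constant roots `C y`; for every other `y` the slice is a nonzero
    -- polynomial and the induction hypothesis applies.
    set P := MvPolynomial.finSuccEquiv ℝ n p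
    have hP : P ≠ 0 := by simpa [P] using hp
    have hfin : {y : ℝ | Polynomial.eval (MvPolynomial.C y) P = 0}.Finite := by
      have := (Polynomial.finite_setOfPred_isRoot hP).preimage
        (MvPolynomial.C_injective (Fin n) ℝ).injOn
      exact this
    have hae : ∀ᵐ y : ℝ, Polynomial.eval (MvPolynomial.C y) P ≠ 0 :=
      (measure_eq_zero_iff_ae_notMem (s := {y | _})).1 (hfin.measure_zero volume)
    filter_upwards [hae] with y hy
    refine (congrArg volume ?_).trans (ih hy)
    ext s
    have : MvPolynomial.eval s (Polynomial.eval (MvPolynomial.C y) P) =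
        MvPolynomial.eval (Fin.cons y s : Fin (n + 1) → ℝ) p := by
      rw [MvPolynomial.eval_eq_eval_mv_eval', Polynomial.eval_map, Polynomial.eval,
        Polynomial.hom_eval₂]
      simp [P]
    simp [this, Fin.insertNthEquiv, Fin.insertNth_zero']

lemma volume_pval_eq_zero {p : Poly d} (hp : p ≠ 0) : volume {x : Pt d | pval p x = 0} = 0 := by
  have hm : MeasurableSet {x : Fin d → ℝ | MvPolynomial.eval x p = 0} :=
    (isClosed_eq (MvPolynomial.continuous_eval p) continuous_const).measurableSet
  have := (PiLp.volume_preserving_ofLp (Fin d)).measure_preimage hm.nullMeasurableSet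
  rw [volume_eval_eq_zero hp] at this
  exact this

/-- Composition of a polynomial with the affine map `y ↦ x₀ + A y`. -/
def affComp (p : Poly d) (x₀ : Pt d) (A : Pt m →ₗ[ℝ] Pt d) : Poly m :=
  MvPolynomial.bind₁ (fun i => MvPolynomial.C (x₀ i) +
    ∑ j, MvPolynomial.C (A (EuclideanSpace.single j 1) i) * MvPolynomial.X j) p

lemma pval_affComp (p : Poly d) (x₀ : Pt d) (A : Pt m →ₗ[ℝ] Pt d) (y : Pt m) :
    pval (affComp p x₀ A) y = pval p (x₀ + A y) := by
  have hA : ∀ i, A y i = ∑ j, A (EuclideanSpace.single j 1) i * y j := by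
    intro i
    conv_lhs => rw [← (EuclideanSpace.basisFun (Fin m) ℝ).sum_repr y]
    simp [map_sum, mul_comm]
  simp only [pval, affComp]
  rw [← MvPolynomial.coe_aeval_eq_eval, ← MvPolynomial.coe_aeval_eq_eval]
  simp only [RingHom.coe_coe]
  rw [MvPolynomial.aeval_bind₁]
  congr 2
  ext i
  simp [hA]

lemma totalDegree_affComp_le (p : Poly d) (x₀ : Pt d) (A : Pt m →ₗ[ℝ] Pt d) :
    (affComp p x₀ A).totalDegree ≤ p.totalDegree := by
  set g : Fin d → Poly m := fun i => MvPolynomial.C (x₀ i) +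
    ∑ j, MvPolynomial.C (A (EuclideanSpace.single j 1) i) * MvPolynomial.X j
  have hg : ∀ i, (g i).totalDegree ≤ 1 := by
    intro i
    refine (MvPolynomial.totalDegree_add _ _).trans (max_le (by simp) ?_)
    refine MvPolynomial.totalDegree_finsetSum_le fun j _ => ?_
    refine (MvPolynomial.totalDegree_mul _ _).trans ?_
    simp
  change (MvPolynomial.bind₁ g p).totalDegree ≤ _
  conv_lhs => rw [p.as_sum, map_sum]
  refine MvPolynomial.totalDegree_finsetSum_le fun s hs => ?_
  rw [MvPolynomial.bind₁_monomial]
  refine (MvPolynomial.totalDegree_mul _ _).trans ?_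
  rw [MvPolynomial.totalDegree_C, zero_add]
  refine (MvPolynomial.totalDegree_finsetProd _ _).trans ?_
  refine le_trans (Finset.sum_le_sum fun i _ => ?_) (MvPolynomial.le_totalDegree hs)
  exact (MvPolynomial.totalDegree_pow _ _).trans (by nlinarith [hg i])

end Poly

/-! ### A Remez-type inequality -/

section Remez

variable {d m : ℕ}

lemma integrableOn_of_continuous_of_isBounded {E : Set (Pt m)} (hE : Bornology.IsBounded E)
    {f : Pt m → ℝ} (hf : Continuous f) : IntegrableOn f E := by
  obtain ⟨R, hR⟩ := hE.subset_closedBall 0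
  exact (hf.continuousOn.integrableOn_compact (isCompact_closedBall 0 R)).mono_set hR

lemma measurableSet_sublevel {B : Set (Pt m)} (hB : MeasurableSet B) (p : Poly m) (ε : ℝ) :
    MeasurableSet {x ∈ B | |pval p x| ≤ ε} :=
  hB.inter (isClosed_le (continuous_pval p).abs continuous_const).measurableSet

/-- For a polynomial family parametrized linearly by a nonzero coefficient vector `c`, the
sublevel sets are uniformly small near `c`. -/
lemma exists_nhds_sublevel_le {n : ℕ} (b : Fin n → Poly m) (hb : LinearIndependent ℝ b)
    {ρ : ℝ} (hρ : 0 < ρ) {c : Fin n → ℝ} (hc : c ≠ 0) :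
    ∃ ε > 0, ∀ᶠ c' in nhds c,
      volume.real {x ∈ Metric.closedBall (0 : Pt m) 1 | |pval (∑ i, c' i • b i) x| ≤ ε} ≤ ρ := by
  set B := Metric.closedBall (0 : Pt m) 1
  have hcomp : IsCompact B := isCompact_closedBall 0 1
  set p : Poly m := ∑ i, c i • b i
  have hp : p ≠ 0 := fun h => hc (funext (Fintype.linearIndependent_iff.1 hb c h))
  let S : ℕ → Set (Pt m) := fun j => {x ∈ B | |pval p x| ≤ 1 / ((j : ℝ) + 1)}
  have hSm : ∀ j, MeasurableSet (S j) := fun j =>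
    measurableSet_sublevel hcomp.measurableSet p _
  have hSanti : Antitone S := fun i j hij x hx =>
    ⟨hx.1, hx.2.trans (one_div_le_one_div_of_le (by positivity) (by exact_mod_cast by omega))⟩
  have hSfin : ∀ j, volume (S j) ≠ ⊤ := fun j =>
    ((measure_mono (fun x hx => hx.1)).trans_lt hcomp.measure_lt_top).ne
  -- The sublevel sets decrease to the zero set of `p` in the ball, which is null, so by continuity
  -- from above one of them is already small.
  have hinter : volume (⋂ j, S j) = 0 := by
    refine measure_mono_null (fun x hx => ?_) (volume_pval_eq_zero hp)
    have hx' : ∀ j : ℕ, |pval p x| ≤ 1 / ((j : ℝ) + 1) := fun j => (Set.mem_iInter.1 hx j).2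
    have := ge_of_tendsto' tendsto_one_div_add_atTop_nhds_zero_nat hx'
    exact abs_eq_zero.1 (le_antisymm this (abs_nonneg _))
  have htend := tendsto_measure_iInter_atTop (μ := volume) (s := S)
    (fun j => (hSm j).nullMeasurableSet) hSanti ⟨0, hSfin 0⟩
  rw [hinter] at htend
  obtain ⟨j, hj⟩ := (htend.eventually (gt_mem_nhds (ENNReal.ofReal_pos.2 hρ))).exists
  set η : ℝ := 1 / ((j : ℝ) + 1)
  have hη : 0 < η := by positivity
  obtain ⟨K, hK⟩ := hcomp.exists_bound_of_continuousOn
    (f := fun x => ∑ i, |pval (b i) x|) (by fun_prop)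
  -- The other half of `η` absorbs the change of the polynomial on the ball as `c` moves to `c'`.
  refine ⟨η / 2, by positivity, ?_⟩
  have hcont : Filter.Tendsto (fun c' : Fin n → ℝ => ‖c' - c‖ * K) (nhds c) (nhds 0) := by
    have : Continuous fun c' : Fin n → ℝ => ‖c' - c‖ * K := by fun_prop
    simpa using this.tendsto c
  filter_upwards [hcont.eventually (gt_mem_nhds (half_pos hη))] with c' hc'
  have hsub : {x ∈ B | |pval (∑ i, c' i • b i) x| ≤ η / 2} ⊆ S j := by
    rintro x ⟨hxB, hx⟩
    refine ⟨hxB, ?_⟩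
    have hdiff : |pval p x - pval (∑ i, c' i • b i) x| ≤ ‖c' - c‖ * K := by
      have h1 : pval p x - pval (∑ i, c' i • b i) x = ∑ i, (c i - c' i) * pval (b i) x := by
        simp [p, pval_sum, sub_mul]
      rw [h1]
      refine (Finset.abs_sum_le_sum_abs _ _).trans ?_
      have h2 : ∀ i ∈ Finset.univ, |(c i - c' i) * pval (b i) x| ≤ ‖c' - c‖ * |pval (b i) x| := by
        intro i _
        rw [abs_mul, abs_sub_comm]
        exact mul_le_mul_of_nonneg_right (norm_le_pi_norm (c' - c) i) (abs_nonneg _)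
      refine (Finset.sum_le_sum h2).trans ?_
      rw [← Finset.mul_sum]
      exact mul_le_mul_of_nonneg_left ((le_abs_self _).trans (hK x hxB)) (norm_nonneg _)
    have := abs_sub_abs_le_abs_sub (pval p x) (pval (∑ i, c' i • b i) x)
    change |pval p x| ≤ η
    linarith
  exact ENNReal.toReal_le_of_le_ofReal hρ.le ((measure_mono hsub).trans hj.le)

/-- On the unit ball, polynomials of bounded degree are controlled by their `L²` norm on any
measurable subset whose measure is bounded below. -/
lemma exists_sq_le_integral_unitBall (m k : ℕ) {ρ : ℝ} (hρ : 0 < ρ) :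
    ∃ C > 0, ∀ p : Poly m, p.totalDegree ≤ k → ∀ E ⊆ Metric.closedBall (0 : Pt m) 1,
      MeasurableSet E → ρ ≤ volume.real E → ∀ x ∈ Metric.closedBall (0 : Pt m) 1,
        pval p x ^ 2 ≤ C * ∫ y in E, pval p y ^ 2 := by
  set B := Metric.closedBall (0 : Pt m) 1
  have hcomp : IsCompact B := isCompact_closedBall 0 1
  let V := MvPolynomial.restrictTotalDegree (Fin m) ℝ k
  let β := finBasis ℝ V
  let b : Fin (finrank ℝ V) → Poly m := fun i => (β i : Poly m)
  have hb : LinearIndependent ℝ b :=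
    β.linearIndependent.map' V.subtype (Submodule.ker_subtype V)
  -- The sphere of normalized coefficient vectors is compact, so the local thresholds of
  -- `exists_nhds_sublevel_le` can be replaced by a single `ε`.
  obtain ⟨ε, hε, hsub⟩ : ∃ ε > 0, ∀ c ∈ Metric.sphere (0 : Fin (finrank ℝ V) → ℝ) 1,
      volume.real {x ∈ B | |pval (∑ i, c i • b i) x| ≤ ε} ≤ ρ / 2 := by
    refine (isCompact_sphere (0 : Fin (finrank ℝ V) → ℝ) 1).induction_on
      (p := fun S => ∃ ε > 0, ∀ c ∈ S,
        volume.real {x ∈ B | |pval (∑ i, c i • b i) x| ≤ ε} ≤ ρ / 2) ?_ ?_ ?_ ?_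
    · exact ⟨1, one_pos, by simp⟩
    · rintro s t hst ⟨ε, hε, h⟩
      exact ⟨ε, hε, fun c hc => h c (hst hc)⟩
    · have hmono : ∀ c : Fin (finrank ℝ V) → ℝ, ∀ ε ε' : ℝ, ε ≤ ε' →
          volume.real {x ∈ B | |pval (∑ i, c i • b i) x| ≤ ε} ≤
            volume.real {x ∈ B | |pval (∑ i, c i • b i) x| ≤ ε'} := fun c ε ε' h =>
        measureReal_mono (fun x hx => ⟨hx.1, hx.2.trans h⟩)
          ((measure_mono (fun x hx => hx.1)).trans_lt hcomp.measure_lt_top).ne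
      rintro s t ⟨ε, hε, h⟩ ⟨ε', hε', h'⟩
      refine ⟨min ε ε', lt_min hε hε', ?_⟩
      rintro c (hc | hc)
      · exact (hmono _ _ _ (min_le_left _ _)).trans (h c hc)
      · exact (hmono _ _ _ (min_le_right _ _)).trans (h' c hc)
    · intro c hc
      have hc0 : c ≠ 0 := by rintro rfl; simp at hc
      obtain ⟨ε, hε, h⟩ := exists_nhds_sublevel_le b hb (half_pos hρ) hc0
      exact ⟨_, mem_nhdsWithin_of_mem_nhds h, ε, hε, fun c hc => hc⟩
  obtain ⟨K, hK⟩ := hcomp.exists_bound_of_continuousOn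
    (f := fun x => ∑ i, |pval (b i) x|) (by fun_prop)
  -- With `N` the norm of the coefficient vector, `|p| ≤ N K` on the ball, while `|p| > N ε` on `E`
  -- outside a set of measure at most `ρ / 2` when `N > 0`. The `+ 1` keeps the constant positive if
  -- `K = 0`.
  refine ⟨2 * (K ^ 2 + 1) / (ε ^ 2 * ρ), by positivity, ?_⟩
  intro p hp E hEB hE hEρ x hx
  let c := β.repr ⟨p, (MvPolynomial.mem_restrictTotalDegree _ _ _).2 hp⟩
  have hpc : p = ∑ i, c i • b i := by
    have := congrArg V.subtype (β.sum_repr ⟨p, (MvPolynomial.mem_restrictTotalDegree _ _ _).2 hp⟩)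
    rw [map_sum] at this
    exact this.symm
  set N : ℝ := ‖(c : Fin (finrank ℝ V) → ℝ)‖
  have hxK : pval p x ^ 2 ≤ N ^ 2 * K ^ 2 := by
    rw [← mul_pow, ← sq_abs]
    refine pow_le_pow_left₀ (abs_nonneg _) ?_ 2
    rw [hpc, pval_sum]
    refine (Finset.abs_sum_le_sum_abs _ _).trans ?_
    refine le_trans (Finset.sum_le_sum (g := fun i => N * |pval (b i) x|) fun i _ => ?_) ?_
    · rw [pval_smul, abs_mul]
      exact mul_le_mul_of_nonneg_right (norm_le_pi_norm (c : Fin (finrank ℝ V) → ℝ) i)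
        (abs_nonneg _)
    · rw [← Finset.mul_sum]
      exact mul_le_mul_of_nonneg_left ((le_abs_self _).trans (hK x hx)) (norm_nonneg _)
  have h_int : N ^ 2 * (ε ^ 2 * (ρ / 2)) ≤ ∫ y in E, pval p y ^ 2 := by
    rcases eq_or_ne N 0 with hN | hN
    · rw [hN]
      simpa using integral_nonneg fun y => sq_nonneg (pval p y)
    have hNpos : 0 < N := lt_of_le_of_ne (norm_nonneg _) hN.symm
    let c₁ : Fin (finrank ℝ V) → ℝ := N⁻¹ • (c : Fin (finrank ℝ V) → ℝ)
    have hc₁ : c₁ ∈ Metric.sphere (0 : Fin (finrank ℝ V) → ℝ) 1 := by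
      rw [mem_sphere_zero_iff_norm, norm_smul, norm_inv, Real.norm_of_nonneg hNpos.le]
      exact inv_mul_cancel₀ hN
    have hp₁ : ∀ y, pval p y = N * pval (∑ i, c₁ i • b i) y := by
      intro y
      rw [hpc, pval_sum, pval_sum, Finset.mul_sum]
      refine Finset.sum_congr rfl fun i _ => ?_
      simp only [c₁, Pi.smul_apply, smul_eq_mul, pval_smul]
      field_simp
    set D : Set (Pt m) := {x ∈ B | |pval (∑ i, c₁ i • b i) x| ≤ ε}
    have hD : MeasurableSet D :=
      measurableSet_sublevel hcomp.measurableSet _ _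
    have hEfin : volume E ≠ ⊤ := ((measure_mono hEB).trans_lt hcomp.measure_lt_top).ne
    have hED : ρ / 2 ≤ volume.real (E \ D) := by
      have h1 := hsub c₁ hc₁
      have h2 := measureReal_sdiff_add_inter (μ := volume) (s := E) hD hEfin
      have h3 : volume.real (E ∩ D) ≤ volume.real D := measureReal_mono Set.inter_subset_right
        ((measure_mono (fun x hx => hx.1)).trans_lt hcomp.measure_lt_top).ne
      have h4 : volume.real D ≤ ρ / 2 := h1
      linarith
    have hii : IntegrableOn (fun y => pval p y ^ 2) E :=
      integrableOn_of_continuous_of_isBounded (hcomp.isBounded.subset hEB) (by fun_prop)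
    calc N ^ 2 * (ε ^ 2 * (ρ / 2)) ≤ (N ^ 2 * ε ^ 2) * volume.real (E \ D) := by
          rw [← mul_assoc]; gcongr
      _ = ∫ _ in E \ D, N ^ 2 * ε ^ 2 := by simp [mul_comm]
      _ ≤ ∫ y in E \ D, pval p y ^ 2 := by
          refine setIntegral_mono_on (integrableOn_const
            ((measure_mono Set.sdiff_subset).trans_lt hEfin.lt_top).ne)
            (hii.mono_set Set.sdiff_subset) (hE.diff hD) fun y hy => ?_
          have : ε < |pval (∑ i, c₁ i • b i) y| := by
            by_contra! h
            exact hy.2 ⟨hEB hy.1, h⟩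
          rw [hp₁ y, mul_pow, ← sq_abs (pval _ y)]
          gcongr
      _ ≤ ∫ y in E, pval p y ^ 2 :=
          setIntegral_mono_set hii (Filter.Eventually.of_forall fun y => sq_nonneg _)
            (Filter.Eventually.of_forall Set.sdiff_subset)
  have hρε : 0 < ε ^ 2 * ρ := by positivity
  rw [div_mul_eq_mul_div, le_div_iff₀ hρε]
  nlinarith [sq_nonneg N, sq_nonneg K, mul_le_mul_of_nonneg_left h_int (show 0 ≤ 2 * (K ^ 2 + 1) by
    positivity), mul_le_mul_of_nonneg_right hxK hρε.le, mul_nonneg (sq_nonneg N) hρε.le]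

end Remez

/-! ### Flat patches -/

section Patch

open scoped Pointwise

variable {d m : ℕ}

/-- The affine isometry `y ↦ x₀ + ι y` parametrizing an `m`-plane. -/
def chart (x₀ : Pt d) (ι : Pt m →ₗᵢ[ℝ] Pt d) (y : Pt m) : Pt d := x₀ + ι y

/-- The closed disc of radius `h` about `x₀` in the plane `x₀ + range ι`. -/
def disc (x₀ : Pt d) (ι : Pt m →ₗᵢ[ℝ] Pt d) (h : ℝ) : Set (Pt d) :=
  Metric.closedBall x₀ h ∩ Set.range (chart x₀ ι)

lemma isometry_chart (x₀ : Pt d) (ι : Pt m →ₗᵢ[ℝ] Pt d) : Isometry (chart x₀ ι) :=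
  (IsometryEquiv.addLeft x₀).isometry.comp ι.isometry

lemma measurableEmbedding_chart (x₀ : Pt d) (ι : Pt m →ₗᵢ[ℝ] Pt d) :
    MeasurableEmbedding (chart x₀ ι) :=
  (isometry_chart x₀ ι).isClosedEmbedding.measurableEmbedding

/-- The normalized Hausdorff measure is Lebesgue measure on `Pt m` and is preserved by isometries.
Through this identity every surface integral over a face becomes a Lebesgue integral in the chart.
-/
lemma restrict_eq_map_chart (x₀ : Pt d) (ι : Pt m →ₗᵢ[ℝ] Pt d) {S : Set (Pt d)}
    (hS : S ⊆ Set.range (chart x₀ ι)) :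
    (μHE[m] : Measure (Pt d)).restrict S =
      (volume.restrict (chart x₀ ι ⁻¹' S)).map (chart x₀ ι) := by
  rw [← (measurableEmbedding_chart x₀ ι).restrict_map,
    ← EuclideanSpace.euclideanHausdorffMeasure_eq_volume,
    (isometry_chart x₀ ι).map_euclideanHausdorffMeasure, Measure.restrict_restrict_of_subset hS]

lemma setIntegral_chart (x₀ : Pt d) (ι : Pt m →ₗᵢ[ℝ] Pt d) {S : Set (Pt d)}
    (hS : S ⊆ Set.range (chart x₀ ι)) (f : Pt d → ℝ) :
    ∫ x in S, f x ∂μHE[m] = ∫ y in chart x₀ ι ⁻¹' S, f (chart x₀ ι y) := by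
  rw [restrict_eq_map_chart x₀ ι hS, (measurableEmbedding_chart x₀ ι).integral_map]

lemma measure_chart (x₀ : Pt d) (ι : Pt m →ₗᵢ[ℝ] Pt d) {S : Set (Pt d)}
    (hS : S ⊆ Set.range (chart x₀ ι)) :
    (μHE[m] : Measure (Pt d)) S = volume (chart x₀ ι ⁻¹' S) := by
  rw [← EuclideanSpace.euclideanHausdorffMeasure_eq_volume,
    (isometry_chart x₀ ι).euclideanHausdorffMeasure_preimage, Set.inter_eq_left.2 hS]

lemma chart_mem_closedBall {x₀ : Pt d} {ι : Pt m →ₗᵢ[ℝ] Pt d} {h : ℝ} {y : Pt m} :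
    chart x₀ ι y ∈ Metric.closedBall x₀ h ↔ y ∈ Metric.closedBall (0 : Pt m) h := by
  simp [chart]

lemma measure_disc_lt_top (x₀ : Pt d) (ι : Pt m →ₗᵢ[ℝ] Pt d) (h : ℝ) :
    (μHE[m] : Measure (Pt d)) (disc x₀ ι h) < ⊤ := by
  rw [measure_chart x₀ ι (S := disc x₀ ι h) Set.inter_subset_right]
  refine (measure_mono (t := Metric.closedBall 0 h) fun y hy => ?_).trans_lt
    measure_closedBall_lt_top
  exact chart_mem_closedBall.1 hy.1

/-- The volume of the unit ball. -/
def ballVol (m : ℕ) : ℝ := volume.real (Metric.closedBall (0 : Pt m) 1)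

lemma ballVol_nonneg (m : ℕ) : 0 ≤ ballVol m := measureReal_nonneg

lemma measureReal_le_of_subset_disc {x₀ : Pt d} {ι : Pt m →ₗᵢ[ℝ] Pt d} {h : ℝ} (hh : 0 ≤ h)
    {S : Set (Pt d)} (hS : S ⊆ disc x₀ ι h) :
    (μHE[m] : Measure (Pt d)).real S ≤ ballVol m * h ^ m := by
  rw [Measure.real, measure_chart x₀ ι (hS.trans Set.inter_subset_right)]
  have := Measure.addHaar_real_closedBall' (volume : Measure (Pt m)) 0 hh
  rw [finrank_euclideanSpace_fin] at this
  rw [ballVol, mul_comm, ← this]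
  exact measureReal_mono (fun y hy => chart_mem_closedBall.1 (hS hy).1)
    measure_closedBall_lt_top.ne

lemma integrableOn_of_subset_disc {x₀ : Pt d} {ι : Pt m →ₗᵢ[ℝ] Pt d} {h : ℝ} {S : Set (Pt d)}
    (hS : S ⊆ disc x₀ ι h) {f : Pt d → ℝ} (hf : Continuous f) : IntegrableOn f S μHE[m] := by
  obtain ⟨K, hK⟩ := (isCompact_closedBall x₀ h).exists_bound_of_continuousOn hf.continuousOn
  have : IntegrableOn f (disc x₀ ι h) μHE[m] := by
    refine Measure.integrableOn_of_bounded (M := K) (measure_disc_lt_top x₀ ι h).ne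
      hf.aestronglyMeasurable ?_
    refine (ae_restrict_iff' ?_).2 (Filter.Eventually.of_forall fun x hx => hK x hx.1)
    exact (Metric.isClosed_closedBall.inter
      (isometry_chart x₀ ι).isClosedEmbedding.isClosed_range).measurableSet
  exact this.mono_set hS

/-- Scaled form of `exists_sq_le_integral_unitBall`. -/
lemma exists_sq_le_integral_ball (m k : ℕ) {ρ : ℝ} (hρ : 0 < ρ) :
    ∃ C > 0, ∀ h > 0, ∀ p : Poly m, p.totalDegree ≤ k →
      ∀ E ⊆ Metric.closedBall (0 : Pt m) h, MeasurableSet E → ρ * h ^ m ≤ volume.real E →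
        ∀ x ∈ Metric.closedBall (0 : Pt m) h,
          pval p x ^ 2 * h ^ m ≤ C * ∫ y in E, pval p y ^ 2 := by
  obtain ⟨C, hC, H⟩ := exists_sq_le_integral_unitBall m k hρ
  refine ⟨C, hC, fun h hh p hp E hE hEm hEρ x hx => ?_⟩
  have hpow : 0 < h ^ m := pow_pos hh m
  -- Pull back to the unit ball by a dilation; the factor `h ^ m` in the statement is its Jacobian.
  let A : Pt m →ₗ[ℝ] Pt m := h • LinearMap.id
  have hval : ∀ y, pval (affComp p 0 A) y = pval p (h • y) := fun y => by
    simp [pval_affComp, A]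
  have hball : ∀ y : Pt m, h • y ∈ Metric.closedBall (0 : Pt m) h ↔
      y ∈ Metric.closedBall (0 : Pt m) 1 := fun y => by
    simp [norm_smul, abs_of_pos hh, hh]
  have key := H (affComp p 0 A) ((totalDegree_affComp_le p 0 A).trans hp)
    ((fun y => h • y) ⁻¹' E) (fun y hy => (hball y).1 (hE hy))
    ((measurable_const_smul h) hEm) ?_ (h⁻¹ • x) ((hball _).1 (by simpa [smul_smul, hh.ne'] using hx))
  · simp only [hval, smul_smul, mul_inv_cancel₀ hh.ne', one_smul] at key
    rw [Measure.setIntegral_comp_smul_of_pos volume (fun y => pval p y ^ 2) _ hh,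
      finrank_euclideanSpace_fin] at key
    have hset : h • ((fun y : Pt m => h • y) ⁻¹' E) = E := by
      rw [Set.preimage_smul₀ hh.ne', smul_inv_smul₀ hh.ne']
    rw [hset, smul_eq_mul] at key
    calc pval p x ^ 2 * h ^ m ≤ (C * ((h ^ m)⁻¹ * ∫ y in E, pval p y ^ 2)) * h ^ m := by gcongr
      _ = C * ∫ y in E, pval p y ^ 2 := by field_simp
  · rw [Measure.real, Measure.addHaar_preimage_smul volume hh.ne', finrank_euclideanSpace_fin,
      ENNReal.toReal_mul, ENNReal.toReal_ofReal (abs_nonneg _), abs_of_pos (inv_pos.2 hpow),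
      ← div_eq_inv_mul, le_div_iff₀ hpow]
    exact hEρ

/-- The Remez-type inequality on flat patches. -/
lemma exists_sq_le_integral_disc (m k : ℕ) {ρ : ℝ} (hρ : 0 < ρ) :
    ∃ C > 0, ∀ (d : ℕ) (x₀ : Pt d) (ι : Pt m →ₗᵢ[ℝ] Pt d), ∀ h > 0, ∀ p : Poly d,
      p.totalDegree ≤ k → ∀ S ⊆ disc x₀ ι h, MeasurableSet S →
        ρ * h ^ m ≤ (μHE[m] : Measure (Pt d)).real S → ∀ x ∈ disc x₀ ι h,
          pval p x ^ 2 * h ^ m ≤ C * ∫ y in S, pval p y ^ 2 ∂μHE[m] := by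
  obtain ⟨C, hC, H⟩ := exists_sq_le_integral_ball m k hρ
  refine ⟨C, hC, ?_⟩
  rintro d x₀ ι h hh p hp S hS hSm hSρ x ⟨hx, y, rfl⟩
  have hSr : S ⊆ Set.range (chart x₀ ι) := hS.trans Set.inter_subset_right
  have key := H h hh (affComp p x₀ ι.toLinearMap) ((totalDegree_affComp_le _ _ _).trans hp)
    (chart x₀ ι ⁻¹' S) (fun z hz => chart_mem_closedBall.1 (hS hz).1)
    ((measurableEmbedding_chart x₀ ι).measurable hSm)
    (by rwa [Measure.real, ← measure_chart x₀ ι hSr]) y (chart_mem_closedBall.1 hx)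
  rw [setIntegral_chart x₀ ι hSr]
  simp only [pval_affComp] at key
  exact key

/-- Polynomials weighted by a product of squares of affine functions, none of which is uniformly
small on the disc, are controlled by the weighted `L²` norm. -/
lemma exists_le_integral_weight (m k N : ℕ) {ρ α : ℝ} (hρ : 0 < ρ) (hα : 0 < α) :
    ∃ c > 0, ∀ (d : ℕ) (x₀ : Pt d) (ι : Pt m →ₗᵢ[ℝ] Pt d), ∀ h > 0,
      ∀ S ⊆ disc x₀ ι h, MeasurableSet S → ρ * h ^ m ≤ (μHE[m] : Measure (Pt d)).real S →
      ∀ (J : Type) (I : Finset J) (l : J → Poly d), I.card ≤ N →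
        (∀ i ∈ I, (l i).totalDegree ≤ 1 ∧ ∃ x ∈ disc x₀ ι h, α ≤ |pval (l i) x|) →
      ∀ Φ : Pt d → ℝ, Continuous Φ → (∀ x ∈ S, ∏ i ∈ I, pval (l i) x ^ 2 ≤ Φ x) →
      ∀ q : Poly d, q.totalDegree ≤ k → ∀ x ∈ disc x₀ ι h,
        c * (pval q x ^ 2 * h ^ m) ≤ ∫ y in S, Φ y * pval q y ^ 2 ∂μHE[m] := by
  -- At most `N` exceptional sets of relative measure `ρ'` together take up at most half of `ρ`, and
  -- `N + 1` avoids dividing by zero.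
  set ρ' : ℝ := ρ / (2 * (N + 1))
  have hρ' : 0 < ρ' := by positivity
  obtain ⟨C₁, hC₁, H₁⟩ := exists_sq_le_integral_disc m 1 hρ'
  obtain ⟨C₂, hC₂, H₂⟩ := exists_sq_le_integral_disc m k (half_pos hρ)
  set V := ballVol m
  have hV : 0 ≤ V := ballVol_nonneg m
  set t : ℝ := 1 + C₁ * V
  have ht : 1 ≤ t := by have := mul_nonneg hC₁.le hV; simp only [t]; linarith
  have htpos : 0 < t := by linarith
  -- The bound `α / t` makes the Remez inequality contradictory on a large sublevel set, since it
  -- would give `t ^ 2 ≤ C₁ * V < t` with `1 ≤ t`. The bound `1` makes powers of `ε` decrease, so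
  -- that fewer than `N` factors do no harm.
  set ε : ℝ := min 1 (α / t)
  have hε : 0 < ε := lt_min one_pos (by positivity)
  have hε1 : ε ≤ 1 := min_le_left _ _
  have hεt : ε ≤ α / t := min_le_right _ _
  refine ⟨ε ^ (2 * N) / C₂, by positivity, ?_⟩
  intro d x₀ ι h hh S hS hSm hSρ J I l hI hl Φ hΦ hlΦ q hq x hx
  have hpow : 0 < h ^ m := pow_pos hh m
  let D : J → Set (Pt d) := fun i => {x ∈ S | |pval (l i) x| ≤ ε}
  have hDm : ∀ i, MeasurableSet (D i) := fun i => measurableSet_sublevel hSm _ _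
  have hDS : ∀ i, D i ⊆ S := fun i x hx => hx.1
  have hfin : ∀ A ⊆ S, (μHE[m] : Measure (Pt d)) A ≠ ⊤ := fun A hA =>
    ((measure_mono (hA.trans hS)).trans_lt (measure_disc_lt_top x₀ ι h)).ne
  -- If an affine function were at most `ε` on a set this large, the Remez inequality in degree one
  -- would make it less than `α` on the whole disc.
  have hDsmall : ∀ i ∈ I, (μHE[m] : Measure (Pt d)).real (D i) ≤ ρ' * h ^ m := by
    intro i hi
    by_contra! hlt
    obtain ⟨hdeg, z, hz, hαz⟩ := hl i hi
    have h1 := H₁ d x₀ ι h hh (l i) hdeg (D i) ((hDS i).trans hS) (hDm i) hlt.le z hz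
    have h2 : ∫ y in D i, pval (l i) y ^ 2 ∂μHE[m] ≤ ε ^ 2 * (V * h ^ m) := by
      calc ∫ y in D i, pval (l i) y ^ 2 ∂μHE[m] ≤ ∫ _ in D i, ε ^ 2 ∂μHE[m] := by
            refine setIntegral_mono_on (integrableOn_of_subset_disc ((hDS i).trans hS)
              (by fun_prop)) (integrableOn_const (hfin _ (hDS i))) (hDm i) fun y hy => ?_
            rw [← sq_abs]
            exact pow_le_pow_left₀ (abs_nonneg _) hy.2 2
        _ = ε ^ 2 * (μHE[m] : Measure (Pt d)).real (D i) := by simp [mul_comm]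
        _ ≤ _ := by gcongr; exact measureReal_le_of_subset_disc hh.le ((hDS i).trans hS)
    have h3 : α ^ 2 ≤ pval (l i) z ^ 2 := by
      rw [← sq_abs (pval (l i) z)]; exact pow_le_pow_left₀ hα.le hαz 2
    have h4 : α ^ 2 * h ^ m ≤ (C₁ * V * ε ^ 2) * h ^ m := by
      calc α ^ 2 * h ^ m ≤ pval (l i) z ^ 2 * h ^ m := by gcongr
        _ ≤ _ := h1
        _ ≤ C₁ * (ε ^ 2 * (V * h ^ m)) := by gcongr
        _ = _ := by ring
    have h5 := le_of_mul_le_mul_right h4 hpow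
    have h6 : ε ^ 2 ≤ α ^ 2 / t ^ 2 := by
      rw [← div_pow]; exact pow_le_pow_left₀ hε.le hεt 2
    have h7 : C₁ * V * ε ^ 2 ≤ C₁ * V * (α ^ 2 / t ^ 2) := by gcongr
    have h8 : α ^ 2 * t ^ 2 ≤ C₁ * V * α ^ 2 := by
      have := h5.trans h7
      rwa [← mul_div_assoc, le_div_iff₀ (by positivity)] at this
    have h9 : t ^ 2 ≤ C₁ * V := by
      have : 0 < α ^ 2 := by positivity
      nlinarith
    nlinarith
  set U : Set (Pt d) := ⋃ i ∈ I, D i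
  have hUm : MeasurableSet U := I.measurableSet_biUnion fun i _ => hDm i
  have hUsmall : (μHE[m] : Measure (Pt d)).real U ≤ ρ / 2 * h ^ m := by
    calc (μHE[m] : Measure (Pt d)).real U ≤ ∑ i ∈ I, (μHE[m] : Measure (Pt d)).real (D i) :=
          measureReal_biUnion_finset_le _ _
      _ ≤ ∑ i ∈ I, ρ' * h ^ m := Finset.sum_le_sum hDsmall
      _ = I.card * (ρ' * h ^ m) := by simp
      _ ≤ (N + 1) * (ρ' * h ^ m) := by
          gcongr
          exact_mod_cast hI.trans (Nat.le_succ N)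
      _ = ρ / 2 * h ^ m := by simp only [ρ']; field_simp
  have hUS : U ⊆ S := Set.iUnion₂_subset fun i _ => hDS i
  have hS' : ρ / 2 * h ^ m ≤ (μHE[m] : Measure (Pt d)).real (S \ U) := by
    have h1 := measureReal_sdiff_add_inter (μ := (μHE[m] : Measure (Pt d))) (s := S) hUm
      (hfin S subset_rfl)
    rw [Set.inter_eq_right.2 hUS] at h1
    linarith
  have hsub : S \ U ⊆ disc x₀ ι h := Set.sdiff_subset.trans hS
  have hprod : ∀ y ∈ S \ U, ε ^ (2 * N) ≤ Φ y := by
    intro y hy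
    refine le_trans ?_ (hlΦ y hy.1)
    calc ε ^ (2 * N) ≤ ε ^ (2 * I.card) := pow_le_pow_of_le_one hε.le hε1 (by omega)
      _ = ∏ i ∈ I, ε ^ 2 := by rw [Finset.prod_const, pow_mul]
      _ ≤ _ := by
        refine Finset.prod_le_prod (fun i _ => by positivity) fun i hi => ?_
        have : ε < |pval (l i) y| := by
          by_contra! hle
          exact hy.2 (Set.mem_iUnion₂.2 ⟨i, hi, hy.1, hle⟩)
        rw [← sq_abs (pval (l i) y)]
        gcongr
  have hΦnn : ∀ y ∈ S, 0 ≤ Φ y * pval q y ^ 2 := fun y hy =>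
    mul_nonneg ((Finset.prod_nonneg fun i _ => sq_nonneg _).trans (hlΦ y hy)) (sq_nonneg _)
  have hii : IntegrableOn (fun y => Φ y * pval q y ^ 2) S μHE[m] :=
    integrableOn_of_subset_disc hS (by fun_prop)
  have key := H₂ d x₀ ι h hh q hq (S \ U) hsub (hSm.diff hUm) hS' x hx
  calc ε ^ (2 * N) / C₂ * (pval q x ^ 2 * h ^ m)
      ≤ ε ^ (2 * N) / C₂ * (C₂ * ∫ y in S \ U, pval q y ^ 2 ∂μHE[m]) := by gcongr
    _ = ∫ y in S \ U, ε ^ (2 * N) * pval q y ^ 2 ∂μHE[m] := by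
        rw [integral_const_mul]; field_simp
    _ ≤ ∫ y in S \ U, Φ y * pval q y ^ 2 ∂μHE[m] := by
        refine setIntegral_mono_on (integrableOn_of_subset_disc hsub (by fun_prop))
          (hii.mono_set Set.sdiff_subset) (hSm.diff hUm) fun y hy => ?_
        exact mul_le_mul_of_nonneg_right (hprod y hy) (sq_nonneg _)
    _ ≤ _ := setIntegral_mono_set hii
        ((ae_restrict_iff' hSm).2 (Filter.Eventually.of_forall hΦnn))
        (Filter.Eventually.of_forall Set.sdiff_subset)

end Patch

/-! ### Oblique Fubini decomposition along a hyperplane -/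

section Oblique

variable {m : ℕ}

/-- The map `(y, u) ↦ x₀ + ι y + u w`. -/
def oblique (x₀ : Pt (m + 1)) (ι : Pt m →ₗᵢ[ℝ] Pt (m + 1)) (w : Pt (m + 1)) (z : Pt m × ℝ) :
    Pt (m + 1) := chart x₀ ι z.1 + z.2 • w

/-- The isometry `(u, y) ↦ u ν + ι y` for a unit vector `ν` orthogonal to the range of `ι`. -/
def normalSplit (ι : Pt m →ₗᵢ[ℝ] Pt (m + 1)) (ν : Pt (m + 1)) (hν : ‖ν‖ = 1)
    (horth : ∀ y, inner ℝ ν (ι y) = 0) : WithLp 2 (ℝ × Pt m) ≃ₗᵢ[ℝ] Pt (m + 1) :=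
  LinearIsometry.toLinearIsometryEquiv
    { toLinearMap := (LinearMap.toSpanSingleton ℝ (Pt (m + 1)) ν ∘ₗ LinearMap.fst ℝ ℝ (Pt m) +
        ι.toLinearMap ∘ₗ LinearMap.snd ℝ ℝ (Pt m)) ∘ₗ (WithLp.linearEquiv 2 ℝ (ℝ × Pt m)).toLinearMap
      norm_map' := by
        intro z
        rw [← sq_eq_sq₀ (norm_nonneg _) (norm_nonneg _), WithLp.prod_norm_sq_eq_of_L2]
        simp only [LinearMap.comp_apply, LinearMap.add_apply, LinearMap.fst_apply,
          LinearMap.snd_apply, LinearMap.toSpanSingleton_apply]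
        change ‖z.fst • ν + ι z.snd‖ ^ 2 = _
        rw [norm_add_sq_real, inner_smul_left, horth, norm_smul, hν, ι.norm_map]
        simp }
    (by
      rw [(WithLp.linearEquiv 2 ℝ (ℝ × Pt m)).finrank_eq]
      simp [add_comm])

lemma normalSplit_apply (ι : Pt m →ₗᵢ[ℝ] Pt (m + 1)) (ν : Pt (m + 1)) (hν : ‖ν‖ = 1)
    (horth : ∀ y, inner ℝ ν (ι y) = 0) (u : ℝ) (y : Pt m) :
    normalSplit ι ν hν horth (WithLp.toLp 2 (u, y)) = u • ν + ι y := rfl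

/-- A vector is the sum of its normal component and a tangential vector. -/
lemma exists_eq_inner_smul_add {ι : Pt m →ₗᵢ[ℝ] Pt (m + 1)} {ν : Pt (m + 1)} (hν : ‖ν‖ = 1)
    (horth : ∀ y, inner ℝ ν (ι y) = 0) (w : Pt (m + 1)) : ∃ b, w = inner ℝ ν w • ν + ι b := by
  obtain ⟨z, rfl⟩ := (normalSplit ι ν hν horth).surjective w
  obtain ⟨⟨u, b⟩, rfl⟩ := (WithLp.toLp_surjective 2) z
  refine ⟨b, ?_⟩
  rw [normalSplit_apply, inner_add_right, inner_smul_right, horth, real_inner_self_eq_norm_sq, hν]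
  simp

/-- With `w = c ν + ι b`, the map sends `(y, u)` to `x₀ + (c u) ν + ι (y + u b)`. It is the
composite of a scaling of `u` by `c`, a shear in `y` and an isometry; only the scaling changes the
measure. -/
lemma measurePreserving_oblique (x₀ : Pt (m + 1)) {ι : Pt m →ₗᵢ[ℝ] Pt (m + 1)} {ν : Pt (m + 1)}
    (hν : ‖ν‖ = 1) (horth : ∀ y, inner ℝ ν (ι y) = 0) {w : Pt (m + 1)} (hc : inner ℝ ν w ≠ 0) :
    MeasurePreserving (oblique x₀ ι w) (volume.prod volume)
      (ENNReal.ofReal |(inner ℝ ν w)⁻¹| • volume) := by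
  obtain ⟨b, hb⟩ := exists_eq_inner_smul_add hν horth w
  set c : ℝ := inner ℝ ν w
  have h1 : MeasurePreserving (fun u : ℝ => c * u) volume (ENNReal.ofReal |c⁻¹| • volume) :=
    ⟨by fun_prop, Real.map_volume_mul_left hc⟩
  have h2 := h1.skew_product (μc := (volume : Measure (Pt m))) (μd := volume)
    (g := fun u y => y + u • b) (by fun_prop)
    (Filter.Eventually.of_forall fun u => (measurePreserving_add_right volume (u • b)).map_eq)
  rw [Measure.prod_smul_left] at h2
  have h3 : MeasurePreserving (fun z : ℝ × Pt m => x₀ + normalSplit ι ν hν horth (WithLp.toLp 2 z))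
      (volume.prod volume) volume :=
    (measurePreserving_add_left volume x₀).comp
      ((normalSplit ι ν hν horth).measurePreserving.comp (WithLp.volume_preserving_toLp ℝ (Pt m)))
  have h4 := (h3.smul_measure (ENNReal.ofReal |c⁻¹|)).comp h2
  have h5 := h4.comp (Measure.measurePreserving_swap (μ := (volume : Measure (Pt m)))
    (ν := (volume : Measure ℝ)))
  convert h5 using 1
  ext1 ⟨y, u⟩
  simp only [Function.comp_apply, Prod.swap, normalSplit_apply, oblique, chart, map_add, map_smul]
  conv_lhs => rw [hb]
  rw [smul_add, smul_smul, mul_comm u c]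
  abel

lemma continuous_oblique (x₀ : Pt (m + 1)) (ι : Pt m →ₗᵢ[ℝ] Pt (m + 1)) (w : Pt (m + 1)) :
    Continuous (oblique x₀ ι w) := by
  have := (isometry_chart x₀ ι).continuous
  unfold oblique
  fun_prop

lemma injective_oblique (x₀ : Pt (m + 1)) {ι : Pt m →ₗᵢ[ℝ] Pt (m + 1)} {ν : Pt (m + 1)}
    (horth : ∀ y, inner ℝ ν (ι y) = 0) {w : Pt (m + 1)} (hc : inner ℝ ν w ≠ 0) :
    Function.Injective (oblique x₀ ι w) := by
  rintro ⟨y, u⟩ ⟨y', u'⟩ h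
  simp only [oblique, chart, add_assoc, add_right_inj] at h
  have h1 := congrArg (inner ℝ ν) h
  simp only [inner_add_right, horth, inner_smul_right, zero_add] at h1
  have hu : u = u' := mul_right_cancel₀ hc h1
  subst hu
  have := ι.injective (add_right_cancel h)
  rw [this]

lemma measurableEmbedding_oblique (x₀ : Pt (m + 1)) {ι : Pt m →ₗᵢ[ℝ] Pt (m + 1)} {ν : Pt (m + 1)}
    (horth : ∀ y, inner ℝ ν (ι y) = 0) {w : Pt (m + 1)} (hc : inner ℝ ν w ≠ 0) :
    MeasurableEmbedding (oblique x₀ ι w) :=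
  (continuous_oblique x₀ ι w).measurableEmbedding (injective_oblique x₀ horth hc)

/-- Almost every line of direction `w` avoids a null subset of a transverse hyperplane. -/
lemma volume_cylinder_eq_zero (x₀ : Pt (m + 1)) {ι : Pt m →ₗᵢ[ℝ] Pt (m + 1)} {ν : Pt (m + 1)}
    (hν : ‖ν‖ = 1) (horth : ∀ y, inner ℝ ν (ι y) = 0) {w : Pt (m + 1)} (hc : inner ℝ ν w ≠ 0)
    {Z : Set (Pt (m + 1))} (hZ : Z ⊆ Set.range (chart x₀ ι))
    (hnull : volume (chart x₀ ι ⁻¹' Z) = 0) :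
    volume {x : Pt (m + 1) | ∃ u : ℝ, x + u • w ∈ Z} = 0 := by
  have hmp := measurePreserving_oblique x₀ hν horth hc
  have hemb := measurableEmbedding_oblique x₀ horth hc
  have himg : {x : Pt (m + 1) | ∃ u : ℝ, x + u • w ∈ Z} ⊆
      oblique x₀ ι w '' ((chart x₀ ι ⁻¹' Z) ×ˢ Set.univ) := by
    rintro x ⟨u, hu⟩
    obtain ⟨y, hy⟩ := hZ hu
    refine ⟨(y, -u), ⟨?_, trivial⟩, ?_⟩
    · change chart x₀ ι y ∈ Z
      rwa [hy]
    · simp [oblique, hy]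
  refine measure_mono_null himg ?_
  have h1 : (ENNReal.ofReal |(inner ℝ ν w)⁻¹| • volume)
      (oblique x₀ ι w '' ((chart x₀ ι ⁻¹' Z) ×ˢ Set.univ)) = 0 := by
    rw [← hmp.map_eq, hemb.map_apply, Set.preimage_image_eq _ hemb.injective, Measure.prod_prod,
      hnull, zero_mul]
  rw [Measure.smul_apply, smul_eq_mul, mul_eq_zero] at h1
  refine h1.resolve_left ?_
  simpa using hc

/-- Integration of a directional derivative over the half-cylinder `e + [0, ∞) w`. -/
lemma integral_halfCylinder (x₀ : Pt (m + 1)) {ι : Pt m →ₗᵢ[ℝ] Pt (m + 1)} {ν : Pt (m + 1)}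
    (hν : ‖ν‖ = 1) (horth : ∀ y, inner ℝ ν (ι y) = 0) {w : Pt (m + 1)} (hc : inner ℝ ν w ≠ 0)
    {e : Set (Pt (m + 1))} (he : e ⊆ Set.range (chart x₀ ι)) (hem : MeasurableSet e)
    {f : Pt (m + 1) → ℝ} (hf : ContDiff ℝ 1 f) (hfs : HasCompactSupport f) :
    MeasurableSet {x : Pt (m + 1) | ∃ u ≤ (0 : ℝ), x + u • w ∈ e} ∧
    ∫ x in {x : Pt (m + 1) | ∃ u ≤ (0 : ℝ), x + u • w ∈ e}, fderiv ℝ f x w =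
      -(|inner ℝ ν w| * ∫ x in e, f x ∂μHE[m]) := by
  have hmp := measurePreserving_oblique x₀ hν horth hc
  have hemb := measurableEmbedding_oblique x₀ horth hc
  set c : ℝ := inner ℝ ν w
  set A : Set (Pt m × ℝ) := (chart x₀ ι ⁻¹' e) ×ˢ Set.Ici 0
  have hAm : MeasurableSet A :=
    ((measurableEmbedding_chart x₀ ι).measurable hem).prod measurableSet_Ici
  have himg : {x : Pt (m + 1) | ∃ u ≤ (0 : ℝ), x + u • w ∈ e} = oblique x₀ ι w '' A := by
    ext x
    constructor
    · rintro ⟨u, hu0, hu⟩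
      obtain ⟨y, hy⟩ := he hu
      refine ⟨(y, -u), ⟨?_, by simpa using hu0⟩, ?_⟩
      · change chart x₀ ι y ∈ e
        rwa [hy]
      · simp [oblique, hy]
    · rintro ⟨⟨y, u⟩, ⟨hy, hu⟩, rfl⟩
      refine ⟨-u, by simpa using hu, ?_⟩
      simpa [oblique] using hy
  rw [himg]
  refine ⟨hemb.measurableSet_image.2 hAm, ?_⟩
  have hf' : Continuous fun x => fderiv ℝ f x w :=
    (hf.continuous_fderiv one_ne_zero).clm_apply continuous_const
  have hf's : HasCompactSupport fun x => fderiv ℝ f x w :=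
    (hfs.fderiv ℝ).comp_left (g := fun L : Pt (m + 1) →L[ℝ] ℝ => L w) (by simp)
  have h_int : Integrable (fun x => fderiv ℝ f x w) (volume : Measure (Pt (m + 1))) :=
    hf'.integrable_of_hasCompactSupport hf's
  have h_intΛ : Integrable (fun z => fderiv ℝ f (oblique x₀ ι w z) w)
      ((volume : Measure (Pt m)).prod volume) := by
    have := h_int.smul_measure (c := ENNReal.ofReal |c⁻¹|) ENNReal.ofReal_ne_top
    rw [← hmp.map_eq] at this
    exact hemb.integrable_map_iff.1 this
  -- Solved for Lebesgue measure, the Jacobian is `|c|`. The absolute value appears because `w` may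
  -- point to either side of the hyperplane.
  have hvol : (volume : Measure (Pt (m + 1))) =
      ENNReal.ofReal |c| • (volume.prod volume).map (oblique x₀ ι w) := by
    rw [hmp.map_eq, smul_smul, ← ENNReal.ofReal_mul (abs_nonneg _), ← abs_mul, mul_inv_cancel₀ hc]
    simp
  rw [hvol, Measure.restrict_smul, integral_smul_measure, hemb.restrict_map, hemb.integral_map,
    Set.preimage_image_eq _ hemb.injective, setIntegral_prod _ h_intΛ.integrableOn,
    ENNReal.toReal_ofReal (abs_nonneg _), smul_eq_mul, ← mul_neg]
  congr 1
  rw [setIntegral_chart x₀ ι he, ← integral_neg]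
  refine integral_congr_ae (Filter.Eventually.of_forall fun y => ?_)
  simp only
  rw [integral_Ici_eq_integral_Ioi]
  have hw : w ≠ 0 := by rintro rfl; simp [c] at hc
  have hline : ContDiff ℝ 1 fun u : ℝ => f (chart x₀ ι y + u • w) := hf.comp (by fun_prop)
  have hder : ∀ u : ℝ, fderiv ℝ f (oblique x₀ ι w (y, u)) w =
      deriv (fun u : ℝ => f (chart x₀ ι y + u • w)) u := by
    intro u
    have h1 : HasDerivAt (fun u : ℝ => chart x₀ ι y + u • w) w u := by
      simpa using ((hasDerivAt_id u).smul_const w).const_add (chart x₀ ι y)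
    have h2 := (hf.differentiable one_ne_zero (chart x₀ ι y + u • w)).hasFDerivAt.comp_hasDerivAt u h1
    exact h2.deriv.symm
  simp only [hder]
  -- On each ray the derivative integrates to minus the value at the starting point on `e`; the
  -- value at infinity vanishes by compact support.
  rw [HasCompactSupport.integral_Ioi_deriv_eq hline]
  · simp
  · have hcl : Topology.IsClosedEmbedding fun u : ℝ => chart x₀ ι y + u • w :=
      (Homeomorph.addLeft (chart x₀ ι y)).isClosedEmbedding.comp (isClosedEmbedding_smul_left hw)
    exact hfs.comp_isClosedEmbedding hcl

end Oblique

/-! ### Sign changes along a line -/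

section Line

open Filter Topology

/-- A function on the line that is constant near each point, the point itself excluded, has one
and the same such value everywhere. -/
lemma exists_eq_of_punctured_const {J : ℝ → ℝ} (h : ∀ v, ∃ a, ∀ᶠ v' in 𝓝[≠] v, J v' = a) :
    ∃ a, ∀ v, ∀ᶠ v' in 𝓝[≠] v, J v' = a := by
  choose J' hJ' using h
  -- Close to `v` but off `v`, `J` equals `J' v`. This persists around each nearby `v' ≠ v`, so the
  -- punctured value there is the same.
  have hloc : IsLocallyConstant J' := by
    rw [IsLocallyConstant.iff_eventually_eq]
    intro v
    have h1 := hJ' v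
    rw [eventually_nhdsWithin_iff] at h1
    filter_upwards [eventually_eventually_nhds.2 h1] with v' hv'
    by_cases hvv : v' = v
    · rw [hvv]
    · have h2 : ∀ᶠ z in 𝓝[≠] v', J z = J' v := by
        have h3 : ∀ᶠ z in 𝓝 v', z ≠ v := (isOpen_ne.eventually_mem hvv)
        filter_upwards [nhdsWithin_le_nhds hv', nhdsWithin_le_nhds h3] with z hz hz'
        exact hz hz'
      obtain ⟨z, hz1, hz2⟩ := (h2.and (hJ' v')).exists
      exact hz2.symm.trans hz1
  refine ⟨J' 0, fun v => ?_⟩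
  rw [hloc.apply_eq_of_preconnectedSpace 0 v]
  exact hJ' v

open Classical in
/-- If a bounded set of the line changes state exactly at the points `u i`, leaving the set when
`s i = 1` and entering it when `s i = -1`, then membership is determined by the signed count of
the changes to the left. -/
lemma indicator_eq_neg_sum {I : Type*} (F : Finset I) (u s : I → ℝ) (L : Set ℝ)
    (hbdd : BddBelow L) (hinj : Set.InjOn u F)
    (hoff : ∀ v, (∀ i ∈ F, u i ≠ v) → ∀ᶠ v' in 𝓝 v, (v' ∈ L ↔ v ∈ L))
    (hcross : ∀ i ∈ F,
      (s i = 1 ∧ (∀ᶠ v in 𝓝[<] (u i), v ∈ L) ∧ ∀ᶠ v in 𝓝[>] (u i), v ∉ L) ∨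
      (s i = -1 ∧ (∀ᶠ v in 𝓝[<] (u i), v ∉ L) ∧ ∀ᶠ v in 𝓝[>] (u i), v ∈ L))
    {v : ℝ} (hv : ∀ i ∈ F, u i ≠ v) :
    L.indicator (fun _ => (1 : ℝ)) v = -∑ i ∈ F, if u i < v then s i else 0 := by
  -- The jumps of the indicator and of the signed count cancel at each `u i`, so `J` is constant off
  -- the crossings. Far to the left both terms vanish, hence the constant is zero.
  set J : ℝ → ℝ := fun v => L.indicator (fun _ => (1 : ℝ)) v + ∑ i ∈ F, if u i < v then s i else 0
  have hterm : ∀ (a v : ℝ) (s : ℝ), a ≠ v →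
      ∀ᶠ v' in 𝓝 v, (if a < v' then s else 0) = if a < v then s else 0 := by
    intro a v s hav
    rcases lt_or_gt_of_ne hav with h | h
    · filter_upwards [lt_mem_nhds h] with v' hv'
      simp [h, hv']
    · filter_upwards [gt_mem_nhds h] with v' hv'
      rw [if_neg (not_lt.2 h.le), if_neg (not_lt.2 (le_of_lt hv'))]
  have hJoff : ∀ v, (∀ i ∈ F, u i ≠ v) → ∀ᶠ v' in 𝓝 v, J v' = J v := by
    intro v hv
    have h1 : ∀ᶠ v' in 𝓝 v, ∀ i ∈ F, (if u i < v' then s i else 0) = if u i < v then s i else 0 :=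
      (eventually_all_finset F).2 fun i hi => hterm _ _ _ (hv i hi)
    filter_upwards [hoff v hv, h1] with v' h2 h3
    simp only [J, Finset.sum_congr rfl h3, Set.indicator, h2]
  have hJ : ∀ v, ∃ a, ∀ᶠ v' in 𝓝[≠] v, J v' = a := by
    intro v
    by_cases hv : ∀ i ∈ F, u i ≠ v
    · exact ⟨J v, nhdsWithin_le_nhds (hJoff v hv)⟩
    push Not at hv
    obtain ⟨i, hi, rfl⟩ := hv
    set R : ℝ := ∑ j ∈ F.erase i, if u j < u i then s j else 0
    have h1 : ∀ᶠ v' in 𝓝 (u i), ∀ j ∈ F.erase i,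
        (if u j < v' then s j else 0) = if u j < u i then s j else 0 :=
      (eventually_all_finset _).2 fun j hj => hterm _ _ _ fun h =>
        Finset.ne_of_mem_erase hj (hinj (Finset.mem_of_mem_erase hj) hi h)
    have h2 : ∀ᶠ v' in 𝓝 (u i), J v' =
        L.indicator (fun _ => (1 : ℝ)) v' + ((if u i < v' then s i else 0) + R) := by
      filter_upwards [h1] with v' hv'
      simp only [J, R]
      rw [← Finset.add_sum_erase F _ hi, Finset.sum_congr rfl hv']
    have hlt : ∀ᶠ v' in 𝓝[<] (u i), v' < u i := self_mem_nhdsWithin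
    have hgt : ∀ᶠ v' in 𝓝[>] (u i), u i < v' := self_mem_nhdsWithin
    rw [← Set.Iio_union_Ioi, nhdsWithin_union]
    rcases hcross i hi with ⟨hs, hl, hr⟩ | ⟨hs, hl, hr⟩
    · refine ⟨1 + R, eventually_sup.2 ⟨?_, ?_⟩⟩
      · filter_upwards [nhdsWithin_le_nhds h2, hl, hlt] with v' a1 a2 a3
        rw [a1, Set.indicator_of_mem a2, if_neg a3.not_gt]
        ring
      · filter_upwards [nhdsWithin_le_nhds h2, hr, hgt] with v' a1 a2 a3
        rw [a1, Set.indicator_of_notMem a2, if_pos a3, hs]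
        ring
    · refine ⟨R, eventually_sup.2 ⟨?_, ?_⟩⟩
      · filter_upwards [nhdsWithin_le_nhds h2, hl, hlt] with v' a1 a2 a3
        rw [a1, Set.indicator_of_notMem a2, if_neg a3.not_gt]
        ring
      · filter_upwards [nhdsWithin_le_nhds h2, hr, hgt] with v' a1 a2 a3
        rw [a1, Set.indicator_of_mem a2, if_pos a3, hs]
        ring
  obtain ⟨a, ha⟩ := exists_eq_of_punctured_const hJ
  have hval : ∀ v, (∀ i ∈ F, u i ≠ v) → J v = a := by
    intro v hv
    obtain ⟨z, hz1, hz2⟩ := ((ha v).and (nhdsWithin_le_nhds (hJoff v hv))).exists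
    exact hz2.symm.trans hz1
  obtain ⟨b, hb⟩ := hbdd
  obtain ⟨v₀, hv₀⟩ : ∃ v₀, v₀ < b ∧ ∀ i ∈ F, v₀ < u i := by
    have h1 : ∀ᶠ v in atBot, ∀ i ∈ F, v < u i :=
      (eventually_all_finset F).2 fun i _ => eventually_lt_atBot _
    exact ((eventually_lt_atBot b).and h1).exists
  have hJ0 : J v₀ = 0 := by
    have h1 : v₀ ∉ L := fun h => hv₀.1.not_ge (hb h)
    simp only [J, Set.indicator_of_notMem h1, zero_add]
    exact Finset.sum_eq_zero fun i hi => if_neg (hv₀.2 i hi).not_gt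
  have ha0 : a = 0 := by rw [← hval v₀ fun i hi => (hv₀.2 i hi).ne', hJ0]
  have := hval v hv
  simp only [J, ha0] at this
  linarith

end Line

/-! ### Charts of flat faces -/

section FaceChart

variable {m : ℕ}

/-- The chart `y ↦ x₀ + ι y` parametrizes the hyperplane spanned by `e`, and `x₀` is a relative
interior point of `e`. -/
structure IsFaceChart (e : Set (Pt (m + 1))) (x₀ : Pt (m + 1))
    (ι : Pt m →ₗᵢ[ℝ] Pt (m + 1)) : Prop where
  base : x₀ ∈ intrinsicInterior ℝ e
  range_eq : Set.range (chart x₀ ι) = (affineSpan ℝ e : Set (Pt (m + 1)))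
  mem_span : ∀ y, ι y ∈ vectorSpan ℝ e

lemma IsFlatFace.exists_chart {e : Set (Pt (m + 1))} (he : IsFlatFace e) :
    ∃ x₀ ι, IsFaceChart e x₀ ι := by
  obtain ⟨x₀, hx₀⟩ := he.connected.nonempty
  have hdim : finrank ℝ (vectorSpan ℝ e) = m := by have := he.hyperplane; omega
  let L : Pt m ≃ₗᵢ[ℝ] vectorSpan ℝ e :=
    ((stdOrthonormalBasis ℝ (vectorSpan ℝ e)).reindex (finCongr hdim)).repr.symm
  refine ⟨x₀, (vectorSpan ℝ e).subtypeₗᵢ.comp L.toLinearIsometry, hx₀, ?_, fun y => (L y).2⟩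
  have hx : x₀ ∈ affineSpan ℝ e := subset_affineSpan ℝ e (intrinsicInterior_subset hx₀)
  ext x
  constructor
  · rintro ⟨y, rfl⟩
    have : (L y : Pt (m + 1)) +ᵥ x₀ ∈ affineSpan ℝ e :=
      AffineSubspace.vadd_mem_of_mem_direction (by rw [direction_affineSpan]; exact (L y).2) hx
    rw [vadd_eq_add, add_comm (L y : Pt (m + 1)) x₀] at this
    exact this
  · intro hxe
    have h1 : x -ᵥ x₀ ∈ vectorSpan ℝ e := by
      rw [← direction_affineSpan]
      exact AffineSubspace.vsub_mem_direction hxe hx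
    refine ⟨L.symm ⟨x -ᵥ x₀, h1⟩, ?_⟩
    simp [chart]

variable {e : Set (Pt (m + 1))} {x₀ : Pt (m + 1)} {ι : Pt m →ₗᵢ[ℝ] Pt (m + 1)}

lemma IsFaceChart.subset_range (h : IsFaceChart e x₀ ι) : e ⊆ Set.range (chart x₀ ι) := by
  rw [h.range_eq]
  exact subset_affineSpan ℝ e

lemma IsFaceChart.base_mem (h : IsFaceChart e x₀ ι) : x₀ ∈ e := intrinsicInterior_subset h.base

/-- The intrinsic interior is the interior relative to the affine span, and the chart is a
homeomorphism onto that span. -/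
lemma IsFaceChart.intrinsicInterior_eq (h : IsFaceChart e x₀ ι) :
    intrinsicInterior ℝ e = chart x₀ ι '' interior (chart x₀ ι ⁻¹' e) := by
  have hmem : ∀ y, chart x₀ ι y ∈ affineSpan ℝ e := fun y => by
    rw [← SetLike.mem_coe, ← h.range_eq]
    exact ⟨y, rfl⟩
  let a : Pt m → affineSpan ℝ e := fun y => ⟨chart x₀ ι y, hmem y⟩
  have ha : Continuous a := (isometry_chart x₀ ι).continuous.subtype_mk _
  have hiso : Isometry a := fun y z => isometry_chart x₀ ι y z
  have hsurj : Function.Surjective a := by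
    rintro ⟨x, hx⟩
    rw [← SetLike.mem_coe, ← h.range_eq] at hx
    obtain ⟨y, rfl⟩ := hx
    exact ⟨y, rfl⟩
  let H : Pt m ≃ₜ affineSpan ℝ e :=
    (IsometryEquiv.mk (Equiv.ofBijective a ⟨hiso.injective, hsurj⟩) hiso).toHomeomorph
  have h1 : chart x₀ ι ⁻¹' e = H ⁻¹' (Subtype.val ⁻¹' e) := rfl
  rw [h1, ← H.preimage_interior]
  ext x
  rw [mem_intrinsicInterior]
  constructor
  · rintro ⟨y, hy, rfl⟩
    refine ⟨H.symm y, by simpa using hy, ?_⟩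
    exact congrArg Subtype.val (H.apply_symm_apply y)
  · rintro ⟨y, hy, rfl⟩
    exact ⟨H y, hy, rfl⟩

/-- The relative boundary of a flat face is null. -/
lemma IsFaceChart.volume_diff_intrinsicInterior (h : IsFaceChart e x₀ ι) (he : IsFlatFace e) :
    volume (chart x₀ ι ⁻¹' (e \ intrinsicInterior ℝ e)) = 0 := by
  obtain ⟨S, hS⟩ := he.polytopal
  let A : Pt m →ᵃ[ℝ] Pt (m + 1) := AffineMap.const ℝ (Pt m) x₀ + ι.toLinearMap.toAffineMap
  have hA : (A : Pt m → Pt (m + 1)) = chart x₀ ι := funext fun y => by simp [A, chart]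
  have hconv : ∀ s : Finset (Pt (m + 1)),
      Convex ℝ (chart x₀ ι ⁻¹' convexHull ℝ (s : Set (Pt (m + 1)))) := fun s => by
    rw [← hA]
    exact (convex_convexHull ℝ (s : Set (Pt (m + 1)))).affine_preimage A
  -- A point interior to one of the convex pieces of `e` is interior to `e`. So a relative boundary
  -- point lies on the frontier of every piece containing it, and frontiers of convex sets are null.
  have hsub : chart x₀ ι ⁻¹' (e \ intrinsicInterior ℝ e) ⊆
      ⋃ s ∈ S, frontier (chart x₀ ι ⁻¹' convexHull ℝ (s : Set (Pt (m + 1)))) := by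
    rintro y ⟨hy, hyi⟩
    have hy' := hy
    rw [hS] at hy'
    simp only [Set.mem_iUnion] at hy'
    obtain ⟨s, hs, hys⟩ := hy'
    refine Set.mem_iUnion₂.2 ⟨s, hs, subset_closure hys, fun h_int => hyi ?_⟩
    rw [h.intrinsicInterior_eq]
    refine ⟨y, interior_mono (fun z hz => ?_) h_int, rfl⟩
    change chart x₀ ι z ∈ e
    rw [hS]
    exact Set.mem_iUnion₂.2 ⟨s, hs, hz⟩
  refine measure_mono_null hsub ?_
  exact (measure_biUnion_null_iff S.countable_toSet).2 fun s _ => (hconv s).addHaar_frontier volume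

lemma IsFlatFace.isClosed (he : IsFlatFace e) : IsClosed e := by
  rw [← he.regular]
  exact isClosed_closure

lemma affineSpan_ne_top_of_orthogonal {ν : Pt (m + 1)} (hν : ‖ν‖ = 1)
    (horth : ∀ w ∈ vectorSpan ℝ e, inner ℝ ν w = 0) : affineSpan ℝ e ≠ ⊤ := by
  intro htop
  have h1 : vectorSpan ℝ e = ⊤ := by
    rw [← direction_affineSpan, htop, AffineSubspace.direction_top]
  have h2 := horth ν (by rw [h1]; trivial)
  rw [real_inner_self_eq_norm_sq, hν] at h2
  norm_num at h2

lemma IsFaceChart.orthogonal (h : IsFaceChart e x₀ ι) {ν : Pt (m + 1)}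
    (horth : ∀ w ∈ vectorSpan ℝ e, inner ℝ ν w = 0) (y : Pt m) : inner ℝ ν (ι y) = 0 :=
  horth _ (h.mem_span y)

/-- The hyperplane of a face is the zero set of the normal component. -/
lemma IsFaceChart.mem_affineSpan_iff (h : IsFaceChart e x₀ ι) {ν : Pt (m + 1)} (hν : ‖ν‖ = 1)
    (horth : ∀ w ∈ vectorSpan ℝ e, inner ℝ ν w = 0) {x : Pt (m + 1)} :
    x ∈ affineSpan ℝ e ↔ inner ℝ ν (x - x₀) = 0 := by
  rw [← SetLike.mem_coe, ← h.range_eq]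
  constructor
  · rintro ⟨y, rfl⟩
    simpa [chart] using h.orthogonal horth y
  · intro hx
    obtain ⟨b, hb⟩ := exists_eq_inner_smul_add hν (h.orthogonal horth) (x - x₀)
    refine ⟨b, ?_⟩
    rw [hx, zero_smul, zero_add] at hb
    rw [chart, ← hb]
    abel

end FaceChart

/-! ### The divergence theorem on a polytopal element -/

section Divergence

open Filter Topology

variable {m : ℕ}

/-- A closed bounded set whose boundary consists of finitely many flat faces `e ∈ F`, no two of
them in a common hyperplane, with outward unit normals `ν e`. -/
structure IsFacetedBody (T : Set (Pt (m + 1))) (F : Finset (Set (Pt (m + 1))))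
    (ν : Set (Pt (m + 1)) → Pt (m + 1)) : Prop where
  isClosed : IsClosed T
  isBounded : Bornology.IsBounded T
  frontier_eq : frontier T = ⋃ e ∈ F, e
  flat : ∀ e ∈ F, IsFlatFace e
  normal : ∀ e ∈ F, IsOutwardNormal T e (ν e)
  noncoplanar : ∀ e ∈ F, ∀ e' ∈ F, e ≠ e' → ∃ x ∈ e, x ∉ affineSpan ℝ e'

/-- Off the frontier, the interior of `T` and the complement of its closure form an open partition,
which cannot separate a preconnected set. -/
lemma mem_of_isPreconnected_of_disjoint_frontier {X : Type*} [TopologicalSpace X] {s T : Set X}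
    (hs : IsPreconnected s) (hd : ∀ x ∈ s, x ∉ frontier T) {x y : X} (hx : x ∈ s) (hxT : x ∈ T)
    (hy : y ∈ s) : y ∈ T := by
  have h_int : ∀ z ∈ s, z ∈ closure T → z ∈ interior T := fun z hz hzc => by
    by_contra h
    exact hd z hz ⟨hzc, h⟩
  by_contra hyT
  have hyc : y ∉ closure T := fun h => hyT (interior_subset (h_int y hy h))
  obtain ⟨z, -, hz1, hz2⟩ := hs (interior T) (closure T)ᶜ isOpen_interior
    isClosed_closure.isOpen_compl
    (fun z hz => by
      by_cases h : z ∈ closure T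
      · exact Or.inl (h_int z hz h)
      · exact Or.inr h)
    ⟨x, hx, h_int x hx (subset_closure hxT)⟩ ⟨y, hy, hyc⟩
  exact hz2 (subset_closure (interior_subset hz1))

/-- Near a boundary point lying on a single hyperplane, the two sides of the hyperplane are
inside and outside. -/
lemma IsOutwardNormal.side {T e : Set (Pt (m + 1))} {ν : Pt (m + 1)} (hν : IsOutwardNormal T e ν)
    {z : Pt (m + 1)} (hz : z ∈ intrinsicInterior ℝ e) {ε : ℝ} (hε : 0 < ε)
    (hfr : ∀ x ∈ Metric.ball z ε, x ∈ frontier T → inner ℝ ν (x - z) = 0) :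
    (∀ x ∈ Metric.ball z ε, 0 < inner ℝ ν (x - z) → x ∉ T) ∧
      (∀ x ∈ Metric.ball z ε, inner ℝ ν (x - z) < 0 → x ∈ T) := by
  have hin : ∀ t : ℝ, inner ℝ ν (t • ν) = t := fun t => by
    rw [inner_smul_right, real_inner_self_eq_norm_sq, hν.unit]
    simp
  have hlin : IsLinearMap ℝ fun x : Pt (m + 1) => inner ℝ ν x :=
    ⟨fun x y => inner_add_right _ _ _, fun c x => inner_smul_right _ _ _⟩
  -- The two open half-balls are convex and miss the frontier, so each is wholly inside or wholly
  -- outside. The definition of the normal supplies one point of known status in each.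
  have hpos : Convex ℝ (Metric.ball z ε ∩ {x | inner ℝ ν z < inner ℝ ν x}) :=
    (convex_ball z ε).inter (convex_halfSpace_gt hlin _)
  have hneg : Convex ℝ (Metric.ball z ε ∩ {x | inner ℝ ν x < inner ℝ ν z}) :=
    (convex_ball z ε).inter (convex_halfSpace_lt hlin _)
  have hball : ∀ t : ℝ, |t| < ε → z + t • ν ∈ Metric.ball z ε := fun t ht => by
    simpa [norm_smul, hν.unit] using ht
  constructor
  · intro x hx hx0 hxT
    obtain ⟨η, hη, hout⟩ := hν.outside z hz
    obtain ⟨t, ht0, ht⟩ := exists_between (lt_min hη hε)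
    rw [lt_min_iff] at ht
    refine hout t ht0 ht.1 ?_
    refine mem_of_isPreconnected_of_disjoint_frontier hpos.isPreconnected (fun y hy hyf => ?_)
      ⟨hx, by simpa [inner_sub_right] using hx0⟩ hxT ⟨hball t (by rw [abs_of_pos ht0]; exact ht.2), ?_⟩
    · have h1 := hfr y hy.1 hyf
      have h2 : inner ℝ ν z < inner ℝ ν y := hy.2
      rw [inner_sub_right] at h1
      linarith
    · change inner ℝ ν z < inner ℝ ν (z + t • ν)
      rw [inner_add_right, hin]
      linarith
  · intro x hx hx0
    obtain ⟨η, hη, hins⟩ := hν.inside z hz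
    obtain ⟨t, ht0, ht⟩ := exists_between (lt_min hη hε)
    rw [lt_min_iff] at ht
    have hmem := hins t ht0 ht.1
    rw [sub_eq_add_neg, ← neg_smul] at hmem
    refine mem_of_isPreconnected_of_disjoint_frontier hneg.isPreconnected (fun y hy hyf => ?_)
      ⟨hball (-t) (by rw [abs_neg, abs_of_pos ht0]; exact ht.2), ?_⟩ hmem
      ⟨hx, by simpa [inner_sub_right] using hx0⟩
    · have h1 := hfr y hy.1 hyf
      have h2 : inner ℝ ν y < inner ℝ ν z := hy.2
      rw [inner_sub_right] at h1
      linarith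
    · change inner ℝ ν (z + -t • ν) < inner ℝ ν z
      rw [inner_add_right, hin]
      linarith

variable {T : Set (Pt (m + 1))} {F : Finset (Set (Pt (m + 1)))}
  {ν : Set (Pt (m + 1)) → Pt (m + 1)}

lemma IsFacetedBody.inner_eq_zero (hT : IsFacetedBody T F ν) {e : Set (Pt (m + 1))} (he : e ∈ F)
    {x z : Pt (m + 1)} (hx : x ∈ e) (hz : z ∈ e) : inner ℝ (ν e) (x - z) = 0 :=
  (hT.normal e he).orthogonal _ (vsub_mem_vectorSpan ℝ hx hz)

/-- The remaining faces are closed and miss `z`, so a small ball meets the frontier only in `e`, and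
`IsOutwardNormal.side` applies. -/
lemma IsFacetedBody.exists_ball (hT : IsFacetedBody T F ν) {e : Set (Pt (m + 1))} (he : e ∈ F)
    {z : Pt (m + 1)} (hz : z ∈ intrinsicInterior ℝ e) (hz' : ∀ e' ∈ F, e' ≠ e → z ∉ e') :
    ∃ ε > 0, (∀ x ∈ Metric.ball z ε, 0 < inner ℝ (ν e) (x - z) → x ∉ T) ∧
      (∀ x ∈ Metric.ball z ε, inner ℝ (ν e) (x - z) < 0 → x ∈ T) := by
  have h1 : ∀ᶠ x in 𝓝 z, ∀ e' ∈ F, e' ≠ e → x ∉ e' := by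
    refine (eventually_all_finset F).2 fun e' he' => ?_
    by_cases hee : e' = e
    · exact Eventually.of_forall fun x h => (h hee).elim
    · filter_upwards [(hT.flat e' he').isClosed.isOpen_compl.mem_nhds (hz' e' he' hee)] with x hx _
      exact hx
  obtain ⟨ε, hε, hball⟩ := Metric.eventually_nhds_iff_ball.1 h1
  refine ⟨ε, hε, (hT.normal e he).side hz hε fun x hx hxf => ?_⟩
  rw [hT.frontier_eq] at hxf
  simp only [Set.mem_iUnion] at hxf
  obtain ⟨e', he', hxe⟩ := hxf
  have : e' = e := by
    by_contra h
    exact hball x hx e' he' h hxe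
  subst this
  exact hT.inner_eq_zero he hxe (intrinsicInterior_subset hz)

/-- A line of direction `w` in general position with respect to the faces. -/
structure GenericLine (F : Finset (Set (Pt (m + 1)))) (ν : Set (Pt (m + 1)) → Pt (m + 1))
    (w x : Pt (m + 1)) : Prop where
  tangent : ∀ e ∈ F, inner ℝ (ν e) w = 0 → ∀ u : ℝ, x + u • w ∉ e
  interior : ∀ e ∈ F, inner ℝ (ν e) w ≠ 0 → ∀ u : ℝ, x + u • w ∉ e \ intrinsicInterior ℝ e
  single : ∀ e ∈ F, ∀ e' ∈ F, e ≠ e' → inner ℝ (ν e) w ≠ 0 → ∀ u : ℝ, x + u • w ∉ e ∩ e'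
  base : ∀ e ∈ F, x ∉ e

/-- Each exceptional set is null. For a face parallel to `w`, a line meeting it starts in its
hyperplane. For a transverse face, the bad points lie in a cylinder over a null subset of the face:
its relative boundary, or its intersection with another face, which lies in a proper affine subspace
because the faces are not coplanar. -/
lemma IsFacetedBody.ae_genericLine (hT : IsFacetedBody T F ν) (w : Pt (m + 1)) :
    ∀ᵐ x, GenericLine F ν w x := by
  have hface : ∀ e ∈ F, volume (affineSpan ℝ e : Set (Pt (m + 1))) = 0 := fun e he =>
    Measure.addHaar_affineSubspace volume _
      (affineSpan_ne_top_of_orthogonal (hT.normal e he).unit (hT.normal e he).orthogonal)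
  have h1 : ∀ᵐ x : Pt (m + 1), ∀ e ∈ F, inner ℝ (ν e) w = 0 → ∀ u : ℝ, x + u • w ∉ e := by
    refine (F.eventually_all (l := ae volume)).2 fun e he => ?_
    obtain ⟨x₀, ι, hch⟩ := (hT.flat e he).exists_chart
    have := measure_eq_zero_iff_ae_notMem.1 (hface e he)
    filter_upwards [this] with x hx hw u hu
    refine hx ?_
    have h2 := (hch.mem_affineSpan_iff (hT.normal e he).unit (hT.normal e he).orthogonal).1
      (subset_affineSpan ℝ e hu)
    refine (hch.mem_affineSpan_iff (hT.normal e he).unit (hT.normal e he).orthogonal).2 ?_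
    rw [add_sub_right_comm, inner_add_right, inner_smul_right, hw] at h2
    simpa using h2
  have hcyl : ∀ e ∈ F, inner ℝ (ν e) w ≠ 0 → ∀ Z ⊆ e,
      (∀ x₀ ι, IsFaceChart e x₀ ι → volume (chart x₀ ι ⁻¹' Z) = 0) →
        ∀ᵐ x : Pt (m + 1), ∀ u : ℝ, x + u • w ∉ Z := by
    intro e he hw Z hZ hnull
    obtain ⟨x₀, ι, hch⟩ := (hT.flat e he).exists_chart
    have := measure_eq_zero_iff_ae_notMem.1 (volume_cylinder_eq_zero x₀ (hT.normal e he).unit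
      (hch.orthogonal (hT.normal e he).orthogonal) hw (hZ.trans hch.subset_range) (hnull x₀ ι hch))
    filter_upwards [this] with x hx u hu
    exact hx ⟨u, hu⟩
  have h2 : ∀ᵐ x : Pt (m + 1), ∀ e ∈ F, inner ℝ (ν e) w ≠ 0 →
      ∀ u : ℝ, x + u • w ∉ e \ intrinsicInterior ℝ e := by
    refine (F.eventually_all (l := ae volume)).2 fun e he => ?_
    by_cases hw : inner ℝ (ν e) w ≠ 0
    · filter_upwards [hcyl e he hw _ Set.sdiff_subset fun x₀ ι hch =>
        hch.volume_diff_intrinsicInterior (hT.flat e he)] with x hx _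
      exact hx
    · exact Eventually.of_forall fun x h => (hw h).elim
  have h3 : ∀ᵐ x : Pt (m + 1), ∀ e ∈ F, ∀ e' ∈ F, e ≠ e' → inner ℝ (ν e) w ≠ 0 →
      ∀ u : ℝ, x + u • w ∉ e ∩ e' := by
    refine (F.eventually_all (l := ae volume)).2 fun e he =>
      (F.eventually_all (l := ae volume)).2 fun e' he' => ?_
    by_cases hw : e ≠ e' ∧ inner ℝ (ν e) w ≠ 0
    · have hnull : ∀ x₀ ι, IsFaceChart e x₀ ι → volume (chart x₀ ι ⁻¹' (e ∩ e')) = 0 := by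
        intro x₀ ι hch
        let A : Pt m →ᵃ[ℝ] Pt (m + 1) := AffineMap.const ℝ (Pt m) x₀ + ι.toLinearMap.toAffineMap
        have hA : (A : Pt m → Pt (m + 1)) = chart x₀ ι := funext fun y => by simp [A, chart]
        obtain ⟨x, hxe, hxe'⟩ := hT.noncoplanar e he e' he' hw.1
        obtain ⟨y, rfl⟩ := hch.subset_range hxe
        have htop : (affineSpan ℝ e').comap A ≠ ⊤ := by
          intro h
          have : y ∈ (affineSpan ℝ e').comap A := by rw [h]; trivial
          rw [AffineSubspace.mem_comap, hA] at this
          exact hxe' this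
        refine measure_mono_null (fun z hz => ?_) (Measure.addHaar_affineSubspace volume _ htop)
        change A z ∈ affineSpan ℝ e'
        rw [hA]
        exact subset_affineSpan ℝ e' hz.2
      filter_upwards [hcyl e he hw.2 (e ∩ e') Set.inter_subset_left hnull] with x hx _ _
      exact hx
    · exact Eventually.of_forall fun x h h' => (hw ⟨h, h'⟩).elim
  have h4 : ∀ᵐ x : Pt (m + 1), ∀ e ∈ F, x ∉ e :=
    (F.eventually_all (l := ae volume)).2 fun e he =>
      measure_eq_zero_iff_ae_notMem.1 (measure_mono_null (subset_affineSpan ℝ e) (hface e he))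
  filter_upwards [h1, h2, h3, h4] with x a1 a2 a3 a4
  exact ⟨a1, a2, a3, a4⟩

/-- A transverse line meets a face at most once. -/
lemma IsFacetedBody.line_unique (hT : IsFacetedBody T F ν) {e : Set (Pt (m + 1))} (he : e ∈ F)
    {w x : Pt (m + 1)} (hw : inner ℝ (ν e) w ≠ 0) {u u' : ℝ} (hu : x + u • w ∈ e)
    (hu' : x + u' • w ∈ e) : u = u' := by
  have := hT.inner_eq_zero he hu hu'
  rw [add_sub_add_left_eq_sub, ← sub_smul, inner_smul_right, mul_eq_zero] at this
  exact sub_eq_zero.1 (this.resolve_right hw)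

open Classical in
/-- Along a generic line, the indicator of the body is the signed count of the faces behind. -/
lemma IsFacetedBody.indicator_eq (hT : IsFacetedBody T F ν) {w : Pt (m + 1)} (hw0 : w ≠ 0)
    {x : Pt (m + 1)} (hx : GenericLine F ν w x) :
    T.indicator (fun _ => (1 : ℝ)) x = -∑ e ∈ F, Real.sign (inner ℝ (ν e) w) *
      {x : Pt (m + 1) | ∃ u ≤ (0 : ℝ), x + u • w ∈ e}.indicator (fun _ => (1 : ℝ)) x := by
  let F' := F.filter fun e => inner ℝ (ν e) w ≠ 0 ∧ ∃ u : ℝ, x + u • w ∈ e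
  have hF' : ∀ e ∈ F', e ∈ F ∧ inner ℝ (ν e) w ≠ 0 ∧ ∃ u : ℝ, x + u • w ∈ e := fun e he =>
    Finset.mem_filter.1 he
  have hu : ∀ e, ∃ u : ℝ, e ∈ F' → x + u • w ∈ e := fun e => by
    by_cases he : e ∈ F'
    · obtain ⟨u, hu⟩ := (hF' e he).2.2
      exact ⟨u, fun _ => hu⟩
    · exact ⟨0, fun h => (he h).elim⟩
  choose u hu using hu
  let L : Set ℝ := {v | x + v • w ∈ T}
  have hcontl : Continuous fun v : ℝ => x + v • w := by fun_prop
  have hL : BddBelow L := by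
    obtain ⟨R, hR⟩ := hT.isBounded.exists_norm_le
    refine ⟨-((R + ‖x‖) / ‖w‖), fun v hv => ?_⟩
    have h1 : ‖v • w‖ ≤ R + ‖x‖ := by
      calc ‖v • w‖ = ‖(x + v • w) - x‖ := by congr 1; abel
        _ ≤ ‖x + v • w‖ + ‖x‖ := norm_sub_le _ _
        _ ≤ _ := by gcongr; exact hR _ hv
    rw [norm_smul, Real.norm_eq_abs, ← le_div_iff₀ (norm_pos_iff.2 hw0)] at h1
    exact (abs_le.1 h1).1
  have hzero : ∀ e ∈ F', u e ≠ 0 := by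
    intro e he h0
    refine hx.base e (hF' e he).1 ?_
    simpa [h0] using hu e he
  have key := indicator_eq_neg_sum F' u (fun e => Real.sign (inner ℝ (ν e) w)) L hL ?_ ?_ ?_ hzero
  · have h1 : L.indicator (fun _ => (1 : ℝ)) 0 = T.indicator (fun _ => (1 : ℝ)) x := by
      simp [L, Set.indicator]
    rw [← h1, key, Finset.sum_filter]
    congr 1
    refine Finset.sum_congr rfl fun e he => ?_
    by_cases hc : inner ℝ (ν e) w = 0
    · simp [hc]
    by_cases hm : ∃ v : ℝ, x + v • w ∈ e
    · have heF' : e ∈ F' := Finset.mem_filter.2 ⟨he, hc, hm⟩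
      rw [if_pos ⟨hc, hm⟩]
      have hiff : x ∈ {x : Pt (m + 1) | ∃ u ≤ (0 : ℝ), x + u • w ∈ e} ↔ u e < 0 := by
        constructor
        · rintro ⟨v, hv0, hv⟩
          rw [hT.line_unique he hc hv (hu e heF')] at hv0
          exact lt_of_le_of_ne hv0 (hzero e heF')
        · intro h
          exact ⟨u e, h.le, hu e heF'⟩
      by_cases hlt : u e < 0
      · rw [if_pos hlt, Set.indicator_of_mem (hiff.2 hlt), mul_one]
      · rw [if_neg hlt, Set.indicator_of_notMem (fun h => hlt (hiff.1 h)), mul_zero]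
    · rw [if_neg fun h => hm h.2, Set.indicator_of_notMem, mul_zero]
      rintro ⟨v, -, hv⟩
      exact hm ⟨v, hv⟩
  · intro e he e' he' hee
    by_contra hne
    refine hx.single e (hF' e he).1 e' (hF' e' he').1 hne (hF' e he).2.1 (u e) ⟨hu e he, ?_⟩
    rw [hee]
    exact hu e' he'
  · intro v hv
    have hnf : x + v • w ∉ frontier T := by
      rw [hT.frontier_eq]
      simp only [Set.mem_iUnion, not_exists]
      intro e he hxe
      by_cases hc : inner ℝ (ν e) w = 0
      · exact hx.tangent e he hc v hxe
      · have heF' : e ∈ F' := Finset.mem_filter.2 ⟨he, hc, v, hxe⟩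
        exact hv e heF' (hT.line_unique he hc (hu e heF') hxe)
    by_cases hin : x + v • w ∈ interior T
    · filter_upwards [hcontl.continuousAt.preimage_mem_nhds (isOpen_interior.mem_nhds hin)]
        with v' hv'
      exact ⟨fun _ => interior_subset (s := T) hin, fun _ => interior_subset (s := T) hv'⟩
    · have hcl : x + v • w ∉ closure T := fun h => hnf ⟨h, hin⟩
      filter_upwards [hcontl.continuousAt.preimage_mem_nhds
        (isClosed_closure.isOpen_compl.mem_nhds hcl)] with v' hv'
      exact ⟨fun h => (hv' (subset_closure h)).elim, fun h => (hcl (subset_closure h)).elim⟩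
  · intro e he
    obtain ⟨heF, hc, -⟩ := hF' e he
    have hz : x + u e • w ∈ intrinsicInterior ℝ e := by
      by_contra h
      exact hx.interior e heF hc (u e) ⟨hu e he, h⟩
    obtain ⟨ε, hε, hout, hins⟩ := hT.exists_ball heF hz fun e' he' hne hmem =>
      hx.single e heF e' he' hne.symm hc (u e) ⟨hu e he, hmem⟩
    have hnear : ∀ᶠ v in 𝓝 (u e), x + v • w ∈ Metric.ball (x + u e • w) ε :=
      hcontl.continuousAt.preimage_mem_nhds (Metric.ball_mem_nhds _ hε)
    have hval : ∀ v : ℝ, inner ℝ (ν e) (x + v • w - (x + u e • w)) =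
        (v - u e) * inner ℝ (ν e) w := fun v => by
      rw [add_sub_add_left_eq_sub, ← sub_smul, inner_smul_right]
    have hlt : ∀ᶠ v in 𝓝[<] (u e), v < u e := self_mem_nhdsWithin
    have hgt : ∀ᶠ v in 𝓝[>] (u e), u e < v := self_mem_nhdsWithin
    -- The line moves along `w`, so it leaves `T` through `e` exactly when `w` has a positive
    -- component along the outward normal.
    rcases lt_or_gt_of_ne hc with hneg | hpos
    · refine Or.inr ⟨Real.sign_of_neg hneg, ?_, ?_⟩
      · filter_upwards [nhdsWithin_le_nhds hnear, hlt] with v h1 h2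
        exact hout _ h1 (by rw [hval]; exact mul_pos_of_neg_of_neg (sub_neg.2 h2) hneg)
      · filter_upwards [nhdsWithin_le_nhds hnear, hgt] with v h1 h2
        exact hins _ h1 (by rw [hval]; exact mul_neg_of_pos_of_neg (sub_pos.2 h2) hneg)
    · refine Or.inl ⟨Real.sign_of_pos hpos, ?_, ?_⟩
      · filter_upwards [nhdsWithin_le_nhds hnear, hlt] with v h1 h2
        exact hins _ h1 (by rw [hval]; exact mul_neg_of_neg_of_pos (sub_neg.2 h2) hpos)
      · filter_upwards [nhdsWithin_le_nhds hnear, hgt] with v h1 h2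
        exact hout _ h1 (by rw [hval]; exact mul_pos (sub_pos.2 h2) hpos)

/-- The divergence theorem for a compactly supported function. -/
lemma IsFacetedBody.integral_fderiv (hT : IsFacetedBody T F ν) {w : Pt (m + 1)} (hw0 : w ≠ 0)
    {f : Pt (m + 1) → ℝ} (hf : ContDiff ℝ 1 f) (hfs : HasCompactSupport f) :
    ∫ x in T, fderiv ℝ f x w = ∑ e ∈ F, inner ℝ (ν e) w * ∫ x in e, f x ∂μHE[m] := by
  let c : Set (Pt (m + 1)) → Set (Pt (m + 1)) := fun e => {x | ∃ u ≤ (0 : ℝ), x + u • w ∈ e}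
  have hf' : Continuous fun x => fderiv ℝ f x w :=
    (hf.continuous_fderiv one_ne_zero).clm_apply continuous_const
  have h_int : Integrable (fun x => fderiv ℝ f x w) (volume : Measure (Pt (m + 1))) :=
    hf'.integrable_of_hasCompactSupport
      ((hfs.fderiv ℝ).comp_left (g := fun L : Pt (m + 1) →L[ℝ] ℝ => L w) (by simp))
  have hcyl : ∀ e ∈ F, inner ℝ (ν e) w ≠ 0 → MeasurableSet (c e) ∧
      ∫ x in c e, fderiv ℝ f x w = -(|inner ℝ (ν e) w| * ∫ x in e, f x ∂μHE[m]) := by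
    intro e he hc
    obtain ⟨x₀, ι, hch⟩ := (hT.flat e he).exists_chart
    exact integral_halfCylinder x₀ (hT.normal e he).unit
      (hch.orthogonal (hT.normal e he).orthogonal) hc hch.subset_range
      (hT.flat e he).isClosed.measurableSet hf hfs
  -- The indicator identity is multiplied by the derivative before integrating. The half-cylinders
  -- are unbounded, so it is the compact support of `f` that makes the separate integrals finite.
  have hae : ∀ᵐ x : Pt (m + 1), T.indicator (fun x => fderiv ℝ f x w) x =
      -∑ e ∈ F, Real.sign (inner ℝ (ν e) w) * (c e).indicator (fun x => fderiv ℝ f x w) x := by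
    filter_upwards [hT.ae_genericLine w] with x hx
    have h1 : ∀ A : Set (Pt (m + 1)), A.indicator (fun x => fderiv ℝ f x w) x =
        A.indicator (fun _ => (1 : ℝ)) x * fderiv ℝ f x w := fun A => by
      by_cases h : x ∈ A <;> simp [h]
    simp only [h1]
    rw [hT.indicator_eq hw0 hx, neg_mul, Finset.sum_mul]
    simp only [c, mul_assoc]
  rw [← integral_indicator hT.isClosed.measurableSet, integral_congr_ae hae, integral_neg,
    integral_finsetSum, ← Finset.sum_neg_distrib]
  · refine Finset.sum_congr rfl fun e he => ?_
    rw [integral_const_mul]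
    by_cases hc : inner ℝ (ν e) w = 0
    · simp [hc]
    rw [integral_indicator (hcyl e he hc).1, (hcyl e he hc).2]
    rcases lt_or_gt_of_ne hc with h | h
    · rw [Real.sign_of_neg h, abs_of_neg h]
      ring
    · rw [Real.sign_of_pos h, abs_of_pos h]
      ring
  · intro e he
    -- A face parallel to `w` has sign zero, so nothing need be known about its half-cylinder.
    by_cases hc : inner ℝ (ν e) w = 0
    · simp [hc]
    exact (h_int.indicator (hcyl e he hc).1).const_mul _

/-- The divergence theorem for polynomials. -/
theorem IsFacetedBody.integral_pderiv (hT : IsFacetedBody T F ν) (p : Poly (m + 1))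
    (j : Fin (m + 1)) :
    ∫ x in T, pval (MvPolynomial.pderiv j p) x = ∑ e ∈ F, ν e j * ∫ x in e, pval p x ∂μHE[m] := by
  obtain ⟨R, hR⟩ := hT.isBounded.subset_ball (0 : Pt (m + 1))
  -- A cutoff equal to one near `T` turns the polynomial into a compactly supported function; `max R
  -- 1` keeps the radius positive.
  let χ : ContDiffBump (0 : Pt (m + 1)) := ⟨max R 1, max R 1 + 1, by positivity, by linarith⟩
  set f : Pt (m + 1) → ℝ := fun x => χ x * pval p x
  have hf : ContDiff ℝ 1 f := χ.contDiff.mul (contDiff_pval p)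
  have hfs : HasCompactSupport f := χ.hasCompactSupport.mul_right
  have hTball : T ⊆ Metric.ball 0 (max R 1) := hR.trans (Metric.ball_subset_ball (le_max_left _ _))
  have hone : ∀ x ∈ Metric.ball (0 : Pt (m + 1)) (max R 1), f x = pval p x := fun x hx => by
    simp only [f]
    rw [χ.one_of_mem_closedBall (Metric.ball_subset_closedBall hx), one_mul]
  have key := hT.integral_fderiv (w := EuclideanSpace.single j 1) (by simp) hf hfs
  have h1 : ∫ x in T, pval (MvPolynomial.pderiv j p) x =
      ∫ x in T, fderiv ℝ f x (EuclideanSpace.single j 1) := by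
    refine setIntegral_congr_fun hT.isClosed.measurableSet fun x hx => ?_
    have : f =ᶠ[𝓝 x] pval p := by
      filter_upwards [Metric.isOpen_ball.mem_nhds (hTball hx)] with y hy
      exact hone y hy
    rw [this.fderiv_eq, fderiv_pval_single]
  rw [h1, key]
  refine Finset.sum_congr rfl fun e he => ?_
  congr 1
  · simp [EuclideanSpace.inner_single_right]
  · refine setIntegral_congr_fun (hT.flat e he).isClosed.measurableSet fun x hx => ?_
    refine hone x (hTball ?_)
    refine hT.isClosed.frontier_subset ?_
    rw [hT.frontier_eq]
    exact Set.mem_iUnion₂.2 ⟨e, he, hx⟩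

end Divergence

/-! ### Estimates on a single element -/

section Element

variable {m : ℕ}

/-- A faceted body of diameter at most `h` with shape regularity constants, together with charts
of its faces. -/
structure IsRegularElement (T : Set (Pt (m + 1))) (F : Finset (Set (Pt (m + 1))))
    (ν xe : Set (Pt (m + 1)) → Pt (m + 1)) (ιe : Set (Pt (m + 1)) → Pt m →ₗᵢ[ℝ] Pt (m + 1))
    (h ρ ρ' δ : ℝ) : Prop extends IsFacetedBody T F ν where
  nonempty : T.Nonempty
  h_pos : 0 < h
  chart : ∀ e ∈ F, IsFaceChart e (xe e) (ιe e)
  dist_le : ∀ x ∈ T, ∀ y ∈ T, dist x y ≤ h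
  volume_ge : ρ * h ^ (m + 1) ≤ volume.real T
  area_ge : ∀ e ∈ F, ρ' * h ^ m ≤ (μHE[m] : Measure (Pt (m + 1))).real e
  separated : ∀ e ∈ F, ∀ e' ∈ F, e ≠ e' → ∃ x ∈ e, δ * h ≤ |inner ℝ (ν e') (x - xe e')|

/-- Young's inequality for integrals. -/
lemma abs_integral_mul_le {X : Type*} [MeasurableSpace X] {μ : Measure X} {a b : X → ℝ}
    (ha : Integrable (fun x => a x ^ 2) μ) (hb : Integrable (fun x => b x ^ 2) μ) {t : ℝ}
    (ht : 0 < t) :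
    |∫ x, a x * b x ∂μ| ≤ t * ∫ x, a x ^ 2 ∂μ + 1 / (4 * t) * ∫ x, b x ^ 2 ∂μ := by
  rw [← integral_const_mul, ← integral_const_mul,
    ← integral_add (ha.const_mul t) (hb.const_mul _)]
  rw [← Real.norm_eq_abs]
  refine norm_integral_le_of_norm_le ((ha.const_mul t).add (hb.const_mul _))
    (Filter.Eventually.of_forall fun x => ?_)
  rw [Real.norm_eq_abs, abs_le]
  have h1 : t * a x ^ 2 + 1 / (4 * t) * b x ^ 2 - a x * b x = (2 * t * a x - b x) ^ 2 / (4 * t) := by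
    field_simp
    ring
  have h2 : t * a x ^ 2 + 1 / (4 * t) * b x ^ 2 + a x * b x = (2 * t * a x + b x) ^ 2 / (4 * t) := by
    field_simp
    ring
  have h3 : 0 ≤ (2 * t * a x - b x) ^ 2 / (4 * t) := by positivity
  have h4 : 0 ≤ (2 * t * a x + b x) ^ 2 / (4 * t) := by positivity
  constructor <;> linarith

/-- The affine function `x ↦ ⟪ν, x₀ - x⟫ / h` as a polynomial. -/
def planePoly {d : ℕ} (ν x₀ : Pt d) (h : ℝ) : Poly d :=
  MvPolynomial.C (inner ℝ ν x₀ / h) - ∑ i, MvPolynomial.C (ν i / h) * MvPolynomial.X i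

lemma pval_planePoly {d : ℕ} (ν x₀ : Pt d) (h : ℝ) (x : Pt d) :
    pval (planePoly ν x₀ h) x = inner ℝ ν (x₀ - x) / h := by
  have hx : inner ℝ ν x = ∑ i, ν i * x i := by
    simp [PiLp.inner_apply, mul_comm]
  rw [inner_sub_right, sub_div, hx, Finset.sum_div]
  simp only [planePoly, pval_sub, pval_C, pval_sum, pval_mul]
  congr 1
  refine Finset.sum_congr rfl fun i _ => ?_
  simp [pval]
  ring

lemma totalDegree_planePoly_le {d : ℕ} (ν x₀ : Pt d) (h : ℝ) :
    (planePoly ν x₀ h).totalDegree ≤ 1 := by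
  refine (MvPolynomial.totalDegree_sub _ _).trans (max_le (by simp) ?_)
  refine MvPolynomial.totalDegree_finsetSum_le fun j _ => ?_
  refine (MvPolynomial.totalDegree_mul _ _).trans ?_
  simp

/-- The orthogonal projection onto the hyperplane through `x₀` with unit normal `ν`, composed with
a polynomial: the extension of its trace that is constant in the normal direction. -/
def normalExt {d : ℕ} (q : Poly d) (ν x₀ : Pt d) : Poly d :=
  affComp q (inner ℝ ν x₀ • ν)
    (LinearMap.id - (LinearMap.toSpanSingleton ℝ (Pt d) ν) ∘ₗ (innerSL ℝ ν).toLinearMap)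

lemma pval_normalExt {d : ℕ} (q : Poly d) (ν x₀ x : Pt d) :
    pval (normalExt q ν x₀) x = pval q (x - inner ℝ ν (x - x₀) • ν) := by
  rw [normalExt, pval_affComp]
  congr 1
  simp only [LinearMap.sub_apply, LinearMap.id_apply, LinearMap.comp_apply,
    LinearMap.toSpanSingleton_apply, inner_sub_right, sub_smul]
  change _ + (x - inner ℝ ν x • ν) = _
  abel

variable {T : Set (Pt (m + 1))} {F : Finset (Set (Pt (m + 1)))}
  {ν xe : Set (Pt (m + 1)) → Pt (m + 1)} {ιe : Set (Pt (m + 1)) → Pt m →ₗᵢ[ℝ] Pt (m + 1)}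
  {h ρ ρ' δ : ℝ}

lemma IsFacetedBody.face_subset (hT : IsFacetedBody T F ν) {e : Set (Pt (m + 1))} (he : e ∈ F) :
    e ⊆ T := fun x hx => hT.isClosed.frontier_subset (by
  rw [hT.frontier_eq]
  exact Set.mem_iUnion₂.2 ⟨e, he, hx⟩)

namespace IsRegularElement

lemma measurableSet (hT : IsRegularElement T F ν xe ιe h ρ ρ' δ)
    : MeasurableSet T := hT.isClosed.measurableSet

lemma measurableSet_face (hT : IsRegularElement T F ν xe ιe h ρ ρ' δ)
    {e : Set (Pt (m + 1))} (he : e ∈ F) : MeasurableSet e :=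
  (hT.flat e he).isClosed.measurableSet

lemma base_mem (hT : IsRegularElement T F ν xe ιe h ρ ρ' δ)
    {e : Set (Pt (m + 1))} (he : e ∈ F) : xe e ∈ T :=
  hT.face_subset he (hT.chart e he).base_mem

lemma face_subset_disc (hT : IsRegularElement T F ν xe ιe h ρ ρ' δ)
    {e : Set (Pt (m + 1))} (he : e ∈ F) : e ⊆ disc (xe e) (ιe e) h :=
  fun _ hx => ⟨hT.dist_le _ (hT.face_subset he hx) _ (hT.base_mem he),
    (hT.chart e he).subset_range hx⟩

lemma subset_disc (hT : IsRegularElement T F ν xe ιe h ρ ρ' δ)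
    {x₀ : Pt (m + 1)} (hx₀ : x₀ ∈ T) : T ⊆ disc x₀ LinearIsometry.id h :=
  fun x hx => ⟨hT.dist_le _ hx _ hx₀, x - x₀, by simp [WG.chart]⟩

lemma integrableOn (hT : IsRegularElement T F ν xe ιe h ρ ρ' δ)
    {f : Pt (m + 1) → ℝ} (hf : Continuous f) : IntegrableOn f T :=
  integrableOn_of_continuous_of_isBounded hT.isBounded hf

lemma integrableOn_face (hT : IsRegularElement T F ν xe ιe h ρ ρ' δ)
    {e : Set (Pt (m + 1))} (he : e ∈ F) {f : Pt (m + 1) → ℝ}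
    (hf : Continuous f) : IntegrableOn f e μHE[m] :=
  integrableOn_of_subset_disc (hT.face_subset_disc he) hf

lemma volume_le (hT : IsRegularElement T F ν xe ιe h ρ ρ' δ)
    : volume.real T ≤ ballVol (m + 1) * h ^ (m + 1) := by
  obtain ⟨x₀, hx₀⟩ := hT.nonempty
  rw [← EuclideanSpace.euclideanHausdorffMeasure_eq_volume]
  exact measureReal_le_of_subset_disc hT.h_pos.le (hT.subset_disc hx₀)

lemma volume_ne_top (hT : IsRegularElement T F ν xe ιe h ρ ρ' δ)
    : volume T ≠ ⊤ := hT.isBounded.measure_lt_top.ne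

lemma setIntegral_le (hT : IsRegularElement T F ν xe ιe h ρ ρ' δ)
    {f : Pt (m + 1) → ℝ} (hf : Continuous f) {K : ℝ} (hK : 0 ≤ K)
    (hfK : ∀ x ∈ T, f x ≤ K) : ∫ x in T, f x ≤ K * (ballVol (m + 1) * h ^ (m + 1)) := by
  calc ∫ x in T, f x ≤ ∫ _ in T, K :=
        setIntegral_mono_on (hT.integrableOn hf) (integrableOn_const hT.volume_ne_top)
          hT.measurableSet hfK
    _ = K * volume.real T := by simp [mul_comm]
    _ ≤ _ := by gcongr; exact hT.volume_le

lemma setIntegral_face_le (hT : IsRegularElement T F ν xe ιe h ρ ρ' δ)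
    {e : Set (Pt (m + 1))} (he : e ∈ F) {f : Pt (m + 1) → ℝ}
    (hf : Continuous f) {K : ℝ} (hK : 0 ≤ K) (hfK : ∀ x ∈ e, f x ≤ K) :
    ∫ x in e, f x ∂μHE[m] ≤ K * (ballVol m * h ^ m) := by
  have hfin : (μHE[m] : Measure (Pt (m + 1))) e ≠ ⊤ :=
    ((measure_mono (hT.face_subset_disc he)).trans_lt (measure_disc_lt_top _ _ _)).ne
  calc ∫ x in e, f x ∂μHE[m] ≤ ∫ _ in e, K ∂μHE[m] :=
        setIntegral_mono_on (hT.integrableOn_face he hf) (integrableOn_const hfin)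
          (hT.measurableSet_face he) hfK
    _ = K * (μHE[m] : Measure (Pt (m + 1))).real e := by simp [mul_comm]
    _ ≤ _ := by
        gcongr
        exact measureReal_le_of_subset_disc hT.h_pos.le (hT.face_subset_disc he)

lemma abs_normal_le (hT : IsRegularElement T F ν xe ιe h ρ ρ' δ)
    (j : Fin (m + 1)) {e : Set (Pt (m + 1))} (he : e ∈ F) : |ν e j| ≤ 1 := by
  rw [← (hT.normal e he).unit]
  exact PiLp.norm_apply_le (ν e) j

lemma sum_normal_sq (hT : IsRegularElement T F ν xe ιe h ρ ρ' δ)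
    {e : Set (Pt (m + 1))} (he : e ∈ F) : ∑ j, ν e j ^ 2 = 1 := by
  have := EuclideanSpace.real_norm_sq_eq (ν e)
  rw [(hT.normal e he).unit] at this
  simpa using this.symm

lemma abs_pval_planePoly_le (hT : IsRegularElement T F ν xe ιe h ρ ρ' δ)
    {e : Set (Pt (m + 1))} (he : e ∈ F) {x : Pt (m + 1)} (hx : x ∈ T) :
    |pval (planePoly (ν e) (xe e) h) x| ≤ 1 := by
  rw [pval_planePoly, abs_div, abs_of_pos hT.h_pos, div_le_one hT.h_pos]
  refine (abs_real_inner_le_norm _ _).trans ?_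
  rw [(hT.normal e he).unit, one_mul, ← dist_eq_norm]
  exact hT.dist_le _ (hT.base_mem he) _ hx

lemma pval_planePoly_eq_zero (hT : IsRegularElement T F ν xe ιe h ρ ρ' δ)
    {e : Set (Pt (m + 1))} (he : e ∈ F) {x : Pt (m + 1)} (hx : x ∈ e) :
    pval (planePoly (ν e) (xe e) h) x = 0 := by
  rw [pval_planePoly, hT.inner_eq_zero he (hT.chart e he).base_mem hx, zero_div]

/-- The plane functions are not uniformly small on the ball. -/
lemma exists_one_le_planePoly (hT : IsRegularElement T F ν xe ιe h ρ ρ' δ)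
    {x₀ : Pt (m + 1)} {e : Set (Pt (m + 1))} (he : e ∈ F) :
    ∃ x ∈ disc x₀ LinearIsometry.id h, 1 ≤ |pval (planePoly (ν e) (xe e) h) x| := by
  have hh := hT.h_pos
  have hmem : ∀ t : ℝ, |t| = h → x₀ + t • ν e ∈ disc x₀ (LinearIsometry.id (R := ℝ)) h := by
    intro t ht
    refine ⟨?_, t • ν e, by simp [WG.chart]⟩
    simp [norm_smul, (hT.normal e he).unit, ht]
  have hval : ∀ t : ℝ, pval (planePoly (ν e) (xe e) h) (x₀ + t • ν e) =
      inner ℝ (ν e) (xe e - x₀) / h - t / h := by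
    intro t
    rw [pval_planePoly, ← sub_sub, inner_sub_right, inner_smul_right, real_inner_self_eq_norm_sq,
      (hT.normal e he).unit]
    ring
  -- A step of length `h` along `ν e` changes the value by one; the direction is chosen so that the
  -- modulus grows.
  rcases le_total 0 (inner ℝ (ν e) (xe e - x₀) / h) with h0 | h0
  · refine ⟨_, hmem (-h) (by rw [abs_neg, abs_of_pos hh]), ?_⟩
    rw [hval, neg_div, div_self hh.ne', le_abs]
    left
    linarith
  · refine ⟨_, hmem h (abs_of_pos hh), ?_⟩
    rw [hval, div_self hh.ne', le_abs]
    right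
    linarith

end IsRegularElement

/-- The number of faces is bounded in terms of the separation constant. -/
lemma exists_card_faces_le (m : ℕ) {δ : ℝ} (hδ : 0 < δ) :
    ∃ N : ℕ, ∀ (T : Set (Pt (m + 1))) (F : Finset (Set (Pt (m + 1))))
      (ν xe : Set (Pt (m + 1)) → Pt (m + 1)) (ιe : Set (Pt (m + 1)) → Pt m →ₗᵢ[ℝ] Pt (m + 1))
      (h ρ ρ' : ℝ), IsRegularElement T F ν xe ιe h ρ ρ' δ → F.card ≤ N := by
  let B : Set (Pt (m + 1) × ℝ) := Metric.closedBall 0 1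
  have hB : IsCompact B := isCompact_closedBall 0 1
  obtain ⟨t, -, htfin, ht⟩ := hB.finite_cover_balls (e := δ / 4) (by positivity)
  refine ⟨htfin.toFinset.card, ?_⟩
  intro T F ν xe ιe h ρ ρ' hT
  obtain ⟨x₀, hx₀⟩ := hT.nonempty
  have hh := hT.h_pos
  -- A face is recorded by its normal and the scaled offset of its hyperplane. These parameters lie
  -- in a fixed compact ball.
  let P : Set (Pt (m + 1)) → Pt (m + 1) × ℝ := fun e => (ν e, inner ℝ (ν e) (xe e - x₀) / h)
  have hPB : ∀ e ∈ F, P e ∈ B := by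
    intro e he
    rw [mem_closedBall_zero_iff, Prod.norm_def]
    refine max_le (hT.normal e he).unit.le ?_
    rw [Real.norm_eq_abs, abs_div, abs_of_pos hh, div_le_one hh]
    refine (abs_real_inner_le_norm _ _).trans ?_
    rw [(hT.normal e he).unit, one_mul, ← dist_eq_norm]
    exact hT.dist_le _ (hT.base_mem he) _ hx₀
  -- Hyperplanes with close parameters stay close on all of `T`, so separated faces have parameters
  -- at distance at least `δ / 2`. No ball of radius `δ / 4` then holds two of them.
  have hsep : ∀ e ∈ F, ∀ e' ∈ F, e ≠ e' → δ ≤ 2 * dist (P e) (P e') := by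
    intro e he e' he' hne
    obtain ⟨x, hx, hδx⟩ := hT.separated e he e' he' hne
    have h0 : inner ℝ (ν e) (x - xe e) = 0 :=
      hT.inner_eq_zero he hx (hT.chart e he).base_mem
    have h1 : inner ℝ (ν e') (x - xe e') =
        inner ℝ (ν e' - ν e) (x - x₀) + h * ((P e).2 - (P e').2) := by
      have e1 : h * ((P e).2 - (P e').2) =
          inner ℝ (ν e) (xe e - x₀) - inner ℝ (ν e') (xe e' - x₀) := by
        simp only [P]
        field_simp
      rw [e1]
      simp only [inner_sub_left, inner_sub_right] at h0 ⊢
      linarith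
    have h2 : |inner ℝ (ν e' - ν e) (x - x₀)| ≤ dist (P e) (P e') * h := by
      refine (abs_real_inner_le_norm _ _).trans ?_
      rw [← dist_eq_norm, ← dist_eq_norm, dist_comm (ν e')]
      exact mul_le_mul (le_max_left _ _) (hT.dist_le _ (hT.face_subset he hx) _ hx₀) dist_nonneg
        dist_nonneg
    have h3 : |h * ((P e).2 - (P e').2)| ≤ h * dist (P e) (P e') := by
      rw [abs_mul, abs_of_pos hh, ← Real.dist_eq]
      exact mul_le_mul_of_nonneg_left (le_max_right _ _) hh.le
    rw [h1] at hδx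
    have h4 := hδx.trans (abs_add_le _ _)
    have h5 : δ * h ≤ (2 * dist (P e) (P e')) * h := by linarith
    exact le_of_mul_le_mul_right h5 hh
  have hc : ∀ e, ∃ z, e ∈ F → z ∈ t ∧ P e ∈ Metric.ball z (δ / 4) := by
    intro e
    by_cases he : e ∈ F
    · have := ht (hPB e he)
      simp only [Set.mem_iUnion] at this
      obtain ⟨z, hz, hez⟩ := this
      exact ⟨z, fun _ => ⟨hz, hez⟩⟩
    · exact ⟨0, fun h => (he h).elim⟩
  choose z hz using hc
  refine Finset.card_le_card_of_injOn z (fun e he => htfin.mem_toFinset.2 (hz e he).1) ?_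
  intro e he e' he' hee
  by_contra hne
  have h1 := hsep e he e' he' hne
  have h2 := (hz e he).2
  have h3 := (hz e' he').2
  rw [← hee] at h3
  rw [Metric.mem_ball] at h2 h3
  have := dist_triangle_right (P e) (P e') (z e)
  linarith

/-- The trace inequality for polynomials. -/
lemma exists_trace_le (m k : ℕ) {ρ : ℝ} (hρ : 0 < ρ) :
    ∃ C > 0, ∀ (T : Set (Pt (m + 1))) (F : Finset (Set (Pt (m + 1))))
      (ν xe : Set (Pt (m + 1)) → Pt (m + 1)) (ιe : Set (Pt (m + 1)) → Pt m →ₗᵢ[ℝ] Pt (m + 1))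
      (h ρ' δ : ℝ), IsRegularElement T F ν xe ιe h ρ ρ' δ → ∀ p : Poly (m + 1),
      p.totalDegree ≤ k → ∀ e ∈ F,
        ∫ x in e, pval p x ^ 2 ∂μHE[m] ≤ C * h⁻¹ * ∫ x in T, pval p x ^ 2 := by
  obtain ⟨C, hC, H⟩ := exists_sq_le_integral_disc (m + 1) k hρ
  refine ⟨C * (ballVol m + 1), by have := ballVol_nonneg m; positivity, ?_⟩
  intro T F ν xe ιe h ρ' δ hT p hp e he
  have hh := hT.h_pos
  have hb := ballVol_nonneg m
  obtain ⟨x₀, hx₀⟩ := hT.nonempty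
  set X := ∫ x in T, pval p x ^ 2
  have hX : 0 ≤ X := integral_nonneg fun x => sq_nonneg _
  -- The Remez inequality with `T` as the subset gives a pointwise bound with `h ^ (m + 1)` in the
  -- denominator. Integrating over `e` returns `h ^ m`, leaving the factor `h⁻¹`.
  have hpt : ∀ x ∈ e, pval p x ^ 2 ≤ C * X / h ^ (m + 1) := by
    intro x hx
    rw [le_div_iff₀ (by positivity)]
    have := H (m + 1) x₀ LinearIsometry.id h hh p hp T (hT.subset_disc hx₀) hT.measurableSet
      (by rw [EuclideanSpace.euclideanHausdorffMeasure_eq_volume]; exact hT.volume_ge) x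
      (hT.subset_disc hx₀ (hT.face_subset he hx))
    rwa [EuclideanSpace.euclideanHausdorffMeasure_eq_volume] at this
  calc ∫ x in e, pval p x ^ 2 ∂μHE[m] ≤ C * X / h ^ (m + 1) * (ballVol m * h ^ m) :=
        hT.setIntegral_face_le he (by fun_prop) (by positivity) hpt
    _ = C * ballVol m * h⁻¹ * X := by field_simp; ring
    _ ≤ C * (ballVol m + 1) * h⁻¹ * X := by gcongr; linarith

end Element

/-! ### Local norm equivalence -/

section Local

variable {m : ℕ}

/-- The entries `g j` are related to the scalar weak function `(v, b)` as a row of the weak gradient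
is, after integration by parts. -/
def WeakRelation (T : Set (Pt (m + 1))) (F : Finset (Set (Pt (m + 1))))
    (ν : Set (Pt (m + 1)) → Pt (m + 1)) (r : ℕ) (v : Poly (m + 1))
    (b : Set (Pt (m + 1)) → Poly (m + 1)) (g : Fin (m + 1) → Poly (m + 1)) : Prop :=
  ∀ j, ∀ ψ : Poly (m + 1), ψ.totalDegree ≤ r →
    ∫ x in T, pval (g j) x * pval ψ x =
      (∫ x in T, pval (MvPolynomial.pderiv j v) x * pval ψ x) +
        ∑ e ∈ F, ν e j * ∫ x in e, pval (b e - v) x * pval ψ x ∂μHE[m]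

/-- Products of powers of the plane functions of the faces in `A`. -/
def bubble (ν xe : Set (Pt (m + 1)) → Pt (m + 1)) (h : ℝ) (s : ℕ)
    (A : Finset (Set (Pt (m + 1)))) : Poly (m + 1) :=
  ∏ e ∈ A, planePoly (ν e) (xe e) h ^ s

lemma totalDegree_bubble_le (ν xe : Set (Pt (m + 1)) → Pt (m + 1)) (h : ℝ) (s : ℕ)
    (A : Finset (Set (Pt (m + 1)))) : (bubble ν xe h s A).totalDegree ≤ s * A.card := by
  refine (MvPolynomial.totalDegree_finsetProd _ _).trans ?_
  refine (Finset.sum_le_card_nsmul _ _ s fun e _ => ?_).trans (by simp [mul_comm])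
  refine (MvPolynomial.totalDegree_pow _ _).trans ?_
  have := totalDegree_planePoly_le (ν e) (xe e) h
  nlinarith

variable {T : Set (Pt (m + 1))} {F : Finset (Set (Pt (m + 1)))}
  {ν xe : Set (Pt (m + 1)) → Pt (m + 1)} {ιe : Set (Pt (m + 1)) → Pt m →ₗᵢ[ℝ] Pt (m + 1)}
  {h ρ ρ' δ : ℝ}

/-- The `s`-th powers of the plane functions are nonnegative on the element, with `s = 1` or
`s = 2`. -/
def IsBubbleExponent (T : Set (Pt (m + 1))) (F : Finset (Set (Pt (m + 1))))
    (ν xe : Set (Pt (m + 1)) → Pt (m + 1)) (h : ℝ) (s : ℕ) : Prop :=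
  s = 2 ∨ s = 1 ∧ ∀ e ∈ F, ∀ x ∈ T, 0 ≤ pval (planePoly (ν e) (xe e) h) x

/-- The lower bound by the square lets `exists_le_integral_weight`, which is stated for squares,
serve both exponents. -/
lemma IsRegularElement.planePoly_pow_bounds (hT : IsRegularElement T F ν xe ιe h ρ ρ' δ) {s : ℕ}
    (hs : IsBubbleExponent T F ν xe h s) {e : Set (Pt (m + 1))} (he : e ∈ F) {x : Pt (m + 1)}
    (hx : x ∈ T) : pval (planePoly (ν e) (xe e) h) x ^ 2 ≤ pval (planePoly (ν e) (xe e) h) x ^ s ∧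
      pval (planePoly (ν e) (xe e) h) x ^ s ≤ 1 := by
  have habs := hT.abs_pval_planePoly_le he hx
  have h2 : pval (planePoly (ν e) (xe e) h) x ^ 2 ≤ 1 := (sq_le_one_iff_abs_le_one _).2 habs
  rcases hs with rfl | ⟨rfl, hs⟩
  · exact ⟨le_rfl, h2⟩
  · have h0 := hs e he x hx
    rw [abs_of_nonneg h0] at habs
    rw [pow_one]
    exact ⟨by nlinarith, habs⟩

lemma IsRegularElement.bubble_bounds (hT : IsRegularElement T F ν xe ιe h ρ ρ' δ) {s : ℕ}
    (hs : IsBubbleExponent T F ν xe h s) {A : Finset (Set (Pt (m + 1)))} (hA : A ⊆ F)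
    {x : Pt (m + 1)} (hx : x ∈ T) :
    ∏ e ∈ A, pval (planePoly (ν e) (xe e) h) x ^ 2 ≤ pval (bubble ν xe h s A) x ∧
      pval (bubble ν xe h s A) x ≤ 1 := by
  simp only [bubble, pval_prod, pval_pow]
  have h1 := fun e (he : e ∈ A) => hT.planePoly_pow_bounds hs (hA he) hx
  exact ⟨Finset.prod_le_prod (fun _ _ => sq_nonneg _) fun e he => (h1 e he).1,
    Finset.prod_le_one (fun e he => (sq_nonneg _).trans (h1 e he).1) fun e he => (h1 e he).2⟩

lemma IsRegularElement.bubble_nonneg (hT : IsRegularElement T F ν xe ιe h ρ ρ' δ) {s : ℕ}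
    (hs : IsBubbleExponent T F ν xe h s) {A : Finset (Set (Pt (m + 1)))} (hA : A ⊆ F)
    {x : Pt (m + 1)} (hx : x ∈ T) : 0 ≤ pval (bubble ν xe h s A) x :=
  (Finset.prod_nonneg fun _ _ => sq_nonneg _).trans (hT.bubble_bounds hs hA hx).1

/-- The weak gradient is controlled by the gradient and the jumps. -/
lemma exists_weakGradient_le (m R N : ℕ) {ρ : ℝ} (hρ : 0 < ρ) :
    ∃ C > 0, ∀ (T : Set (Pt (m + 1))) (F : Finset (Set (Pt (m + 1))))
      (ν xe : Set (Pt (m + 1)) → Pt (m + 1)) (ιe : Set (Pt (m + 1)) → Pt m →ₗᵢ[ℝ] Pt (m + 1))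
      (h ρ' δ : ℝ), IsRegularElement T F ν xe ιe h ρ ρ' δ → F.card ≤ N →
      ∀ (r : ℕ), r ≤ R → ∀ v b g, (∀ j, (g j).totalDegree ≤ r) → WeakRelation T F ν r v b g →
        ∑ j, ∫ x in T, pval (g j) x ^ 2 ≤
          C * ((∑ j, ∫ x in T, pval (MvPolynomial.pderiv j v) x ^ 2) +
            h⁻¹ * ∑ e ∈ F, ∫ x in e, pval (b e - v) x ^ 2 ∂μHE[m]) := by
  obtain ⟨Ct, hCt, H⟩ := exists_trace_le m R hρ
  -- This Young parameter lets each of the at most `N` faces return no more than the share `1 / (4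
  -- (N + 1))` of the weak gradient norm, so that the sum can be absorbed.
  set K : ℝ := (N + 1) * Ct
  have hK : 0 < K := by positivity
  refine ⟨2 * (m + 1) * (1 + K), by positivity, ?_⟩
  intro T F ν xe ιe h ρ' δ hT hF r hr v b g hg hW
  have hh := hT.h_pos
  set Y : ℝ := ∑ e ∈ F, ∫ x in e, pval (b e - v) x ^ 2 ∂μHE[m]
  have hY : 0 ≤ Y := Finset.sum_nonneg fun e _ => integral_nonneg fun x => sq_nonneg _
  have hj : ∀ j, ∫ x in T, pval (g j) x ^ 2 ≤
      2 * (∫ x in T, pval (MvPolynomial.pderiv j v) x ^ 2) + 2 * K * (h⁻¹ * Y) := by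
    intro j
    set X := ∫ x in T, pval (g j) x ^ 2
    have hX : 0 ≤ X := integral_nonneg fun x => sq_nonneg _
    -- The weak gradient is tested against itself; its trace in the face terms is then controlled by
    -- `exists_trace_le`.
    have h0 := hW j (g j) (hg j)
    have h1 : ∫ x in T, pval (g j) x * pval (g j) x = X := by simp only [X, sq]
    rw [h1] at h0
    have h2 := abs_integral_mul_le (μ := volume.restrict T) (a := pval (MvPolynomial.pderiv j v))
      (b := pval (g j)) (hT.integrableOn (by fun_prop)) (hT.integrableOn (by fun_prop)) one_pos
    have h3 : ∀ e ∈ F, ν e j * ∫ x in e, pval (b e - v) x * pval (g j) x ∂μHE[m] ≤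
        K * h⁻¹ * ∫ x in e, pval (b e - v) x ^ 2 ∂μHE[m] + 1 / (4 * (N + 1)) * X := by
      intro e he
      have a1 := abs_integral_mul_le (μ := (μHE[m] : Measure (Pt (m + 1))).restrict e)
        (a := pval (b e - v)) (b := pval (g j)) (hT.integrableOn_face he (by fun_prop))
        (hT.integrableOn_face he (by fun_prop)) (t := K * h⁻¹) (by positivity)
      have a2 := H T F ν xe ιe h ρ' δ hT (g j) ((hg j).trans hr) e he
      have a3 : 1 / (4 * (K * h⁻¹)) * ∫ x in e, pval (g j) x ^ 2 ∂μHE[m] ≤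
          1 / (4 * (K * h⁻¹)) * (Ct * h⁻¹ * X) := by gcongr
      have a4 : 1 / (4 * (K * h⁻¹)) * (Ct * h⁻¹ * X) = 1 / (4 * (N + 1)) * X := by
        simp only [K]
        field_simp
      calc ν e j * ∫ x in e, pval (b e - v) x * pval (g j) x ∂μHE[m]
          ≤ |ν e j * ∫ x in e, pval (b e - v) x * pval (g j) x ∂μHE[m]| := le_abs_self _
        _ ≤ 1 * |∫ x in e, pval (b e - v) x * pval (g j) x ∂μHE[m]| := by
            rw [abs_mul]
            gcongr
            exact hT.abs_normal_le j he
        _ ≤ _ := by linarith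
    have h4 := Finset.sum_le_sum h3
    rw [Finset.sum_add_distrib, ← Finset.mul_sum, Finset.sum_const, nsmul_eq_mul] at h4
    have h5 : (F.card : ℝ) * (1 / (4 * (N + 1)) * X) ≤ 1 / 4 * X := by
      have : (F.card : ℝ) ≤ N + 1 := by exact_mod_cast hF.trans (Nat.le_succ N)
      calc (F.card : ℝ) * (1 / (4 * (N + 1)) * X) ≤ (N + 1) * (1 / (4 * (N + 1)) * X) := by gcongr
        _ = 1 / 4 * X := by field_simp
    have h6 := (le_abs_self _).trans h2
    norm_num at h6
    have h7 : K * h⁻¹ * Y = K * (h⁻¹ * Y) := by ring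
    linarith
  have hG : 0 ≤ ∑ j, ∫ x in T, pval (MvPolynomial.pderiv j v) x ^ 2 :=
    Finset.sum_nonneg fun j _ => integral_nonneg fun x => sq_nonneg _
  set G := ∑ j, ∫ x in T, pval (MvPolynomial.pderiv j v) x ^ 2
  calc ∑ j, ∫ x in T, pval (g j) x ^ 2 ≤ ∑ j, (2 * (∫ x in T, pval (MvPolynomial.pderiv j v) x ^ 2) +
        2 * K * (h⁻¹ * Y)) := Finset.sum_le_sum fun j _ => hj j
    _ = 2 * G + 2 * (m + 1) * K * (h⁻¹ * Y) := by
        rw [Finset.sum_add_distrib, ← Finset.mul_sum]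
        simp
        ring
    _ ≤ 2 * (m + 1) * (1 + K) * (G + h⁻¹ * Y) := by
        have e1 : 0 ≤ h⁻¹ * Y := by positivity
        have e2 : (0 : ℝ) ≤ m := by positivity
        have e3 : 0 ≤ (m : ℝ) * G := by positivity
        have e4 : 0 ≤ (m + 1) * K * G := by positivity
        have e5 : 0 ≤ (m + 1) * (h⁻¹ * Y) := by positivity
        nlinarith

/-- The gradient is controlled by the weak gradient. -/
lemma exists_gradient_le (m k N : ℕ) {ρ : ℝ} (hρ : 0 < ρ) :
    ∃ C > 0, ∀ (T : Set (Pt (m + 1))) (F : Finset (Set (Pt (m + 1))))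
      (ν xe : Set (Pt (m + 1)) → Pt (m + 1)) (ιe : Set (Pt (m + 1)) → Pt m →ₗᵢ[ℝ] Pt (m + 1))
      (h ρ' δ : ℝ), IsRegularElement T F ν xe ιe h ρ ρ' δ → F.card ≤ N →
      ∀ s r : ℕ, IsBubbleExponent T F ν xe h s → s * F.card + (k - 1) ≤ r →
      ∀ v b g, v.totalDegree ≤ k → WeakRelation T F ν r v b g → ∀ j,
        ∫ x in T, pval (MvPolynomial.pderiv j v) x ^ 2 ≤ C * ∫ x in T, pval (g j) x ^ 2 := by
  obtain ⟨c, hc, H⟩ := exists_le_integral_weight (m + 1) (k - 1) N hρ one_pos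
  refine ⟨(ballVol (m + 1) + 1) / c, by have := ballVol_nonneg (m + 1); positivity, ?_⟩
  intro T F ν xe ιe h ρ' δ hT hF s r hs hr v b g hv hW j
  have hh := hT.h_pos
  obtain ⟨x₀, hx₀⟩ := hT.nonempty
  set p := MvPolynomial.pderiv j v
  have hp : p.totalDegree ≤ k - 1 := (totalDegree_pderiv_le v j).trans (Nat.sub_le_sub_right hv 1)
  set Φ := bubble ν xe h s F
  set X := ∫ x in T, pval (g j) x ^ 2
  have hX : 0 ≤ X := integral_nonneg fun x => sq_nonneg _
  have hvan : ∀ e ∈ F, ∀ x ∈ e, pval Φ x = 0 := by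
    intro e he x hx
    simp only [Φ, bubble, pval_prod, pval_pow]
    refine Finset.prod_eq_zero he ?_
    rw [hT.pval_planePoly_eq_zero he hx]
    rcases hs with rfl | ⟨rfl, -⟩ <;> simp
  -- The bubble vanishes on every face, so this test function sees only the interior term.
  have hrel := hW j (Φ * p) (by
    refine (MvPolynomial.totalDegree_mul _ _).trans ((add_le_add ?_ hp).trans hr)
    exact totalDegree_bubble_le ν xe h s F)
  have hzero : ∑ e ∈ F, ν e j * ∫ x in e, pval (b e - v) x * pval (Φ * p) x ∂μHE[m] = 0 := by
    refine Finset.sum_eq_zero fun e he => ?_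
    rw [setIntegral_eq_zero_of_forall_eq_zero, mul_zero]
    intro x hx
    simp [hvan e he x hx]
  rw [hzero, add_zero] at hrel
  set Z := ∫ x in T, pval Φ x * pval p x ^ 2
  have hZ : ∫ x in T, pval p x * pval (Φ * p) x = Z := by
    simp only [Z, pval_mul]
    congr 1
    ext x
    ring
  rw [hZ] at hrel
  -- As `0 ≤ Φ ≤ 1`, pointwise `g Φ p ≤ Φ p² / 2 + g² / 2`, and the first term is absorbed into `Z`.
  have hZX : Z ≤ X := by
    have h1 : Z ≤ ∫ x in T, (1 / 2 * (pval Φ x * pval p x ^ 2) + 1 / 2 * pval (g j) x ^ 2) := by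
      rw [← hrel]
      refine setIntegral_mono_on (hT.integrableOn (by fun_prop)) (hT.integrableOn (by fun_prop))
        hT.measurableSet fun x hx => ?_
      have b0 := hT.bubble_nonneg hs subset_rfl hx
      have b1 := (hT.bubble_bounds hs subset_rfl hx).2
      change 0 ≤ pval Φ x at b0
      change pval Φ x ≤ 1 at b1
      rw [pval_mul]
      nlinarith [mul_nonneg b0 (sq_nonneg (pval (g j) x - pval p x)),
        mul_nonneg (sub_nonneg.2 b1) (sq_nonneg (pval (g j) x))]
    rw [integral_add ((hT.integrableOn (f := fun x => 1 / 2 * (pval Φ x * pval p x ^ 2))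
      (by fun_prop))) (hT.integrableOn (f := fun x => 1 / 2 * pval (g j) x ^ 2) (by fun_prop)),
      integral_const_mul, integral_const_mul] at h1
    change Z ≤ 1 / 2 * Z + 1 / 2 * X at h1
    linarith
  have hpt : ∀ x ∈ T, pval p x ^ 2 ≤ X / (c * h ^ (m + 1)) := by
    intro x hx
    have := H (m + 1) x₀ LinearIsometry.id h hh T (hT.subset_disc hx₀) hT.measurableSet
      (by rw [EuclideanSpace.euclideanHausdorffMeasure_eq_volume]; exact hT.volume_ge)
      _ F (fun e => planePoly (ν e) (xe e) h) hF
      (fun e he => ⟨totalDegree_planePoly_le _ _ _, hT.exists_one_le_planePoly he⟩)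
      (pval Φ) (continuous_pval Φ) (fun y hy => (hT.bubble_bounds hs subset_rfl hy).1) p hp x
      (hT.subset_disc hx₀ hx)
    rw [EuclideanSpace.euclideanHausdorffMeasure_eq_volume] at this
    rw [le_div_iff₀ (by positivity)]
    calc pval p x ^ 2 * (c * h ^ (m + 1)) = c * (pval p x ^ 2 * h ^ (m + 1)) := by ring
      _ ≤ Z := this
      _ ≤ X := hZX
  calc ∫ x in T, pval p x ^ 2 ≤ X / (c * h ^ (m + 1)) * (ballVol (m + 1) * h ^ (m + 1)) :=
        hT.setIntegral_le (by fun_prop) (by positivity) hpt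
    _ = ballVol (m + 1) / c * X := by field_simp
    _ ≤ (ballVol (m + 1) + 1) / c * X := by gcongr; linarith

/-- The jump on a face is controlled by the difference of the weak gradient and the gradient. -/
lemma exists_jump_le (m k N : ℕ) {ρ' δ : ℝ} (hρ' : 0 < ρ') (hδ : 0 < δ) :
    ∃ C > 0, ∀ (T : Set (Pt (m + 1))) (F : Finset (Set (Pt (m + 1))))
      (ν xe : Set (Pt (m + 1)) → Pt (m + 1)) (ιe : Set (Pt (m + 1)) → Pt m →ₗᵢ[ℝ] Pt (m + 1))
      (h ρ : ℝ), IsRegularElement T F ν xe ιe h ρ ρ' δ → F.card ≤ N →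
      ∀ s r : ℕ, IsBubbleExponent T F ν xe h s → s * (F.card - 1) + k ≤ r →
      ∀ v b g, v.totalDegree ≤ k → (∀ e ∈ F, (b e).totalDegree ≤ k) → WeakRelation T F ν r v b g →
      ∀ e ∈ F, h⁻¹ * ∫ x in e, pval (b e - v) x ^ 2 ∂μHE[m] ≤
        C * ∑ j, ∫ x in T, pval (g j - MvPolynomial.pderiv j v) x ^ 2 := by
  classical
  obtain ⟨c, hc, H⟩ := exists_le_integral_weight m k N hρ' hδ
  set V := ballVol (m + 1)
  have hV : 0 ≤ V := ballVol_nonneg _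
  -- Chosen so that, summed over the `m + 1` directions, the Young remainder is at most half of the
  -- lower bound `c * (Y * h ^ m)` for `W`.
  set K : ℝ := (m + 1) * (V + 1) / (2 * c)
  have hK : 0 < K := by positivity
  have hVm := ballVol_nonneg m
  refine ⟨2 * K * (ballVol m + 1) / c, by positivity, ?_⟩
  intro T F ν xe ιe h ρ hT hF s r hs hr v b g hv hb hW e he
  have hh := hT.h_pos
  set q := b e - v
  have hq : q.totalDegree ≤ k :=
    (MvPolynomial.totalDegree_sub _ _).trans (max_le (hb e he) hv)
  -- Extending the jump constantly along the normal keeps its degree and its values on `e`, and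
  -- bounds it on `T` by its values in the hyperplane of `e`.
  set qt := normalExt q (ν e) (xe e)
  have hqt : qt.totalDegree ≤ k := (totalDegree_affComp_le _ _ _).trans hq
  have hch := hT.chart e he
  have hproj : ∀ x ∈ T, x - inner ℝ (ν e) (x - xe e) • ν e ∈ disc (xe e) (ιe e) h := by
    intro x hx
    obtain ⟨y, hy⟩ := exists_eq_inner_smul_add (hT.normal e he).unit
      (hch.orthogonal (hT.normal e he).orthogonal) (x - xe e)
    have hpt : x - inner ℝ (ν e) (x - xe e) • ν e = chart (xe e) (ιe e) y := by
      have : ιe e y = (x - xe e) - inner ℝ (ν e) (x - xe e) • ν e := by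
        conv_rhs => enter [1]; rw [hy]
        abel
      rw [chart, this]
      abel
    refine ⟨?_, y, hpt.symm⟩
    rw [hpt, chart_mem_closedBall, mem_closedBall_zero_iff]
    have h1 : ‖x - xe e‖ ≤ h := by
      rw [← dist_eq_norm]
      exact hT.dist_le _ hx _ (hT.base_mem he)
    refine le_trans ?_ h1
    rw [← sq_le_sq₀ (norm_nonneg _) (norm_nonneg _), hy, norm_add_sq_real, inner_smul_left,
      hch.orthogonal (hT.normal e he).orthogonal, (ιe e).norm_map]
    simp only [mul_zero, add_zero]
    linarith [sq_nonneg ‖inner ℝ (ν e) (x - xe e) • ν e‖]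
  have hqte : ∀ x ∈ e, pval qt x = pval q x := by
    intro x hx
    rw [pval_normalExt, hT.inner_eq_zero he hx hch.base_mem]
    simp
  -- The maximum is taken over the whole disc, since `T` may project outside `e`. The weighted Remez
  -- inequality bounds it all the same.
  obtain ⟨z, hz, hzmax⟩ : ∃ z ∈ disc (xe e) (ιe e) h,
      ∀ x ∈ disc (xe e) (ιe e) h, pval q x ^ 2 ≤ pval q z ^ 2 := by
    have hcomp : IsCompact (disc (xe e) (ιe e) h) := (isCompact_closedBall _ _).inter_right
      (isometry_chart _ _).isClosedEmbedding.isClosed_range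
    obtain ⟨z, hz, hmax⟩ := hcomp.exists_isMaxOn ⟨_, hT.face_subset_disc he hch.base_mem⟩
      (f := fun x => pval q x ^ 2) (by fun_prop)
    exact ⟨z, hz, fun x hx => hmax hx⟩
  set Y := pval q z ^ 2
  have hY : 0 ≤ Y := sq_nonneg _
  set A := F.erase e
  have hAF : A ⊆ F := Finset.erase_subset _ _
  have hAcard : A.card = F.card - 1 := Finset.card_erase_of_mem he
  set Φ := bubble ν xe h s A
  have hvan : ∀ e' ∈ F, e' ≠ e → ∀ x ∈ e', pval Φ x = 0 := by
    intro e' he' hne x hx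
    simp only [Φ, bubble, pval_prod, pval_pow]
    refine Finset.prod_eq_zero (Finset.mem_erase.2 ⟨hne, he'⟩) ?_
    rw [hT.pval_planePoly_eq_zero he' hx]
    rcases hs with rfl | ⟨rfl, -⟩ <;> simp
  have hdeg : ∀ a : ℝ, (a • (Φ * qt)).totalDegree ≤ r := by
    intro a
    refine (MvPolynomial.totalDegree_smul_le _ _).trans
      ((MvPolynomial.totalDegree_mul _ _).trans ((add_le_add ?_ hqt).trans hr))
    rw [← hAcard]
    exact totalDegree_bubble_le ν xe h s A
  set W := ∫ x in e, pval Φ x * pval q x ^ 2 ∂μHE[m]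
  -- The bubble omits `e` and vanishes on all other faces, so only the jump on `e` remains. Summing
  -- over `j` then recovers `W`, because the normal is a unit vector.
  have hrel : ∀ j, ∫ x in T, pval (g j - MvPolynomial.pderiv j v) x * pval (ν e j • (Φ * qt)) x =
      ν e j ^ 2 * W := by
    intro j
    have h1 := hW j (ν e j • (Φ * qt)) (hdeg _)
    rw [Finset.sum_eq_single_of_mem e he] at h1
    · have h2 : ∫ x in T, pval (g j - MvPolynomial.pderiv j v) x * pval (ν e j • (Φ * qt)) x =
          (∫ x in T, pval (g j) x * pval (ν e j • (Φ * qt)) x) -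
            ∫ x in T, pval (MvPolynomial.pderiv j v) x * pval (ν e j • (Φ * qt)) x := by
        rw [← integral_sub (hT.integrableOn (by fun_prop)) (hT.integrableOn (by fun_prop))]
        simp only [pval_sub, sub_mul]
      have h3 : ∫ x in e, pval (b e - v) x * pval (ν e j • (Φ * qt)) x ∂μHE[m] = ν e j * W := by
        simp only [W]
        rw [← integral_const_mul]
        refine setIntegral_congr_fun (hT.measurableSet_face he) fun x hx => ?_
        simp only [pval_smul, pval_mul, hqte x hx]
        change pval q x * _ = _
        ring
      rw [h2, h1, add_sub_cancel_left, h3]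
      ring
    · intro e' he' hne
      rw [setIntegral_eq_zero_of_forall_eq_zero, mul_zero]
      intro x hx
      simp [hvan e' he' hne x hx]
  set D := ∑ j, ∫ x in T, pval (g j - MvPolynomial.pderiv j v) x ^ 2
  have hWle : W ≤ K * h * D + c / 2 * (Y * h ^ m) := by
    have h1 : W = ∑ j, ∫ x in T,
        pval (g j - MvPolynomial.pderiv j v) x * pval (ν e j • (Φ * qt)) x := by
      simp only [hrel]
      rw [← Finset.sum_mul, hT.sum_normal_sq he, one_mul]
    have h2 : ∀ j, ∫ x in T, pval (g j - MvPolynomial.pderiv j v) x * pval (ν e j • (Φ * qt)) x ≤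
        K * h * (∫ x in T, pval (g j - MvPolynomial.pderiv j v) x ^ 2) +
          1 / (4 * (K * h)) * (Y * (V * h ^ (m + 1))) := by
      intro j
      have a1 := abs_integral_mul_le (μ := volume.restrict T)
        (a := pval (g j - MvPolynomial.pderiv j v)) (b := pval (ν e j • (Φ * qt)))
        (hT.integrableOn (by fun_prop)) (hT.integrableOn (by fun_prop)) (t := K * h) (by positivity)
      refine ((le_abs_self _).trans a1).trans ?_
      gcongr
      refine hT.setIntegral_le (by fun_prop) hY fun x hx => ?_
      rw [pval_smul, pval_mul, mul_pow, mul_pow]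
      have b1 : ν e j ^ 2 ≤ 1 := (sq_le_one_iff_abs_le_one _).2 (hT.abs_normal_le j he)
      have b2 : pval Φ x ^ 2 ≤ 1 := by
        have c0 := hT.bubble_nonneg hs hAF hx
        have c1 := (hT.bubble_bounds hs hAF hx).2
        exact pow_le_one₀ c0 c1
      have b3 : pval qt x ^ 2 ≤ Y := by
        rw [pval_normalExt]
        exact hzmax _ (hproj x hx)
      calc ν e j ^ 2 * (pval Φ x ^ 2 * pval qt x ^ 2) ≤ 1 * (1 * Y) := by gcongr
        _ = Y := by ring
    rw [h1]
    refine (Finset.sum_le_sum fun j _ => h2 j).trans ?_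
    rw [Finset.sum_add_distrib, ← Finset.mul_sum, Finset.sum_const, Finset.card_univ,
      Fintype.card_fin, nsmul_eq_mul]
    refine add_le_add le_rfl ?_
    have e1 : ((m + 1 : ℕ) : ℝ) * (1 / (4 * (K * h)) * (Y * (V * h ^ (m + 1)))) =
        c / 2 * (Y * h ^ m) * (V / (V + 1)) := by
      simp only [K]
      push_cast
      field_simp
      ring
    rw [e1]
    refine mul_le_of_le_one_right (by positivity) ?_
    rw [div_le_one (by positivity)]
    linarith
  have hcW : c * (Y * h ^ m) ≤ W := by
    refine H (m + 1) (xe e) (ιe e) h hh e (hT.face_subset_disc he) (hT.measurableSet_face he)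
      (hT.area_ge e he) _ A (fun e => planePoly (ν e) (xe e) h)
      ((Finset.card_le_card hAF).trans hF) (fun e' he' => ⟨totalDegree_planePoly_le _ _ _, ?_⟩)
      (pval Φ) (continuous_pval Φ)
      (fun y hy => (hT.bubble_bounds hs hAF (hT.face_subset he hy)).1) q hq z hz
    obtain ⟨hne, heF⟩ := Finset.mem_erase.1 he'
    obtain ⟨x, hx, hxδ⟩ := hT.separated e he e' heF hne.symm
    refine ⟨x, hT.face_subset_disc he hx, ?_⟩
    rw [pval_planePoly, abs_div, abs_of_pos hh, le_div_iff₀ hh, ← neg_sub, inner_neg_right, abs_neg]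
    exact hxδ
  have hYD : Y * h ^ m ≤ 2 * K / c * h * D := by
    have : c / 2 * (Y * h ^ m) ≤ K * h * D := by linarith
    calc Y * h ^ m = 2 / c * (c / 2 * (Y * h ^ m)) := by field_simp
      _ ≤ 2 / c * (K * h * D) := by gcongr
      _ = _ := by ring
  have hD : 0 ≤ D := Finset.sum_nonneg fun j _ => integral_nonneg fun x => sq_nonneg _
  clear_value D K
  calc h⁻¹ * ∫ x in e, pval q x ^ 2 ∂μHE[m] ≤ h⁻¹ * (Y * (ballVol m * h ^ m)) := by
        gcongr
        exact hT.setIntegral_face_le he (by fun_prop) hY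
          fun x hx => hzmax x (hT.face_subset_disc he hx)
    _ = h⁻¹ * ballVol m * (Y * h ^ m) := by ring
    _ ≤ h⁻¹ * ballVol m * (2 * K / c * h * D) := by gcongr
    _ = 2 * K * ballVol m / c * D := by field_simp
    _ ≤ 2 * K * (ballVol m + 1) / c * D := by gcongr; linarith

end Local

/-! ### Equivalence on one element, Riesz representation, and signs on convex elements -/

section WeakGradient

variable {m : ℕ}

/-- Local equivalence of the weak gradient norm and the discrete `H¹` seminorm, for one scalar
component. -/
lemma exists_local_equiv (m k : ℕ) (hk : 1 ≤ k) {ρ ρ' δ : ℝ} (hρ : 0 < ρ) (hρ' : 0 < ρ')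
    (hδ : 0 < δ) :
    ∃ C > 0, ∀ (T : Set (Pt (m + 1))) (F : Finset (Set (Pt (m + 1))))
      (ν xe : Set (Pt (m + 1)) → Pt (m + 1)) (ιe : Set (Pt (m + 1)) → Pt m →ₗᵢ[ℝ] Pt (m + 1))
      (h : ℝ), IsRegularElement T F ν xe ιe h ρ ρ' δ →
      ∀ s r : ℕ, IsBubbleExponent T F ν xe h s → r = s * F.card + k - 1 →
      ∀ v b g, v.totalDegree ≤ k → (∀ e ∈ F, (b e).totalDegree ≤ k) →
        (∀ j, (g j).totalDegree ≤ r) → WeakRelation T F ν r v b g →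
        (∑ j, ∫ x in T, pval (MvPolynomial.pderiv j v) x ^ 2) +
            h⁻¹ * ∑ e ∈ F, ∫ x in e, pval (b e - v) x ^ 2 ∂μHE[m] ≤
          C * ∑ j, ∫ x in T, pval (g j) x ^ 2 ∧
        ∑ j, ∫ x in T, pval (g j) x ^ 2 ≤
          C * ((∑ j, ∫ x in T, pval (MvPolynomial.pderiv j v) x ^ 2) +
            h⁻¹ * ∑ e ∈ F, ∫ x in e, pval (b e - v) x ^ 2 ∂μHE[m]) := by
  obtain ⟨N, hN⟩ := exists_card_faces_le m hδ
  -- The degree `r` varies with the element, but `2 * N + k` bounds it uniformly.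
  obtain ⟨C₁, hC₁, H₁⟩ := exists_weakGradient_le m (2 * N + k) N hρ
  obtain ⟨C₂, hC₂, H₂⟩ := exists_gradient_le m k N hρ
  obtain ⟨C₃, hC₃, H₃⟩ := exists_jump_le m k N hρ' hδ
  refine ⟨C₁ + (C₂ + N * (C₃ * (2 + 2 * C₂))), by positivity, ?_⟩
  intro T F ν xe ιe h hT s r hs hr v b g hv hb hg hW
  have hcard := hN T F ν xe ιe h ρ ρ' hT
  have hs12 : 1 ≤ s ∧ s ≤ 2 := by rcases hs with rfl | ⟨rfl, -⟩ <;> omega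
  have hsF : s * F.card ≤ 2 * N := Nat.mul_le_mul hs12.2 hcard
  set X := ∑ j, ∫ x in T, pval (g j) x ^ 2
  set G := ∑ j, ∫ x in T, pval (MvPolynomial.pderiv j v) x ^ 2
  set D := ∑ j, ∫ x in T, pval (g j - MvPolynomial.pderiv j v) x ^ 2
  have hX : 0 ≤ X := Finset.sum_nonneg fun j _ => integral_nonneg fun x => sq_nonneg _
  have hG0 : 0 ≤ G := Finset.sum_nonneg fun j _ => integral_nonneg fun x => sq_nonneg _
  have hup := H₁ T F ν xe ιe h ρ' δ hT hcard r (by omega) v b g hg hW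
  have hG : G ≤ C₂ * X := by
    rw [Finset.mul_sum]
    exact Finset.sum_le_sum fun j _ =>
      H₂ T F ν xe ιe h ρ' δ hT hcard s r hs (by omega) v b g hv hW j
  have hD : D ≤ 2 * X + 2 * G := by
    simp only [D, X, G]
    rw [Finset.mul_sum, Finset.mul_sum, ← Finset.sum_add_distrib]
    refine Finset.sum_le_sum fun j _ => ?_
    rw [← integral_const_mul, ← integral_const_mul, ← integral_add
      (hT.integrableOn (f := fun x => 2 * pval (g j) x ^ 2) (by fun_prop))
      (hT.integrableOn (f := fun x => 2 * pval (MvPolynomial.pderiv j v) x ^ 2) (by fun_prop))]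
    refine setIntegral_mono_on (hT.integrableOn (by fun_prop)) (hT.integrableOn (by fun_prop))
      hT.measurableSet fun x _ => ?_
    rw [pval_sub]
    nlinarith [sq_nonneg (pval (g j) x + pval (MvPolynomial.pderiv j v) x)]
  have hJ : h⁻¹ * ∑ e ∈ F, ∫ x in e, pval (b e - v) x ^ 2 ∂μHE[m] ≤ N * (C₃ * D) := by
    rw [Finset.mul_sum]
    have hD0 : 0 ≤ D := Finset.sum_nonneg fun j _ => integral_nonneg fun x => sq_nonneg _
    calc ∑ e ∈ F, h⁻¹ * ∫ x in e, pval (b e - v) x ^ 2 ∂μHE[m] ≤ ∑ e ∈ F, C₃ * D := by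
          refine Finset.sum_le_sum fun e he => ?_
          -- Since `e` is a face and `1 ≤ s`, omitting one factor of the bubble pays for the degree
          -- `k` of the jump: `s (card - 1) + k ≤ s card + k - 1`.
          have h1 : 1 ≤ F.card := Finset.card_pos.2 ⟨e, he⟩
          obtain ⟨n, hn⟩ := Nat.exists_eq_add_of_le' h1
          refine H₃ T F ν xe ιe h ρ hT hcard s r hs ?_ v b g hv hb hW e he
          rw [hr, hn, Nat.add_sub_cancel, Nat.mul_add]
          omega
      _ = F.card * (C₃ * D) := by simp
      _ ≤ N * (C₃ * D) := by gcongr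
  have hDX : D ≤ (2 + 2 * C₂) * X := by linarith
  have hJ' : (N : ℝ) * (C₃ * D) ≤ N * (C₃ * ((2 + 2 * C₂) * X)) := by gcongr
  have hC' : 0 ≤ C₂ + N * (C₃ * (2 + 2 * C₂)) := by positivity
  have hA0 : 0 ≤ h⁻¹ * ∑ e ∈ F, ∫ x in e, pval (b e - v) x ^ 2 ∂μHE[m] :=
    mul_nonneg (inv_nonneg.2 hT.h_pos.le)
      (Finset.sum_nonneg fun e _ => integral_nonneg fun x => sq_nonneg _)
  constructor
  · have : 0 ≤ C₁ * X := by positivity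
    linarith
  · refine hup.trans (mul_le_mul_of_nonneg_right ?_ (add_nonneg hG0 hA0))
    linarith

variable {T : Set (Pt (m + 1))} {F : Finset (Set (Pt (m + 1)))}
  {ν xe : Set (Pt (m + 1)) → Pt (m + 1)} {ιe : Set (Pt (m + 1)) → Pt m →ₗᵢ[ℝ] Pt (m + 1)}
  {h ρ ρ' δ : ℝ}

/-- Linear functionals on polynomials of degree at most `r` are represented by the `L²(T)` inner
product. -/
lemma IsRegularElement.exists_riesz (hT : IsRegularElement T F ν xe ιe h ρ ρ' δ) (hρ : 0 < ρ)
    (r : ℕ) (L : Poly (m + 1) →ₗ[ℝ] ℝ) :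
    ∃ g : Poly (m + 1), g.totalDegree ≤ r ∧
      ∀ ψ : Poly (m + 1), ψ.totalDegree ≤ r → ∫ x in T, pval g x * pval ψ x = L ψ := by
  let V := MvPolynomial.restrictTotalDegree (Fin (m + 1)) ℝ r
  let B : V →ₗ[ℝ] V →ₗ[ℝ] ℝ := LinearMap.mk₂ ℝ
    (fun p q => ∫ x in T, pval (p : Poly (m + 1)) x * pval (q : Poly (m + 1)) x)
    (fun p p' q => by
      rw [← integral_add (hT.integrableOn (by fun_prop)) (hT.integrableOn (by fun_prop))]
      simp [add_mul])
    (fun c p q => by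
      rw [smul_eq_mul, ← integral_const_mul]
      simp [mul_assoc])
    (fun p q q' => by
      rw [← integral_add (hT.integrableOn (by fun_prop)) (hT.integrableOn (by fun_prop))]
      simp [mul_add])
    (fun c p q => by
      rw [smul_eq_mul, ← integral_const_mul]
      simp [mul_left_comm])
  -- A nonzero polynomial vanishes only on a null set, whereas `T` has positive volume. In finite
  -- dimension injectivity gives surjectivity onto the dual.
  have hinj : Function.Injective B := by
    rw [← LinearMap.ker_eq_bot, LinearMap.ker_eq_bot']
    intro p hp
    by_contra hne
    have hp0 : (p : Poly (m + 1)) ≠ 0 := fun h => hne (Subtype.ext h)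
    have h1 : ∫ x in T, pval (p : Poly (m + 1)) x ^ 2 = 0 := by
      have := congrArg (fun f => f p) hp
      simpa [B, sq] using this
    rw [setIntegral_eq_zero_iff_of_nonneg_ae (Filter.Eventually.of_forall fun x => sq_nonneg _)
      (hT.integrableOn (by fun_prop))] at h1
    have h2 : volume T = 0 := by
      have h3 : ∀ᵐ x : Pt (m + 1), pval (p : Poly (m + 1)) x ≠ 0 :=
        (measure_eq_zero_iff_ae_notMem (s := {x | _})).1 (volume_pval_eq_zero hp0)
      rw [measure_eq_zero_iff_ae_notMem]
      have h4 := (ae_restrict_iff' hT.measurableSet).1 h1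
      filter_upwards [h3, h4] with x a1 a2 hx
      exact a1 (by simpa using a2 hx)
    have h5 := hT.volume_ge
    rw [Measure.real, h2, ENNReal.toReal_zero] at h5
    have := hT.h_pos
    have h6 : 0 < ρ * h ^ (m + 1) := by positivity
    linarith
  have hsurj : Function.Surjective B :=
    (LinearMap.injective_iff_surjective_of_finrank_eq_finrank
      (Subspace.dual_finrank_eq (K := ℝ) (V := V)).symm).1 hinj
  obtain ⟨g, hg⟩ := hsurj (L ∘ₗ V.subtype)
  refine ⟨g, (MvPolynomial.mem_restrictTotalDegree _ _ _).1 g.2, fun ψ hψ => ?_⟩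
  have := congrArg (fun f => f ⟨ψ, (MvPolynomial.mem_restrictTotalDegree _ _ _).2 hψ⟩) hg
  simpa [B] using this

/-- The plane functions of a convex element are nonnegative on it. -/
lemma inner_nonneg_of_convex {e : Set (Pt (m + 1))} {n x₀ : Pt (m + 1)}
    {ι : Pt m →ₗᵢ[ℝ] Pt (m + 1)} (hTc : Convex ℝ T) (h_int : (interior T).Nonempty)
    (hreg : closure (interior T) = T) (hn : IsOutwardNormal T e n) (hch : IsFaceChart e x₀ ι)
    (he : e ⊆ frontier T) (heT : e ⊆ T) {x : Pt (m + 1)} (hx : x ∈ T) :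
    0 ≤ inner ℝ n (x₀ - x) := by
  have hx₀ : x₀ ∉ interior T := (he hch.base_mem).2
  obtain ⟨f, hf⟩ := geometric_hahn_banach_open_point hTc.interior isOpen_interior hx₀
  have hle : ∀ a ∈ T, f a ≤ f x₀ := by
    intro a ha
    rw [← hreg] at ha
    exact closure_minimal (fun b hb => (hf b hb).le)
      (isClosed_le f.continuous continuous_const) ha
  -- The face contains a relative neighbourhood of `x₀`, so the supporting functional `f` cannot
  -- increase in any tangential direction, nor in its opposite.
  have htan : ∀ y, f (ι y) = 0 := by
    have hle0 : ∀ y, f (ι y) ≤ 0 := by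
      intro y
      have h0 : (0 : Pt m) ∈ interior (chart x₀ ι ⁻¹' e) := by
        have := hch.base
        rw [hch.intrinsicInterior_eq] at this
        obtain ⟨z, hz, hzx⟩ := this
        have : z = 0 := (isometry_chart x₀ ι).injective (by rw [hzx]; simp [chart])
        rwa [← this]
      have hcont : Continuous fun t : ℝ => t • y := by fun_prop
      have h1 : ∀ᶠ t : ℝ in nhds 0, t • y ∈ interior (chart x₀ ι ⁻¹' e) :=
        hcont.continuousAt.preimage_mem_nhds (isOpen_interior.mem_nhds (by simpa using h0))
      have h2 : ∀ᶠ t : ℝ in nhdsWithin 0 (Set.Ioi 0), 0 < t := self_mem_nhdsWithin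
      obtain ⟨t, ht1, ht2⟩ := ((h1.filter_mono nhdsWithin_le_nhds).and h2).exists
      have h3 : chart x₀ ι (t • y) ∈ e := interior_subset (s := chart x₀ ι ⁻¹' e) ht1
      have h4 := hle _ (heT h3)
      simp only [chart, map_add, map_smul, smul_eq_mul] at h4
      by_contra! hpos
      nlinarith
    intro y
    have h1 := hle0 y
    have h2 := hle0 (-y)
    rw [map_neg, map_neg] at h2
    linarith
  have hdecomp : ∀ a, f a = f x₀ + inner ℝ n (a - x₀) * f n := by
    intro a
    obtain ⟨b, hb⟩ := exists_eq_inner_smul_add hn.unit (hch.orthogonal hn.orthogonal) (a - x₀)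
    have h1 := congrArg f hb
    rw [map_sub, map_add, map_smul, htan, smul_eq_mul] at h1
    linarith
  -- Moving along `-n` enters `T`, so `f n` is nonnegative. If it were zero, `f` would be constant,
  -- against the strict inequality on the interior.
  have hfn : 0 < f n := by
    obtain ⟨ε, hε, hin⟩ := hn.inside x₀ hch.base
    have h1 := hle _ (hin (ε / 2) (by positivity) (by linarith))
    rw [map_sub, map_smul, smul_eq_mul] at h1
    have h2 : 0 ≤ f n := by
      by_contra! hneg
      nlinarith
    refine lt_of_le_of_ne h2 fun h0 => ?_
    obtain ⟨a, ha⟩ := h_int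
    have h3 := hf a ha
    rw [hdecomp a, ← h0] at h3
    linarith
  have h1 := hle x hx
  rw [hdecomp x] at h1
  have h2 : inner ℝ n (x₀ - x) = -inner ℝ n (x - x₀) := by rw [← inner_neg_right, neg_sub]
  rw [h2]
  by_contra! hneg
  have : 0 < inner ℝ n (x - x₀) := by linarith
  nlinarith [mul_pos this hfn]

end WeakGradient

/-! ### Shape regular mesh cells as regular elements -/

section MeshElement

variable {m : ℕ} {Ω : Set (Pt (m + 1))}

lemma mem_facesOn {d : ℕ} {F : Finset (Set (Pt d))} {T e : Set (Pt d)} :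
    e ∈ facesOn F T ↔ e ∈ F ∧ e ⊆ frontier T := by
  classical
  exact Finset.mem_filter

/-- The inclusion of the first `m` coordinates. -/
def coordInclusion (m : ℕ) : Pt m →ₗᵢ[ℝ] Pt (m + 1) :=
  LinearMap.isometryOfOrthonormal (v := (EuclideanSpace.basisFun (Fin m) ℝ).toBasis)
    ((EuclideanSpace.basisFun (Fin m) ℝ).toBasis.constr ℝ
      (EuclideanSpace.basisFun (Fin (m + 1)) ℝ ∘ Fin.castSucc))
    (by simp)
    (by
      have : (((EuclideanSpace.basisFun (Fin m) ℝ).toBasis.constr ℝ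
          (EuclideanSpace.basisFun (Fin (m + 1)) ℝ ∘ Fin.castSucc)) ∘
            (EuclideanSpace.basisFun (Fin m) ℝ).toBasis) =
          EuclideanSpace.basisFun (Fin (m + 1)) ℝ ∘ Fin.castSucc :=
        funext fun i => Basis.constr_basis _ _ _ _
      rw [this]
      exact (EuclideanSpace.basisFun (Fin (m + 1)) ℝ).orthonormal.comp _
        (Fin.castSucc_injective m))

/-- The elements of a shape regular mesh are regular elements. -/
lemma Mesh.exists_isRegularElement (M : Mesh (m + 1) Ω) (hΩ : Bornology.IsBounded Ω)
    {ρv ρe θ σ δ : ℝ} (hρe : 0 < ρe) (hθ : 0 < θ) (hδ : 0 < δ) (hM : M.ShapeRegular ρv ρe θ σ)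
    (hN : M.NoncoplanarFaces δ) {T : Set (Pt (m + 1))} (hTM : T ∈ M.cells) :
    ∃ xe ιe, IsRegularElement T (M.facesOf T) (outwardNormal T) xe ιe (Metric.diam T) ρv
      (ρe * θ ^ m) δ := by
  have hEl := M.isElement T hTM
  have hmemF : ∀ e ∈ M.facesOf T, e ∈ M.faces ∧ e ⊆ frontier T := fun e he =>
    mem_facesOn.1 he
  have hflat : ∀ e ∈ M.facesOf T, IsFlatFace e := fun e he => M.isFlatFace e (hmemF e he).1
  have hnormal : ∀ e ∈ M.facesOf T, IsOutwardNormal T e (outwardNormal T e) := fun e he =>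
    Classical.epsilon_spec (M.normal T hTM e he)
  have hbdd : Bornology.IsBounded T := hΩ.closure.subset (by
    rw [← M.cover]
    exact Set.subset_biUnion_of_mem (u := fun T => T) hTM)
  have hch : ∀ e, ∃ p : Pt (m + 1) × (Pt m →ₗᵢ[ℝ] Pt (m + 1)),
      e ∈ M.facesOf T → IsFaceChart e p.1 p.2 := by
    intro e
    by_cases he : e ∈ M.facesOf T
    · obtain ⟨x₀, ι, h⟩ := (hflat e he).exists_chart
      exact ⟨(x₀, ι), fun _ => h⟩
    -- The family of charts is total; off the faces any isometry serves as a default.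
    · exact ⟨(0, coordInclusion m), fun h => (he h).elim⟩
  choose p hp using hch
  obtain ⟨x, hx⟩ := hEl.connected.nonempty
  have hdiam : 0 < Metric.diam T := by
    obtain ⟨ε, hε, hball⟩ := Metric.isOpen_iff.1 isOpen_interior x hx
    set y : Pt (m + 1) := x + (ε / 2) • EuclideanSpace.single 0 1
    have hy : dist y x = ε / 2 := by
      simp [y, norm_smul, abs_of_pos hε]
    have hyT : y ∈ T := interior_subset (hball (by rw [Metric.mem_ball, hy]; linarith))
    have := Metric.dist_le_diam_of_mem hbdd hyT (interior_subset hx)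
    linarith
  -- The distance to the hyperplane is at most the distance to the foot of the perpendicular, which
  -- is the modulus of the normal component.
  have hsep : ∀ e ∈ M.facesOf T, ∀ e' ∈ M.facesOf T, e ≠ e' →
      ∃ x ∈ e, δ * Metric.diam T ≤ |inner ℝ (outwardNormal T e') (x - (p e').1)| := by
    intro e he e' he' hne
    obtain ⟨x, hx, hxδ⟩ := hN T hTM e he e' he' hne
    refine ⟨x, hx, hxδ.trans ?_⟩
    set n := outwardNormal T e'
    have hn := hnormal e' he'
    set c : ℝ := inner ℝ n (x - (p e').1)
    have hmem : x - c • n ∈ affineSpan ℝ e' := by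
      rw [(hp e' he').mem_affineSpan_iff hn.unit hn.orthogonal, sub_right_comm, inner_sub_right,
        inner_smul_right, real_inner_self_eq_norm_sq, hn.unit]
      simp [c, n]
    refine (Metric.infDist_le_dist_of_mem hmem).trans ?_
    rw [dist_eq_norm, sub_sub_cancel, norm_smul, hn.unit, mul_one, Real.norm_eq_abs]
  refine ⟨fun e => (p e).1, fun e => (p e).2, ?_⟩
  exact
    { isClosed := by rw [← hEl.regular]; exact isClosed_closure
      isBounded := hbdd
      frontier_eq := M.boundary T hTM
      flat := hflat
      normal := hnormal
      noncoplanar := fun e he e' he' hne => by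
        obtain ⟨x, hx, hxδ⟩ := hN T hTM e he e' he' hne
        refine ⟨x, hx, fun hmem => ?_⟩
        rw [Metric.infDist_zero_of_mem (s := (affineSpan ℝ e' : Set (Pt (m + 1)))) hmem] at hxδ
        have := mul_pos hδ hdiam
        linarith
      nonempty := ⟨x, interior_subset hx⟩
      h_pos := hdiam
      chart := hp
      dist_le := fun x hx y hy => Metric.dist_le_diam_of_mem hbdd hx hy
      volume_ge := hM.volume_ge T hTM
      area_ge := fun e he => by
        -- The area bound is in terms of `h_e`; with `θ h_T ≤ h_e` it becomes one in terms of `h_T`,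
        -- at the price of the factor `θ ^ m`.
        have h1 := hM.area_ge T hTM e he
        rw [Nat.add_sub_cancel] at h1
        refine le_trans ?_ h1
        rw [mul_assoc, ← mul_pow]
        have h2 := hM.diam_ge T hTM e he
        gcongr
      separated := hsep }

end MeshElement

/-! ### The weak gradient on a mesh cell and the global norm equivalence -/

section NormEquivalence

variable {m : ℕ} {Ω : Set (Pt (m + 1))}

section

variable {T : Set (Pt (m + 1))} {F : Finset (Set (Pt (m + 1)))}
  {ν xe : Set (Pt (m + 1)) → Pt (m + 1)} {ιe : Set (Pt (m + 1)) → Pt m →ₗᵢ[ℝ] Pt (m + 1)}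
  {h ρ ρ' δ : ℝ}

/-- The functional `ψ ↦ -(v, ∂_j ψ)_T + ⟨b, ψ n_j⟩_{∂T}`. -/
def IsRegularElement.weakFunctional (hT : IsRegularElement T F ν xe ιe h ρ ρ' δ) (v : Poly (m + 1))
    (b : Set (Pt (m + 1)) → Poly (m + 1)) (j : Fin (m + 1)) : Poly (m + 1) →ₗ[ℝ] ℝ where
  toFun ψ := -(∫ x in T, pval v x * pval (MvPolynomial.pderiv j ψ) x) +
    ∑ e ∈ F, ν e j * ∫ x in e, pval (b e) x * pval ψ x ∂μHE[m]
  map_add' ψ ψ' := by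
    have h1 : ∫ x in T, pval v x * pval (MvPolynomial.pderiv j (ψ + ψ')) x =
        (∫ x in T, pval v x * pval (MvPolynomial.pderiv j ψ) x) +
          ∫ x in T, pval v x * pval (MvPolynomial.pderiv j ψ') x := by
      rw [← integral_add (hT.integrableOn (by fun_prop)) (hT.integrableOn (by fun_prop))]
      simp [mul_add]
    have h2 : ∀ e ∈ F, ν e j * ∫ x in e, pval (b e) x * pval (ψ + ψ') x ∂μHE[m] =
        ν e j * ∫ x in e, pval (b e) x * pval ψ x ∂μHE[m] +
          ν e j * ∫ x in e, pval (b e) x * pval ψ' x ∂μHE[m] := fun e he => by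
      rw [← mul_add, ← integral_add (hT.integrableOn_face he (by fun_prop))
        (hT.integrableOn_face he (by fun_prop))]
      simp [mul_add]
    rw [h1, Finset.sum_congr rfl h2, Finset.sum_add_distrib]
    ring
  map_smul' c ψ := by
    have h1 : ∫ x in T, pval v x * pval (MvPolynomial.pderiv j (c • ψ)) x =
        c * ∫ x in T, pval v x * pval (MvPolynomial.pderiv j ψ) x := by
      rw [← integral_const_mul]
      simp [mul_left_comm]
    have h2 : ∀ e ∈ F, ν e j * ∫ x in e, pval (b e) x * pval (c • ψ) x ∂μHE[m] =
        c * (ν e j * ∫ x in e, pval (b e) x * pval ψ x ∂μHE[m]) := fun e _ => by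
      have h3 : ∫ x in e, pval (b e) x * pval (c • ψ) x ∂μHE[m] =
          c * ∫ x in e, pval (b e) x * pval ψ x ∂μHE[m] := by
        rw [← integral_const_mul]
        simp [mul_left_comm]
      rw [h3]
      ring
    rw [h1, Finset.sum_congr rfl h2, ← Finset.mul_sum]
    simp only [RingHom.id_apply, smul_eq_mul]
    ring

end

variable {M : Mesh (m + 1) Ω} {T : Set (Pt (m + 1))}
  {xe : Set (Pt (m + 1)) → Pt (m + 1)} {ιe : Set (Pt (m + 1)) → Pt m →ₗᵢ[ℝ] Pt (m + 1)}
  {h ρ ρ' δ : ℝ}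

/-- The right-hand side of the definition of the weak gradient, entry by entry. -/
lemma weakGradient_rhs_eq
    (hT : IsRegularElement T (M.facesOf T) (outwardNormal T) xe ιe h ρ ρ' δ)
    (v : WeakFunction (m + 1)) (φ : Fin (m + 1) → Fin (m + 1) → Poly (m + 1)) :
    -(∫ x in T, ∑ i, pval (v.inner T i) x * ∑ j, pval (MvPolynomial.pderiv j (φ i j)) x)
      + ∑ e ∈ M.facesOf T, ∫ x in e,
          ∑ i, pval (v.bdry e i) x * (∑ j, pval (φ i j) x * outwardNormal T e j) ∂μHE[m] =
    ∑ i, ∑ j, hT.weakFunctional (v.inner T i) (fun e => v.bdry e i) j (φ i j) := by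
  have h1 : ∫ x in T, ∑ i, pval (v.inner T i) x * ∑ j, pval (MvPolynomial.pderiv j (φ i j)) x =
      ∑ i, ∑ j, ∫ x in T, pval (v.inner T i) x * pval (MvPolynomial.pderiv j (φ i j)) x := by
    simp only [Finset.mul_sum]
    rw [integral_finsetSum _ fun i _ => hT.integrableOn (by fun_prop)]
    refine Finset.sum_congr rfl fun i _ => ?_
    rw [integral_finsetSum _ fun j _ => hT.integrableOn (by fun_prop)]
  have h2 : ∀ e ∈ M.facesOf T, ∫ x in e,
      ∑ i, pval (v.bdry e i) x * (∑ j, pval (φ i j) x * outwardNormal T e j) ∂μHE[m] =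
      ∑ i, ∑ j, outwardNormal T e j * ∫ x in e, pval (v.bdry e i) x * pval (φ i j) x ∂μHE[m] := by
    intro e he
    simp only [Finset.mul_sum]
    rw [integral_finsetSum _ fun i _ => hT.integrableOn_face he (by fun_prop)]
    refine Finset.sum_congr rfl fun i _ => ?_
    rw [integral_finsetSum _ fun j _ => hT.integrableOn_face he (by fun_prop)]
    refine Finset.sum_congr rfl fun j _ => ?_
    rw [← integral_const_mul]
    congr 1
    ext x
    ring
  rw [h1, Finset.sum_congr rfl h2]
  simp only [IsRegularElement.weakFunctional, LinearMap.coe_mk, AddHom.coe_mk,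
    Finset.sum_add_distrib, Finset.sum_neg_distrib]
  congr 1
  rw [Finset.sum_comm]
  exact Finset.sum_congr rfl fun i _ => Finset.sum_comm

lemma integral_sum_mul_eq {F : Finset (Set (Pt (m + 1)))} {ν : Set (Pt (m + 1)) → Pt (m + 1)}
    (hT : IsRegularElement T F ν xe ιe h ρ ρ' δ)
    (G φ : Fin (m + 1) → Fin (m + 1) → Poly (m + 1)) :
    ∫ x in T, ∑ i, ∑ j, pval (G i j) x * pval (φ i j) x =
      ∑ i, ∑ j, ∫ x in T, pval (G i j) x * pval (φ i j) x := by
  rw [integral_finsetSum _ fun i _ => hT.integrableOn (by fun_prop)]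
  refine Finset.sum_congr rfl fun i _ => ?_
  rw [integral_finsetSum _ fun j _ => hT.integrableOn (by fun_prop)]

/-- The discrete weak gradient exists. -/
lemma isWeakGradient_weakGradient
    (hT : IsRegularElement T (M.facesOf T) (outwardNormal T) xe ιe h ρ ρ' δ) (hρ : 0 < ρ) (r : ℕ)
    (v : WeakFunction (m + 1)) : IsWeakGradient M r T v (weakGradient M r T v) := by
  refine Classical.epsilon_spec (p := IsWeakGradient M r T v) ?_
  choose G hG hGeq using fun i j =>
    hT.exists_riesz hρ r (hT.weakFunctional (v.inner T i) (fun e => v.bdry e i) j)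
  refine ⟨G, hG, fun φ hφ => ?_⟩
  refine Eq.trans ?_ (weakGradient_rhs_eq hT v φ).symm
  rw [integral_sum_mul_eq hT]
  exact Finset.sum_congr rfl fun i _ => Finset.sum_congr rfl fun j _ => hGeq i j _ (hφ i j)

/-- Integration by parts in the definition of the weak gradient. -/
lemma IsWeakGradient.weakRelation
    (hT : IsRegularElement T (M.facesOf T) (outwardNormal T) xe ιe h ρ ρ' δ) {r : ℕ}
    {v : WeakFunction (m + 1)} {G : Fin (m + 1) → Fin (m + 1) → Poly (m + 1)}
    (hG : IsWeakGradient M r T v G) (i : Fin (m + 1)) :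
    WeakRelation T (M.facesOf T) (outwardNormal T) r (v.inner T i) (fun e => v.bdry e i) (G i) := by
  intro j ψ hψ
  -- A test matrix with a single nonzero entry decouples the defining identity into scalar ones.
  let φ : Fin (m + 1) → Fin (m + 1) → Poly (m + 1) :=
    fun i' j' => if i' = i then (if j' = j then ψ else 0) else 0
  have h0 : ∫ x in T, ∑ i, ∑ j, pval (G i j) x * pval (φ i j) x =
      ∑ i', ∑ j, hT.weakFunctional (v.inner T i') (fun e => v.bdry e i') j (φ i' j) :=
    (hG.eq φ (fun i' j' => by
      simp only [φ]
      split_ifs <;> simp [hψ])).trans (weakGradient_rhs_eq hT v φ)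
  have hsum : ∀ A : Fin (m + 1) → Fin (m + 1) → Poly (m + 1) → ℝ, (∀ i' j', A i' j' 0 = 0) →
      ∑ i', ∑ j', A i' j' (φ i' j') = A i j ψ := by
    intro A hA
    rw [Finset.sum_eq_single i, Finset.sum_eq_single j]
    · simp [φ]
    · intro j' _ hj'
      simp [φ, hj', hA]
    · simp
    · intro i' _ hi'
      simp [φ, hi', hA]
    · simp
  rw [integral_sum_mul_eq hT, hsum (fun i' j' p => ∫ x in T, pval (G i' j') x * pval p x)
    (fun i' j' => by simp),
    hsum (fun i' j' p => hT.weakFunctional (v.inner T i') (fun e => v.bdry e i') j' p)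
    (fun i' j' => by simp)] at h0
  rw [h0]
  simp only [IsRegularElement.weakFunctional, LinearMap.coe_mk, AddHom.coe_mk]
  -- The divergence theorem for the product moves the derivative from `ψ` to `v₀` and turns the
  -- boundary term into the jump `v_b - v₀`.
  have hdiv := hT.integral_pderiv (v.inner T i * ψ) j
  simp only [Derivation.leibniz, smul_eq_mul, pval_add, pval_mul] at hdiv
  rw [integral_add (hT.integrableOn (f := fun x => pval (v.inner T i) x *
      pval (MvPolynomial.pderiv j ψ) x) (by fun_prop)) (hT.integrableOn (f := fun x => pval ψ x *
      pval (MvPolynomial.pderiv j (v.inner T i)) x) (by fun_prop))] at hdiv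
  have hface : ∀ e ∈ M.facesOf T,
      outwardNormal T e j * ∫ x in e, pval (v.bdry e i - v.inner T i) x * pval ψ x ∂μHE[m] =
      outwardNormal T e j * ∫ x in e, pval (v.bdry e i) x * pval ψ x ∂μHE[m] -
        outwardNormal T e j * ∫ x in e, pval (v.inner T i) x * pval ψ x ∂μHE[m] := by
    intro e he
    rw [← mul_sub, ← integral_sub (hT.integrableOn_face he (by fun_prop))
      (hT.integrableOn_face he (by fun_prop))]
    simp only [pval_sub, sub_mul]
  rw [Finset.sum_congr rfl hface, Finset.sum_sub_distrib, ← hdiv]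
  have hcomm : ∫ x in T, pval (MvPolynomial.pderiv j (v.inner T i)) x * pval ψ x =
      ∫ x in T, pval ψ x * pval (MvPolynomial.pderiv j (v.inner T i)) x := by
    simp only [mul_comm]
  rw [hcomm]
  ring

lemma reaction_nonneg {d : ℕ} {κ : Matrix (Fin d) (Fin d) ℝ} (hκ : κ.PosDef) (T : Set (Pt d))
    (v : WeakFunction d) : 0 ≤ reaction κ T v := by
  refine integral_nonneg fun x => ?_
  have := hκ.inv.posSemidef.dotProduct_mulVec_nonneg (fun i => pval (v.inner T i) x)
  rw [dotProduct_comm]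
  simpa using this

/-- The energy norm and the discrete `H¹` norm are equivalent, in any dimension `m + 1`. -/
theorem exists_energyNorm_equiv (m k : ℕ) (hk : 1 ≤ k) {ρv ρe θ σ δ : ℝ} (hρv : 0 < ρv)
    (hρe : 0 < ρe) (hθ : 0 < θ) (hδ : 0 < δ) :
    ∃ C₁ C₂ : ℝ, 0 < C₁ ∧ 0 < C₂ ∧
      ∀ (Ω : Set (Pt (m + 1))), Bornology.IsBounded Ω →
      ∀ M : Mesh (m + 1) Ω, M.ShapeRegular ρv ρe θ σ → M.NoncoplanarFaces δ →
      ∀ r : Set (Pt (m + 1)) → ℕ, M.AdmissibleDegree k r →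
      ∀ κ : Matrix (Fin (m + 1)) (Fin (m + 1)) ℝ, κ.PosDef →
      ∀ v : WeakFunction (m + 1), MemVh M k v →
        C₁ * discreteH1Norm M κ v ≤ energyNorm M κ r v ∧
        energyNorm M κ r v ≤ C₂ * discreteH1Norm M κ v := by
  obtain ⟨C, hC, H⟩ := exists_local_equiv m k hk hρv (ρ' := ρe * θ ^ m) (by positivity) hδ
  -- Replacing `C` by `C + 1` lets the common reaction term pass through with any positive definite
  -- κ; the square root comes from comparing squared norms cell by cell.
  refine ⟨(√(C + 1))⁻¹, √(C + 1), by positivity, by positivity, ?_⟩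
  intro Ω hΩ M hM hN r hr κ hκ v hv
  have hcell : ∀ T ∈ M.cells,
      ((∫ x in T, ∑ i, ∑ j, pval (MvPolynomial.pderiv j (v.inner T i)) x ^ 2)
        + reaction κ T v
        + (Metric.diam T)⁻¹ * ∑ e ∈ M.facesOf T,
            ∫ x in e, ∑ i, (pval (v.inner T i) x - pval (v.bdry e i) x) ^ 2 ∂μHE[m + 1 - 1]) ≤
        (C + 1) * ((∫ x in T, ∑ i, ∑ j, pval (weakGradient M (r T) T v i j) x ^ 2)
          + reaction κ T v) ∧
      ((∫ x in T, ∑ i, ∑ j, pval (weakGradient M (r T) T v i j) x ^ 2) + reaction κ T v) ≤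
        (C + 1) * ((∫ x in T, ∑ i, ∑ j, pval (MvPolynomial.pderiv j (v.inner T i)) x ^ 2)
        + reaction κ T v
        + (Metric.diam T)⁻¹ * ∑ e ∈ M.facesOf T,
            ∫ x in e, ∑ i, (pval (v.inner T i) x - pval (v.bdry e i) x) ^ 2 ∂μHE[m + 1 - 1]) := by
    intro T hTM
    obtain ⟨xe, ιe, hT⟩ := M.exists_isRegularElement hΩ hρe hθ hδ hM hN hTM
    have hG := isWeakGradient_weakGradient hT hρv (r T) v
    set G := weakGradient M (r T) T v
    have hEl := M.isElement T hTM
    -- The degree `2N + k - 1` allows squared plane functions. With `N + k - 1` only first powers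
    -- fit, and convexity makes them nonnegative.
    obtain ⟨s, hs, hrs⟩ : ∃ s, IsBubbleExponent T (M.facesOf T) (outwardNormal T) xe
        (Metric.diam T) s ∧ r T = s * (M.facesOf T).card + k - 1 := by
      rcases hr T hTM with h | ⟨hconv, h⟩
      · exact ⟨2, Or.inl rfl, h⟩
      · refine ⟨1, Or.inr ⟨rfl, fun e he x hx => ?_⟩, by rw [one_mul]; exact h⟩
        rw [pval_planePoly]
        exact div_nonneg (inner_nonneg_of_convex hconv hEl.connected.nonempty hEl.regular
          (hT.normal e he) (hT.chart e he) (mem_facesOn.1 he).2 (hT.face_subset he) hx)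
          hT.h_pos.le
    have hloc := fun i => H T (M.facesOf T) (outwardNormal T) xe ιe (Metric.diam T) hT s (r T) hs
      hrs (v.inner T i) (fun e => v.bdry e i) (G i) (hv.inner_deg T hTM i)
      (fun e he => hv.bdry_deg e (mem_facesOn.1 he).1 i) (fun j => hG.deg i j)
      (hG.weakRelation hT i)
    have hX : ∫ x in T, ∑ i, ∑ j, pval (G i j) x ^ 2 = ∑ i, ∑ j, ∫ x in T, pval (G i j) x ^ 2 := by
      simp only [sq]
      exact integral_sum_mul_eq hT G G
    have hD : ∫ x in T, ∑ i, ∑ j, pval (MvPolynomial.pderiv j (v.inner T i)) x ^ 2 =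
        ∑ i, ∑ j, ∫ x in T, pval (MvPolynomial.pderiv j (v.inner T i)) x ^ 2 := by
      simp only [sq]
      exact integral_sum_mul_eq hT (fun i j => MvPolynomial.pderiv j (v.inner T i))
        (fun i j => MvPolynomial.pderiv j (v.inner T i))
    have hJ : (Metric.diam T)⁻¹ * ∑ e ∈ M.facesOf T,
        ∫ x in e, ∑ i, (pval (v.inner T i) x - pval (v.bdry e i) x) ^ 2 ∂μHE[m + 1 - 1] =
        ∑ i, (Metric.diam T)⁻¹ * ∑ e ∈ M.facesOf T,
          ∫ x in e, pval (v.bdry e i - v.inner T i) x ^ 2 ∂μHE[m] := by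
      rw [← Finset.mul_sum, Finset.sum_comm, Nat.add_sub_cancel]
      congr 1
      refine Finset.sum_congr rfl fun e he => ?_
      rw [← integral_finsetSum _ fun i _ => hT.integrableOn_face he (by fun_prop)]
      congr 1
      ext x
      refine Finset.sum_congr rfl fun i _ => ?_
      rw [pval_sub]
      ring
    rw [hX, hD, hJ]
    have h1 := Finset.sum_le_sum fun i (_ : i ∈ Finset.univ) => (hloc i).1
    have h2 := Finset.sum_le_sum fun i (_ : i ∈ Finset.univ) => (hloc i).2
    rw [← Finset.mul_sum, Finset.sum_add_distrib] at h1 h2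
    have hR := reaction_nonneg hκ T v
    have hX0 : 0 ≤ ∑ i, ∑ j, ∫ x in T, pval (G i j) x ^ 2 :=
      Finset.sum_nonneg fun i _ => Finset.sum_nonneg fun j _ => integral_nonneg fun x => sq_nonneg _
    have hCR : 0 ≤ C * reaction κ T v := by positivity
    constructor
    · linarith
    · have := hX0.trans h2
      have h3 := nonneg_of_mul_nonneg_right this hC
      linarith
  have hE : energyNorm M κ r v ≤ √(C + 1) * discreteH1Norm M κ v := by
    rw [energyNorm, discreteH1Norm, ← Real.sqrt_mul (by positivity), Finset.mul_sum]
    exact Real.sqrt_le_sqrt (Finset.sum_le_sum fun T hT => (hcell T hT).2)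
  have hH : discreteH1Norm M κ v ≤ √(C + 1) * energyNorm M κ r v := by
    rw [energyNorm, discreteH1Norm, ← Real.sqrt_mul (by positivity), Finset.mul_sum]
    exact Real.sqrt_le_sqrt (Finset.sum_le_sum fun T hT => (hcell T hT).1)
  refine ⟨?_, hE⟩
  rw [inv_mul_le_iff₀ (by positivity)]
  exact hH

end NormEquivalence

end WG

end

theorem mainTheorem4 (d : ℕ) (hd : d = 2 ∨ d = 3) (k : ℕ) (hk : 1 ≤ k)
    (ρv ρe θ σ δ : ℝ) (hρv : 0 < ρv) (hρe : 0 < ρe) (hθ : 0 < θ) (hσ : 0 < σ) (hδ : 0 < δ) :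
    ∃ C₁ C₂ : ℝ, 0 < C₁ ∧ 0 < C₂ ∧
      ∀ (Ω : Set (WG.Pt d)), IsOpen Ω → IsConnected Ω → Bornology.IsBounded Ω →
      ∀ M : WG.Mesh d Ω, M.ShapeRegular ρv ρe θ σ → M.NoncoplanarFaces δ →
      ∀ r : Set (WG.Pt d) → ℕ, M.AdmissibleDegree k r →
      ∀ κ : Matrix (Fin d) (Fin d) ℝ, κ.PosDef →
      ∀ v : WG.WeakFunction d, WG.MemVh M k v →
        C₁ * WG.discreteH1Norm M κ v ≤ WG.energyNorm M κ r v ∧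
        WG.energyNorm M κ r v ≤ C₂ * WG.discreteH1Norm M κ v := by
  -- The ambient dimension is written `m + 1` so that the faces have charts on `Pt m`.
  obtain ⟨m, rfl⟩ : ∃ m, d = m + 1 := by
    rcases hd with rfl | rfl
    exacts [⟨1, rfl⟩, ⟨2, rfl⟩]
  obtain ⟨C₁, C₂, h₁, h₂, H⟩ := WG.exists_energyNorm_equiv m k hk (σ := σ) hρv hρe hθ hδ
  exact ⟨C₁, C₂, h₁, h₂, fun Ω _ _ hΩ => H Ω hΩ⟩
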